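/- **Setting.** Let $T$ be a tree with finite node set $V[T]$ and a root $r\in V[T]$, let $L$ be a finite family of links (each link $\ell$ has two endpoints in $V[T]$; parallel links are allowed), and let $c\in\mathbb{R}_{\ge 0}^L$ be link costs. A link $\ell$ with endpoints $u,v$ *covers* an edge $e\in E[T]$ if $e$ lies on the $u$–$v$ path in $T$; $\mathrm{cov}(e)$ is the set of links covering $e$, and a set of links covers $E[T]$ if each edge of $T$ is covered by one of its links. Let $z\in\mathbb{R}_{\ge 0}^L$ be a feasible solution of the natural LP, i.e. $\sum_{\ell\in \mathrm{cov}(e)} z_\ell\ge 1$ for all $e\in E[T]$. A link is a *cross-link* if its endpoints lie in two different trees of the forest obtained from $T$ by deleting $r$, and an *in-link* otherwise. Let $z^{cr}$ be the vector that agrees with $z$ on cross-links and is $0$ on in-links, and let $z^{in}=z-z^{cr}$. **Lemma.** Let $\lambda>1$ be a real constant. For every such $T$, $r$, $L$, $c$, $z$ there is a set of links $S\subseteq L$ that covers $E[T]$ and has cost $$c(S)=\sum_{\ell\in S}c_\ell\;\le\; 2\lambda\, c^{\intercal} z^{in}+\frac{4\lambda}{3(\lambda-1)}\, c^{\intercal}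 z^{cr}.$$ Moreover, there is a polynomial-time algorithm (depending only on $\lambda$) that, given $T$, $r$, $L$ and rational $c$, $z$, computes such a set $S$. Here the algorithm is a program for a random access machine with logarithmic cost, and its running time is bounded by a polynomial in the encoding length (in bits) of the input. -/

import Mathlib

/-! ## Weighted tree augmentation: a rooted tree with links and a fractional solution -/

/-- The edge set `P_{uv}` of the path between `u` and `v` in `T`
(in a tree there is exactly one such path). -/
def pathEdges {V : Type*} (T : SimpleGraph V) (u v : V) : Set (Sym2 V) :=
  {e | ∃ p : T.Walk u v, p.IsPath ∧ e ∈ p.edges}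

/-- A pair `(T, z)` with a root: a tree `T` on `n` vertices, a root vertex, `m` links (parallel
links are allowed) with endpoints `src ℓ`, `tgt ℓ` and nonnegative real costs, and a
fractional solution `z` of the natural LP, i.e. `z ≥ 0` and every tree edge is covered to an
extent of at least `1` by the links whose tree path contains it. -/
structure RootedPair (n m : ℕ) where
  tree : SimpleGraph (Fin n)
  isTree : tree.IsTree
  root : Fin n
  src : Fin m → Fin n
  tgt : Fin m → Fin n
  cost : Fin m → ℝ
  cost_nonneg : ∀ ℓ, 0 ≤ cost ℓ
  z : Fin m → ℝ
  z_nonneg : ∀ ℓ, 0 ≤ z ℓ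
  feasible : ∀ e ∈ tree.edgeSet,
    1 ≤ ∑ ℓ : Fin m, Set.indicator {ℓ | e ∈ pathEdges tree (src ℓ) (tgt ℓ)} z ℓ

namespace RootedPair

/-- `ℓ` is a cross-link: its endpoints lie in two different trees of the forest obtained from the
tree by removing the root. All other links are in-links. -/
def IsCross {n m : ℕ} (P : RootedPair n m) (ℓ : Fin m) : Prop :=
  ∃ (hu : P.src ℓ ≠ P.root) (hv : P.tgt ℓ ≠ P.root),
    ¬ (P.tree.induce {w | w ≠ P.root}).Reachable ⟨P.src ℓ, hu⟩ ⟨P.tgt ℓ, hv⟩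

/-- `z^cr`: the part of `z` on cross-links. -/
noncomputable def zCross {n m : ℕ} (P : RootedPair n m) : Fin m → ℝ :=
  Set.indicator {ℓ | P.IsCross ℓ} P.z

/-- `z^in = z - z^cr`: the part of `z` on in-links. -/
noncomputable def zIn {n m : ℕ} (P : RootedPair n m) (ℓ : Fin m) : ℝ :=
  P.z ℓ - P.zCross ℓ

/-- The set `S` of links covers all edges of the tree. -/
def CoversTree {n m : ℕ} (P : RootedPair n m) (S : Finset (Fin m)) : Prop :=
  ∀ e ∈ P.tree.edgeSet, ∃ ℓ ∈ S, e ∈ pathEdges P.tree (P.src ℓ) (P.tgt ℓ)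

/-- `S` covers all tree edges at cost at most `2λ cᵀz^in + 4λ/(3(λ-1)) cᵀz^cr`. -/
def IsRounding {n m : ℕ} (P : RootedPair n m) (lam : ℝ) (S : Finset (Fin m)) : Prop :=
  P.CoversTree S ∧
    ∑ ℓ ∈ S, P.cost ℓ ≤
      2 * lam * ∑ ℓ, P.cost ℓ * P.zIn ℓ
        + 4 * lam / (3 * (lam - 1)) * ∑ ℓ, P.cost ℓ * P.zCross ℓ

end RootedPair

/-! ## Random access machine programs with logarithmic cost

Programs work on integer variables `x₀, x₁, …` and integer arrays `a₀, a₁, …`. Every operation is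
charged the bit length of all numbers (operands, addresses, results) it touches. A program is a
finite object, so it mentions finitely many variables and arrays. -/

namespace RAM

/-- Bit length of an integer, without sign. -/
def bits (k : ℤ) : ℕ := Nat.size k.natAbs

/-- Memory: variables `var x` and array cells `arr a i`. -/
structure State where
  var : ℕ → ℤ
  arr : ℕ → ℤ → ℤ

/-- Arithmetic expressions. -/
inductive Expr where
  | lit (k : ℤ)
  | var (x : ℕ)
  | get (a : ℕ) (i : Expr)
  | add (e f : Expr)
  | sub (e f : Expr)
  | mul (e f : Expr)
  | div (e f : Expr)

/-- The value of an expression (`div` is integer division, with value `0` for divisor `0`). -/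
def Expr.eval (s : State) : Expr → ℤ
  | .lit k => k
  | .var x => s.var x
  | .get a i => s.arr a (i.eval s)
  | .add e f => e.eval s + f.eval s
  | .sub e f => e.eval s - f.eval s
  | .mul e f => e.eval s * f.eval s
  | .div e f => e.eval s / f.eval s

/-- The cost of evaluating an expression: every node is charged `1` plus the bit length of its
value. -/
def Expr.cost (s : State) : Expr → ℕ
  | .lit k => 1 + bits k
  | .var x => 1 + bits (s.var x)
  | .get a i => 1 + bits (s.arr a (i.eval s)) + i.cost s
  | .add e f => 1 + bits (e.eval s + f.eval s) + e.cost s + f.cost s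
  | .sub e f => 1 + bits (e.eval s - f.eval s) + e.cost s + f.cost s
  | .mul e f => 1 + bits (e.eval s * f.eval s) + e.cost s + f.cost s
  | .div e f => 1 + bits (e.eval s / f.eval s) + e.cost s + f.cost s

/-- Programs: assignment `x := e`, array write `a[i] := e`, sequencing, branching on `0 < e`,
and looping while `0 < e`. -/
inductive Prog where
  | skip
  | assign (x : ℕ) (e : Expr)
  | put (a : ℕ) (i e : Expr)
  | seq (p q : Prog)
  | ite (e : Expr) (p q : Prog)
  | loop (e : Expr) (p : Prog)

/-- `Run p s s' t`: started in memory `s`, the program `p` halts in memory `s'` after time `t`. -/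
inductive Run : Prog → State → State → ℕ → Prop where
  | skip (s : State) : Run .skip s s 1
  | assign (s : State) (x : ℕ) (e : Expr) :
      Run (.assign x e) s ⟨Function.update s.var x (e.eval s), s.arr⟩ (1 + e.cost s)
  | put (s : State) (a : ℕ) (i e : Expr) :
      Run (.put a i e) s
        ⟨s.var, Function.update s.arr a (Function.update (s.arr a) (i.eval s) (e.eval s))⟩
        (1 + i.cost s + e.cost s)
  | seq {p q : Prog} {s s₁ s₂ : State} {t₁ t₂ : ℕ} :
      Run p s s₁ t₁ → Run q s₁ s₂ t₂ → Run (.seq p q) s s₂ (1 + t₁ + t₂)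
  | ite_true {e : Expr} {p q : Prog} {s s' : State} {t : ℕ} :
      0 < e.eval s → Run p s s' t → Run (.ite e p q) s s' (1 + e.cost s + t)
  | ite_false {e : Expr} {p q : Prog} {s s' : State} {t : ℕ} :
      ¬ 0 < e.eval s → Run q s s' t → Run (.ite e p q) s s' (1 + e.cost s + t)
  | loop_true {e : Expr} {p : Prog} {s s₁ s₂ : State} {t₁ t₂ : ℕ} :
      0 < e.eval s → Run p s s₁ t₁ → Run (.loop e p) s₁ s₂ t₂ →
        Run (.loop e p) s s₂ (1 + e.cost s + t₁ + t₂)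
  | loop_false {e : Expr} {p : Prog} {s : State} :
      ¬ 0 < e.eval s → Run (.loop e p) s s (1 + e.cost s)

/-- An array holding `f 0, …, f (k-1)` in cells `0, …, k-1`, and `0` elsewhere. -/
def arrayOf {k : ℕ} (f : Fin k → ℤ) (i : ℤ) : ℤ :=
  if h : 0 ≤ i ∧ i.toNat < k then f ⟨i.toNat, h.2⟩ else 0

end RAM

namespace RootedPair

/-- The adjacency matrix of the tree, entry `(i, j)` in cell `i * n + j`. -/
noncomputable def adjArray {n m : ℕ} (P : RootedPair n m) : ℤ → ℤ :=
  Set.indicator {k | ∃ i j : Fin n, P.tree.Adj i j ∧ k = (i : ℤ) * n + j} 1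

/-- The initial memory for the pair `P` whose costs and LP values are the rational numbers
`c ℓ`, `x ℓ`, given by numerators and denominators. All other memory is `0`. -/
noncomputable def input {n m : ℕ} (P : RootedPair n m) (c x : Fin m → ℚ) : RAM.State where
  var
    | 0 => n
    | 1 => m
    | 2 => (P.root : ℕ)
    | _ => 0
  arr
    | 0 => P.adjArray
    | 1 => RAM.arrayOf fun ℓ => ((P.src ℓ : ℕ) : ℤ)
    | 2 => RAM.arrayOf fun ℓ => ((P.tgt ℓ : ℕ) : ℤ)
    | 3 => RAM.arrayOf fun ℓ => (c ℓ).num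
    | 4 => RAM.arrayOf fun ℓ => ((c ℓ).den : ℤ)
    | 5 => RAM.arrayOf fun ℓ => (x ℓ).num
    | 6 => RAM.arrayOf fun ℓ => ((x ℓ).den : ℤ)
    | _ => 0

/-- The encoding length of the input: one bit per entry of the adjacency matrix, plus the bit
lengths of all other input numbers. -/
def inputSize {n m : ℕ} (P : RootedPair n m) (c x : Fin m → ℚ) : ℕ :=
  n * n + RAM.bits n + RAM.bits m + RAM.bits (P.root : ℕ)
    + ∑ ℓ, (RAM.bits (P.src ℓ : ℕ) + RAM.bits (P.tgt ℓ : ℕ)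
        + RAM.bits (c ℓ).num + RAM.bits (c ℓ).den + RAM.bits (x ℓ).num + RAM.bits (x ℓ).den)

end RootedPair

/-- The set of links that a final memory describes: link `ℓ` is selected iff cell `ℓ` of
array `7` is nonzero. -/
def RAM.State.output (s : RAM.State) (m : ℕ) : Finset (Fin m) :=
  Finset.univ.filter fun ℓ => s.arr 7 ((ℓ : ℕ) : ℤ) ≠ 0

/-! A vertex v ≠ r stands for the edge to its parent. Put θ = (λ-1)/λ and separate the edges by the
total value of `z^cr` on the links covering them. Where this value is below θ, the in-links
contribute at least 1-θ = 1/λ, so λ·z^in covers these edges fractionally. Cut every link at its apex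
into two vertical pieces, each as expensive as the link. Covering by vertical pieces loses nothing
against the LP: raising dual values at lowest uncovered vertices, followed by reverse deletion,
leaves pieces whose total cost is at most the value of a dual solution (`DualInv`,
`PruneInv.unique`, `PruneInv.upOut`). As a link consists of two pieces, weak duality bounds this by
2λ·cᵀz^in.

The other edges are closed under passing upwards, and a cross-link that covers an edge covers all
edges above it (`cov_of_cross`). Hence only the lowest of them matter, and a cross-link covers at
most two of these. This is an edge cover problem with fractional solution λ/(λ-1)·z^cr, and a factor
4/3 suffices: take a cheapest assignment σ, where the arc u → v costs as much as the cheapest way to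
serve u and v. Its potentials, added at each vertex, put at most 2c_ℓ on each cross-link
(`PairOut.gamma_feasible`), so the assignment costs at most twice the LP value. Colour the arcs of
the cycles of σ with three colours, consecutive arcs differently. Deleting one colour leaves an arc
at every vertex (`PairOut.chosen_covers`), and the three deletions together keep each arc of a
proper cycle twice (`PairOut.sum_cost_le`). The cheapest of them costs at most 2/3 of the
assignment. `le_of_bound` combines both parts.

The threshold matters only through the set of edges it separates, so the program tries the cross
value of every vertex as threshold and keeps the cheapest cover; it does not even depend on λ. It is
written in a small language with bounded sums, searches and loops. Its correctness is shown with
weakest preconditions (`Cmd.wp`), and `Cmd.exists_run_comp` translates it to the machine: loop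
lengths are bounded by the size variables, and all numbers have polynomially many bits, so the time
is polynomial.

Existence for real data follows from the algorithm: approximate costs and values from above by
rationals, and use that there are finitely many covers, each cheap enough on a closed set of data
(`exists_isRounding`). -/

namespace RAM

/-! ### Memory updates -/

def State.setV (s : State) (x : ℕ) (v : ℤ) : State := ⟨Function.update s.var x v, s.arr⟩

def State.setA (s : State) (a : ℕ) (i v : ℤ) : State :=
  ⟨s.var, Function.update s.arr a (Function.update (s.arr a) i v)⟩

@[simp] theorem State.setV_var (s : State) (x : ℕ) (v : ℤ) (y : ℕ) :
    (s.setV x v).var y = if y = x then v else s.var y := by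
  simp [State.setV, Function.update_apply]

@[simp] theorem State.setV_arr (s : State) (x : ℕ) (v : ℤ) : (s.setV x v).arr = s.arr := rfl

@[simp] theorem State.setA_var (s : State) (a : ℕ) (i v : ℤ) : (s.setA a i v).var = s.var := rfl

@[simp] theorem State.setA_arr (s : State) (a : ℕ) (i v : ℤ) (b : ℕ) :
    (s.setA a i v).arr b = if b = a then Function.update (s.arr a) i v else s.arr b := by
  by_cases h : b = a
  · subst h; simp [State.setA]
  · simp [State.setA, h]

/-! ### Rich expressions -/

/-- The least `k` with `P k`, or `N` if there is none below `N`. -/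
noncomputable def fnd (N : ℕ) (P : ℕ → Prop) : ℕ := sInf {k | N ≤ k ∨ P k}

theorem fnd_le (N : ℕ) (P : ℕ → Prop) : fnd N P ≤ N := Nat.sInf_le (Or.inl le_rfl)

theorem fnd_spec {N : ℕ} {P : ℕ → Prop} (h : fnd N P < N) : P (fnd N P) := by
  have h0 : fnd N P ∈ {k | N ≤ k ∨ P k} := Nat.sInf_mem ⟨N, Or.inl le_rfl⟩
  rcases h0 with h1 | h1
  · omega
  · exact h1

theorem fnd_lt_iff {N : ℕ} {P : ℕ → Prop} : fnd N P < N ↔ ∃ k < N, P k := by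
  constructor
  · intro h
    exact ⟨_, h, fnd_spec h⟩
  · rintro ⟨k, hk, hP⟩
    exact lt_of_le_of_lt (Nat.sInf_le (Or.inr hP)) hk

theorem fnd_congr {N : ℕ} {P Q : ℕ → Prop} (h : ∀ k < N, (P k ↔ Q k)) : fnd N P = fnd N Q := by
  unfold fnd
  congr 1
  ext k
  by_cases hk : k < N
  · simp [h k hk]
  · simp [not_lt.1 hk]

/-- Search for a minimizer of `f` among the `k < N` with `P k`. -/
theorem fnd_argmin {N : ℕ} {P : ℕ → Prop} {f : ℕ → ℤ} (h : ∃ k < N, P k) :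
    fnd N (fun k => P k ∧ ∀ j < N, P j → f k ≤ f j) < N := by
  classical
  rw [fnd_lt_iff]
  obtain ⟨k, hk, hP⟩ := h
  obtain ⟨i, hi, hmin⟩ := Finset.exists_min_image ((Finset.range N).filter P) f
    ⟨k, by simp [hk, hP]⟩
  simp only [Finset.mem_filter, Finset.mem_range] at hi hmin
  exact ⟨i, hi.1, hi.2, fun j hj hPj => hmin j ⟨hj, hPj⟩⟩

open Classical in
/-- Truth value. -/
noncomputable def tv (p : Prop) : ℤ := if p then 1 else 0

@[simp] theorem tv_pos {p : Prop} : 0 < tv p ↔ p := by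
  unfold tv; split_ifs with h <;> simp [h]

theorem tv_true {p : Prop} (h : p) : tv p = 1 := by simp [tv, h]

theorem tv_false {p : Prop} (h : ¬ p) : tv p = 0 := by simp [tv, h]

theorem tv_nonneg (p : Prop) : 0 ≤ tv p := by unfold tv; split_ifs <;> simp

theorem tv_le_one (p : Prop) : tv p ≤ 1 := by unfold tv; split_ifs <;> simp

theorem abs_tv_le (p : Prop) : |tv p| ≤ 1 := by unfold tv; split_ifs <;> simp

theorem tv_congr {p q : Prop} (h : p ↔ q) : tv p = tv q := by rw [propext h]

theorem tv_ne_zero {p : Prop} : tv p ≠ 0 ↔ p := by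
  unfold tv; split_ifs with h <;> simp [h]

/-- Expressions with bounded sums and bounded search; `sum x b e` is the sum of `e` over all values
`x < b`, and `find x b e` is the least `x < b` with `0 < e`, or `b` if there is none. -/
inductive X where
  | lit (k : ℤ)
  | var (x : ℕ)
  | get (a : ℕ) (i : X)
  | add (e f : X)
  | sub (e f : X)
  | mul (e f : X)
  | div (e f : X)
  | lt (e f : X)
  | sum (x b : ℕ) (e : X)
  | find (x b : ℕ) (e : X)

namespace X

noncomputable def eval : X → State → ℤ
  | lit k, _ => k
  | var x, s => s.var x
  | get a i, s => s.arr a (i.eval s)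
  | add e f, s => e.eval s + f.eval s
  | sub e f, s => e.eval s - f.eval s
  | mul e f, s => e.eval s * f.eval s
  | div e f, s => e.eval s / f.eval s
  | lt e f, s => tv (e.eval s < f.eval s)
  | sum x b e, s => ∑ k ∈ Finset.range (s.var b).toNat, e.eval (s.setV x k)
  | find x b e, s => fnd (s.var b).toNat fun k => 0 < e.eval (s.setV x k)

/-- Well-formedness: free variables are below `100`, loop bounds are size variables. -/
def wf : X → Bool
  | lit _ => true
  | var x => decide (x < 100)
  | get _ i => i.wf
  | add e f => e.wf && f.wf
  | sub e f => e.wf && f.wf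
  | mul e f => e.wf && f.wf
  | div e f => e.wf && f.wf
  | lt e f => e.wf && f.wf
  | sum x b e => decide (10 ≤ x) && decide (x < 100) && decide (b < 10) && e.wf
  | find x b e => decide (10 ≤ x) && decide (x < 100) && decide (b < 10) && e.wf

/-- If all numbers in memory are at most `B`, then all values are at most `B ^ deg`. -/
def deg : X → ℕ
  | lit k => k.natAbs + 1
  | var _ => 1
  | get _ i => i.deg + 1
  | add e f => e.deg + f.deg + 1
  | sub e f => e.deg + f.deg + 1
  | mul e f => e.deg + f.deg
  | div e f => e.deg + f.deg
  | lt e f => e.deg + f.deg + 1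
  | sum _ _ e => e.deg + 1
  | find _ _ e => e.deg + 1

/-- Compilation, with the result in variable `d` and the variables after `d` as scratch space. -/
def comp : ℕ → X → Prog
  | d, lit k => .assign d (.lit k)
  | d, var x => .assign d (.var x)
  | d, get a i => .seq (i.comp d) (.assign d (.get a (.var d)))
  | d, add e f => .seq (e.comp d) (.seq (f.comp (d + 1)) (.assign d (.add (.var d) (.var (d + 1)))))
  | d, sub e f => .seq (e.comp d) (.seq (f.comp (d + 1)) (.assign d (.sub (.var d) (.var (d + 1)))))
  | d, mul e f => .seq (e.comp d) (.seq (f.comp (d + 1)) (.assign d (.mul (.var d) (.var (d + 1)))))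
  | d, div e f => .seq (e.comp d) (.seq (f.comp (d + 1)) (.assign d (.div (.var d) (.var (d + 1)))))
  | d, lt e f => .seq (e.comp d) (.seq (f.comp (d + 1))
      (.ite (.sub (.var (d + 1)) (.var d)) (.assign d (.lit 1)) (.assign d (.lit 0))))
  -- Variable `d` accumulates, `d + 1` counts down from the bound, and `d + 2` saves the outer value
  -- of `x`, which is restored at the end.
  | d, sum x b e =>
      .seq (.assign d (.lit 0)) (.seq (.assign (d + 1) (.var b)) (.seq (.assign (d + 2) (.var x))
        (.seq (.loop (.var (d + 1))
          (.seq (.assign (d + 1) (.sub (.var (d + 1)) (.lit 1)))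
            (.seq (.assign x (.var (d + 1))) (.seq (e.comp (d + 3))
              (.assign d (.add (.var d) (.var (d + 3))))))))
          (.assign x (.var (d + 2))))))
  -- The counter runs downwards, so the last hit that overwrites `d` is the least one.
  | d, find x b e =>
      .seq (.assign d (.var b)) (.seq (.assign (d + 1) (.var b)) (.seq (.assign (d + 2) (.var x))
        (.seq (.loop (.var (d + 1))
          (.seq (.assign (d + 1) (.sub (.var (d + 1)) (.lit 1)))
            (.seq (.assign x (.var (d + 1))) (.seq (e.comp (d + 3))
              (.ite (.var (d + 3)) (.assign d (.var (d + 1))) .skip)))))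
          (.assign x (.var (d + 2))))))

/-- A bound on the running time of the compiled expression. -/
noncomputable def time : X → Polynomial ℕ
  | lit k => 10 * (.X + 1) + .C (bits k)
  | var _ => 10 * (.X + 1)
  | get _ i => i.time + 10 * (.X + 1)
  | add e f => e.time + f.time + 10 * (.X + 1)
  | sub e f => e.time + f.time + 10 * (.X + 1)
  | mul e f => e.time + f.time + 10 * (.X + 1)
  | div e f => e.time + f.time + 10 * (.X + 1)
  | lt e f => e.time + f.time + 20 * (.X + 1)
  | sum _ _ e => .X * (e.time + 60 * (.X + 1)) + 80 * (.X + 1)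
  | find _ _ e => .X * (e.time + 60 * (.X + 1)) + 80 * (.X + 1)

end X

/-! ### Bounds on memory and on values -/

/-- Bounds for the running time analysis: `B` bounds all numbers the source program stores, `D` the
degrees of its expressions, `L` the values of size variables and the bit lengths of all numbers. -/
structure Ctx where
  B : ℤ
  D : ℕ
  L : ℕ
  two_le : 2 ≤ B
  one_le : 1 ≤ D
  pow_lt : B ^ D < 2 ^ L

/-- Three kinds of variables: those below 10 are sizes and bound the lengths of loops, so they are
at most `L` itself; those below 100 belong to the source program and are at most `B`; the others are
scratch space for intermediate values of expressions, which are only known to be below `2 ^ L`. -/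
structure Good (Γ : Ctx) (s : State) : Prop where
  size_nonneg : ∀ x < 10, 0 ≤ s.var x
  size_le : ∀ x < 10, s.var x ≤ Γ.L
  var_le : ∀ x < 100, |s.var x| ≤ Γ.B
  arr_le : ∀ a i, |s.arr a i| ≤ Γ.B
  lt : ∀ x, |s.var x| < 2 ^ Γ.L

/-- Agreement of two memories up to scratch variables. -/
structure Agree (s s' : State) : Prop where
  var : ∀ x < 100, s'.var x = s.var x
  arr : s'.arr = s.arr

theorem Agree.refl (s : State) : Agree s s := ⟨fun _ _ => rfl, rfl⟩

theorem Agree.trans {s s' s'' : State} (h : Agree s s') (h' : Agree s' s'') : Agree s s'' :=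
  ⟨fun x hx => (h'.var x hx).trans (h.var x hx), h'.arr.trans h.arr⟩

theorem Agree.setV {s s' : State} (h : Agree s s') (x : ℕ) (v : ℤ) :
    Agree (s.setV x v) (s'.setV x v) := by
  refine ⟨fun y hy => ?_, h.arr⟩
  simp only [State.setV_var]
  split_ifs
  · rfl
  · exact h.var y hy

theorem Agree.setA {s s' : State} (h : Agree s s') (a : ℕ) (i v : ℤ) :
    Agree (s.setA a i v) (s'.setA a i v) := by
  refine ⟨h.var, ?_⟩
  funext b
  simp only [State.setA_arr, h.arr]

theorem Good.setV_scratch {Γ : Ctx} {s : State} (h : Good Γ s) {d : ℕ} (hd : 100 ≤ d) {v : ℤ}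
    (hv : |v| < 2 ^ Γ.L) : Good Γ (s.setV d v) := by
  constructor
  · intro x hx
    rw [State.setV_var, if_neg (by omega)]
    exact h.size_nonneg x hx
  · intro x hx
    rw [State.setV_var, if_neg (by omega)]
    exact h.size_le x hx
  · intro x hx
    rw [State.setV_var, if_neg (by omega)]
    exact h.var_le x hx
  · exact h.arr_le
  · intro x
    rw [State.setV_var]
    split_ifs
    · exact hv
    · exact h.lt x

theorem Ctx.lt_of_le_pow (Γ : Ctx) {v : ℤ} {k : ℕ} (hk : k ≤ Γ.D) (hv : |v| ≤ Γ.B ^ k) :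
    |v| < 2 ^ Γ.L := by
  refine lt_of_le_of_lt (hv.trans ?_) Γ.pow_lt
  exact pow_le_pow_right₀ (by linarith [Γ.two_le]) hk

theorem Ctx.lt_of_le (Γ : Ctx) {v : ℤ} (hv : |v| ≤ Γ.B) : |v| < 2 ^ Γ.L :=
  Γ.lt_of_le_pow Γ.one_le (by simpa using hv)

theorem Good.setV_var {Γ : Ctx} {s : State} (h : Good Γ s) {x : ℕ} (hx : 10 ≤ x) {v : ℤ}
    (hv : |v| ≤ Γ.B) : Good Γ (s.setV x v) := by
  constructor
  · intro y hy
    rw [State.setV_var, if_neg (by omega)]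
    exact h.size_nonneg y hy
  · intro y hy
    rw [State.setV_var, if_neg (by omega)]
    exact h.size_le y hy
  · intro y hy
    rw [State.setV_var]
    split_ifs
    · exact hv
    · exact h.var_le y hy
  · exact h.arr_le
  · intro y
    rw [State.setV_var]
    split_ifs
    · exact Γ.lt_of_le hv
    · exact h.lt y

theorem Good.setA {Γ : Ctx} {s : State} (h : Good Γ s) (a : ℕ) (i : ℤ) {v : ℤ}
    (hv : |v| ≤ Γ.B) : Good Γ (s.setA a i v) := by
  refine ⟨h.size_nonneg, h.size_le, h.var_le, ?_, h.lt⟩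
  intro b j
  rw [State.setA_arr]
  split_ifs with hb
  · rw [Function.update_apply]
    split_ifs
    · exact hv
    · exact h.arr_le a j
  · exact h.arr_le b j

theorem bits_le {k : ℤ} {L : ℕ} (h : |k| < 2 ^ L) : bits k ≤ L := by
  unfold bits
  rw [Nat.size_le]
  zify
  exact h

theorem bits_le' {k : ℤ} {L : ℕ} (h : |k| < 2 * 2 ^ L) : bits k ≤ L + 1 :=
  bits_le (by rw [pow_succ]; linarith)

/-- Rule for loops that run exactly `N` times. -/
theorem exists_run_loop {e : Expr} {p : Prog} {c T : ℕ} (Inv : ℕ → State → Prop)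
    (hstep : ∀ k s, Inv (k + 1) s → 0 < e.eval s ∧ e.cost s ≤ c ∧
      ∃ s' t, Run p s s' t ∧ t ≤ T ∧ Inv k s')
    (hend : ∀ s, Inv 0 s → ¬ 0 < e.eval s ∧ e.cost s ≤ c) :
    ∀ N s, Inv N s → ∃ s' t, Run (.loop e p) s s' t ∧ t ≤ N * (1 + c + T) + (1 + c) ∧ Inv 0 s' := by
  intro N
  induction N with
  | zero =>
    intro s hs
    exact ⟨s, _, .loop_false (hend s hs).1, by have := (hend s hs).2; omega, hs⟩
  | succ k ih =>
    intro s hs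
    obtain ⟨h1, h2, s1, t1, hr, ht, hI⟩ := hstep k s hs
    obtain ⟨s2, t2, hr2, ht2, hI2⟩ := ih s1 hI
    refine ⟨s2, _, .loop_true h1 hr hr2, ?_, hI2⟩
    have : (k + 1) * (1 + c + T) = k * (1 + c + T) + (1 + c + T) := by ring
    omega

theorem X.eval_congr {e : X} (hw : e.wf) : ∀ {s s' : State}, Agree s s' → e.eval s' = e.eval s := by
  induction e with
  | lit k => intros; rfl
  | var x =>
    intro s s' h
    simp only [X.wf, decide_eq_true_eq] at hw
    exact h.var x hw
  | get a i ih =>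
    intro s s' h
    simp only [X.wf] at hw
    simp only [X.eval, ih hw h, h.arr]
  | add e f ihe ihf | sub e f ihe ihf | mul e f ihe ihf | div e f ihe ihf | lt e f ihe ihf =>
    intro s s' h
    simp only [X.wf, Bool.and_eq_true] at hw
    simp only [X.eval, ihe hw.1 h, ihf hw.2 h]
  | sum x b e ih | find x b e ih =>
    intro s s' h
    simp only [X.wf, Bool.and_eq_true, decide_eq_true_eq] at hw
    simp only [X.eval, h.var b (by omega), ih hw.2 (h.setV x _)]

theorem X.abs_eval_le {Γ : Ctx} {e : X} (hw : e.wf) :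
    ∀ {s : State}, Good Γ s → |e.eval s| ≤ Γ.B ^ e.deg := by
  have hB := Γ.two_le
  have hB0 : (0 : ℤ) ≤ Γ.B := by linarith
  have hone : ∀ k, (1 : ℤ) ≤ Γ.B ^ k := fun k => one_le_pow₀ (by linarith)
  -- `B ^ k + B ^ l ≤ 2 * B ^ k * B ^ l ≤ B ^ (k + l + 1)`, which explains the extra 1 in the degree
  -- of sums and differences.
  have hadd : ∀ {a b : ℤ} {k l : ℕ}, |a| ≤ Γ.B ^ k → |b| ≤ Γ.B ^ l →
      |a| + |b| ≤ Γ.B ^ (k + l + 1) := by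
    intro a b k l ha hb
    have h1 := hone k
    have h2 := hone l
    have h3 : Γ.B ^ (k + l + 1) = Γ.B * (Γ.B ^ k * Γ.B ^ l) := by ring
    have h4 : 2 * (Γ.B ^ k * Γ.B ^ l) ≤ Γ.B * (Γ.B ^ k * Γ.B ^ l) := by
      apply mul_le_mul_of_nonneg_right hB; positivity
    nlinarith
  induction e with
  | lit k =>
    intro s _
    simp only [X.eval, X.deg]
    have h1 : (k.natAbs : ℤ) < 2 ^ k.natAbs := by exact_mod_cast Nat.lt_two_pow_self
    have h2 : (2 : ℤ) ^ k.natAbs ≤ Γ.B ^ k.natAbs := pow_le_pow_left₀ (by norm_num) hB _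
    have h3 : Γ.B ^ k.natAbs ≤ Γ.B ^ (k.natAbs + 1) :=
      pow_le_pow_right₀ (by linarith) (by omega)
    rw [Int.abs_eq_natAbs]
    linarith
  | var x =>
    intro s h
    simp only [X.wf, decide_eq_true_eq] at hw
    simpa [X.eval, X.deg] using h.var_le x hw
  | get a i ih =>
    intro s h
    simp only [X.eval, X.deg]
    refine (h.arr_le _ _).trans ?_
    have := hone i.deg
    rw [pow_succ]
    nlinarith
  | add e f ihe ihf =>
    intro s h
    simp only [X.wf, Bool.and_eq_true] at hw
    exact (abs_add_le _ _).trans (hadd (ihe hw.1 h) (ihf hw.2 h))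
  | sub e f ihe ihf =>
    intro s h
    simp only [X.wf, Bool.and_eq_true] at hw
    exact (abs_sub _ _).trans (hadd (ihe hw.1 h) (ihf hw.2 h))
  | mul e f ihe ihf =>
    intro s h
    simp only [X.wf, Bool.and_eq_true] at hw
    simp only [X.eval, X.deg, abs_mul, pow_add]
    exact mul_le_mul (ihe hw.1 h) (ihf hw.2 h) (abs_nonneg _) (by positivity)
  | div e f ihe ihf =>
    intro s h
    simp only [X.wf, Bool.and_eq_true] at hw
    simp only [X.eval, X.deg]
    refine (Int.abs_ediv_le_abs _ _).trans ((ihe hw.1 h).trans ?_)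
    exact pow_le_pow_right₀ (by linarith) (by omega)
  | lt e f ihe ihf =>
    intro s h
    exact (abs_tv_le _).trans (hone _)
  | sum x b e ih =>
    intro s h
    simp only [X.wf, Bool.and_eq_true, decide_eq_true_eq] at hw
    simp only [X.eval, X.deg]
    have hN := h.var_le b (by omega)
    have h0 := h.size_nonneg b hw.1.2
    rw [abs_of_nonneg h0] at hN
    refine (Finset.abs_sum_le_sum_abs _ _).trans ?_
    refine (Finset.sum_le_card_nsmul _ _ (Γ.B ^ e.deg) ?_).trans ?_
    · intro k hk
      rw [Finset.mem_range] at hk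
      apply ih hw.2
      apply h.setV_var hw.1.1.1
      rw [abs_of_nonneg (by positivity)]
      omega
    · rw [Finset.card_range, nsmul_eq_mul, pow_succ, mul_comm]
      apply mul_le_mul_of_nonneg_left _ (by positivity)
      omega
  | find x b e ih =>
    intro s h
    simp only [X.wf, Bool.and_eq_true, decide_eq_true_eq] at hw
    simp only [X.eval, X.deg]
    have hN := h.var_le b (by omega)
    have h0 := h.size_nonneg b hw.1.2
    rw [abs_of_nonneg h0] at hN
    rw [abs_of_nonneg (by positivity)]
    have h1 := fnd_le (s.var b).toNat fun k => 0 < e.eval (s.setV x k)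
    have h2 := hone e.deg
    have h3 : Γ.B * 1 ≤ Γ.B * Γ.B ^ e.deg := mul_le_mul_of_nonneg_left h2 hB0
    rw [pow_succ, mul_comm]
    omega

end RAM

/-! ### Correctness and running time of compiled expressions -/

namespace RAM

/-- The effect of running a compiled expression. -/
structure Computes (Γ : Ctx) (d : ℕ) (s s' : State) (v : ℤ) : Prop where
  arr : s'.arr = s.arr
  var : ∀ x < d, s'.var x = s.var x
  val : s'.var d = v
  good : Good Γ s'

theorem Good.bits_var {Γ : Ctx} {s : State} (h : Good Γ s) (x : ℕ) : bits (s.var x) ≤ Γ.L :=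
  bits_le (h.lt x)

theorem Good.bits_arr {Γ : Ctx} {s : State} (h : Good Γ s) (a : ℕ) (i : ℤ) :
    bits (s.arr a i) ≤ Γ.L :=
  bits_le (Γ.lt_of_le (h.arr_le a i))

theorem run_assign (s : State) (x : ℕ) (e : Expr) :
    Run (.assign x e) s (s.setV x (e.eval s)) (1 + e.cost s) := .assign s x e

theorem Ctx.two_le_pow (Γ : Ctx) : (2 : ℤ) < 2 ^ Γ.L :=
  lt_of_le_of_lt Γ.two_le (Γ.lt_of_le (abs_of_nonneg (by linarith [Γ.two_le])).le |> fun h => by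
    rwa [abs_of_nonneg (by linarith [Γ.two_le])] at h)

theorem Ctx.one_lt_L (Γ : Ctx) : 1 < Γ.L := by
  have h : (2 : ℤ) ^ 1 < 2 ^ Γ.L := by simpa using Γ.two_le_pow
  exact (pow_lt_pow_iff_right₀ (by norm_num)).1 h

theorem Good.bits_sub {Γ : Ctx} {s : State} (h : Good Γ s) (x y : ℕ) :
    bits (s.var x - s.var y) ≤ Γ.L + 1 := by
  apply bits_le'
  have h1 := h.lt x
  have h2 := h.lt y
  rw [abs_lt] at *
  constructor <;> linarith

/-- The common part of all binary operations: the value of `e` waits in `d` while `f` is evaluated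
with scratch space from `d + 1` on, and then `op` combines the two. -/
theorem exists_run_bin {Γ : Ctx} {s : State} {d : ℕ} (hd : 100 ≤ d) {e f : X} {t₁ t₂ : ℕ}
    (he : ∃ s' t, Run (e.comp d) s s' t ∧ t ≤ t₁ ∧ Computes Γ d s s' (e.eval s))
    (hf : ∀ s, Good Γ s → ∃ s' t, Run (f.comp (d + 1)) s s' t ∧ t ≤ t₂ ∧
      Computes Γ (d + 1) s s' (f.eval s)) (hw : f.wf)
    {op : Prog} {g : ℤ → ℤ → ℤ}
    (hop : ∀ s : State, Good Γ s → s.var d = e.eval s → True →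
      |g (s.var d) (s.var (d + 1))| < 2 ^ Γ.L → ∃ t, Run op s
        (s.setV d (g (s.var d) (s.var (d + 1)))) t ∧ t ≤ 6 * (Γ.L + 1) + 4)
    (hev : ∀ s' : State, Agree s s' → e.eval s' = e.eval s)
    (hv : |g (e.eval s) (f.eval s)| < 2 ^ Γ.L) :
    ∃ s' t, Run (.seq (e.comp d) (.seq (f.comp (d + 1)) op)) s s' t ∧
      t ≤ t₁ + t₂ + 10 * (Γ.L + 1) ∧ Computes Γ d s s' (g (e.eval s) (f.eval s)) := by
  obtain ⟨s1, u1, r1, hu1, c1⟩ := he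
  obtain ⟨s2, u2, r2, hu2, c2⟩ := hf s1 c1.good
  have hag : Agree s s1 := ⟨fun x hx => c1.var x (by omega), c1.arr⟩
  have hag2 : Agree s s2 := hag.trans ⟨fun x hx => c2.var x (by omega), c2.arr⟩
  have h1 : s2.var d = e.eval s := by rw [c2.var d (by omega), c1.val]
  have h2 : s2.var (d + 1) = f.eval s := by rw [c2.val, X.eval_congr hw hag]
  obtain ⟨u3, r3, hu3⟩ := hop s2 c2.good (by rw [h1, hev s2 hag2]) trivial (by rwa [h1, h2])
  have hL := Γ.one_lt_L
  refine ⟨_, _, .seq r1 (.seq r2 r3), by omega, ?_, ?_, ?_, ?_⟩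
  · rw [State.setV_arr, c2.arr, c1.arr]
  · intro x hx
    rw [State.setV_var, if_neg (by omega), c2.var x (by omega), c1.var x hx]
  · rw [State.setV_var, if_pos rfl, h1, h2]
  · exact c2.good.setV_scratch hd (by rwa [h1, h2])

/-- The degree bound keeps all computed values below `2 ^ L`, so an elementary operation takes time
linear in `L`; sums and searches run at most `L` rounds because their bounds are size variables. -/
theorem X.exists_run_comp {Γ : Ctx} {e : X} (hw : e.wf) (hdeg : e.deg ≤ Γ.D) :
    ∀ {d : ℕ}, 100 ≤ d → ∀ {s : State}, Good Γ s →
      ∃ s' t, Run (e.comp d) s s' t ∧ t ≤ e.time.eval Γ.L ∧ Computes Γ d s s' (e.eval s) := by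
  have hL2 := Γ.two_le_pow
  induction e with
  | lit k =>
    intro d hd s hs
    have hb := Γ.lt_of_le_pow hdeg (X.abs_eval_le hw hs)
    refine ⟨_, _, run_assign _ _ _, ?_, rfl, ?_, ?_, hs.setV_scratch hd hb⟩
    · simp [X.time, Expr.cost]; omega
    · intro x hx; rw [State.setV_var, if_neg (by omega)]
    · simp [Expr.eval, X.eval]
  | var y =>
    intro d hd s hs
    have hb := Γ.lt_of_le_pow hdeg (X.abs_eval_le hw hs)
    refine ⟨_, _, run_assign _ _ _, ?_, rfl, ?_, ?_, hs.setV_scratch hd hb⟩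
    · have := hs.bits_var y
      simp [X.time, Expr.cost]; omega
    · intro x hx; rw [State.setV_var, if_neg (by omega)]
    · simp [Expr.eval, X.eval]
  | get a i ih =>
    intro d hd s hs
    simp only [X.wf] at hw
    simp only [X.deg] at hdeg
    obtain ⟨s1, t1, r1, ht1, c1⟩ := ih hw (by omega) hd hs
    refine ⟨_, _, .seq r1 (run_assign _ _ _), ?_, c1.arr, ?_, ?_, c1.good.setV_scratch hd ?_⟩
    · have h1 := c1.good.bits_var d
      have h2 := c1.good.bits_arr a (s1.var d)
      simp [X.time, Expr.cost, Expr.eval]; omega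
    · intro x hx
      rw [State.setV_var, if_neg (by omega), c1.var x hx]
    · simp [Expr.eval, X.eval, c1.val, c1.arr]
    · exact Γ.lt_of_le (c1.good.arr_le _ _)
  | add e f ihe ihf =>
    intro d hd s hs
    have hb := Γ.lt_of_le_pow hdeg (X.abs_eval_le hw hs)
    simp only [X.wf, Bool.and_eq_true] at hw
    simp only [X.deg] at hdeg
    have := exists_run_bin (g := (· + ·)) (op := .assign d (.add (.var d) (.var (d + 1)))) hd
      (ihe hw.1 (by omega) hd hs) (fun s hs => ihf hw.2 (by omega) (by omega) hs) hw.2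
      (by
        intro s hs _ _ hv
        refine ⟨_, run_assign _ _ _, ?_⟩
        have h1 := hs.bits_var d
        have h2 := hs.bits_var (d + 1)
        have h3 := bits_le hv
        simp only [Expr.cost, Expr.eval]
        omega) (fun s' h => X.eval_congr hw.1 h) hb
    simpa [X.comp, X.eval, X.time] using this
  | sub e f ihe ihf =>
    intro d hd s hs
    have hb := Γ.lt_of_le_pow hdeg (X.abs_eval_le hw hs)
    simp only [X.wf, Bool.and_eq_true] at hw
    simp only [X.deg] at hdeg
    have := exists_run_bin (g := (· - ·)) (op := .assign d (.sub (.var d) (.var (d + 1)))) hd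
      (ihe hw.1 (by omega) hd hs) (fun s hs => ihf hw.2 (by omega) (by omega) hs) hw.2
      (by
        intro s hs _ _ hv
        refine ⟨_, run_assign _ _ _, ?_⟩
        have h1 := hs.bits_var d
        have h2 := hs.bits_var (d + 1)
        have h3 := bits_le hv
        simp only [Expr.cost, Expr.eval]
        omega) (fun s' h => X.eval_congr hw.1 h) hb
    simpa [X.comp, X.eval, X.time] using this
  | mul e f ihe ihf =>
    intro d hd s hs
    have hb := Γ.lt_of_le_pow hdeg (X.abs_eval_le hw hs)
    simp only [X.wf, Bool.and_eq_true] at hw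
    simp only [X.deg] at hdeg
    have := exists_run_bin (g := (· * ·)) (op := .assign d (.mul (.var d) (.var (d + 1)))) hd
      (ihe hw.1 (by omega) hd hs) (fun s hs => ihf hw.2 (by omega) (by omega) hs) hw.2
      (by
        intro s hs _ _ hv
        refine ⟨_, run_assign _ _ _, ?_⟩
        have h1 := hs.bits_var d
        have h2 := hs.bits_var (d + 1)
        have h3 := bits_le hv
        simp only [Expr.cost, Expr.eval]
        omega) (fun s' h => X.eval_congr hw.1 h) hb
    simpa [X.comp, X.eval, X.time] using this
  | div e f ihe ihf =>
    intro d hd s hs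
    have hb := Γ.lt_of_le_pow hdeg (X.abs_eval_le hw hs)
    simp only [X.wf, Bool.and_eq_true] at hw
    simp only [X.deg] at hdeg
    have := exists_run_bin (g := (· / ·)) (op := .assign d (.div (.var d) (.var (d + 1)))) hd
      (ihe hw.1 (by omega) hd hs) (fun s hs => ihf hw.2 (by omega) (by omega) hs) hw.2
      (by
        intro s hs _ _ hv
        refine ⟨_, run_assign _ _ _, ?_⟩
        have h1 := hs.bits_var d
        have h2 := hs.bits_var (d + 1)
        have h3 := bits_le hv
        simp only [Expr.cost, Expr.eval]
        omega) (fun s' h => X.eval_congr hw.1 h) hb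
    simpa [X.comp, X.eval, X.time] using this
  | lt e f ihe ihf =>
    intro d hd s hs
    have hb := Γ.lt_of_le_pow hdeg (X.abs_eval_le hw hs)
    simp only [X.wf, Bool.and_eq_true] at hw
    simp only [X.deg] at hdeg
    have := exists_run_bin (g := fun x y => tv (x < y))
      (op := .ite (.sub (.var (d + 1)) (.var d)) (.assign d (.lit 1)) (.assign d (.lit 0))) hd
      (ihe hw.1 (by omega) hd hs) (fun s hs => ihf hw.2 (by omega) (by omega) hs) hw.2
      (by
        intro s hs _ _ hv
        have h1 := hs.bits_var d
        have h2 := hs.bits_var (d + 1)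
        have h3 := hs.bits_sub (d + 1) d
        have hb1 : bits 1 = 1 := by simp [bits]
        have hb0 : bits 0 = 0 := by simp [bits]
        by_cases hlt : s.var d < s.var (d + 1)
        · have hr := run_assign s d (.lit 1)
          simp only [tv_true hlt]
          refine ⟨_, .ite_true (by simpa [Expr.eval] using hlt) hr, ?_⟩
          simp only [Expr.cost, Expr.eval, hb1]
          omega
        · have hr := run_assign s d (.lit 0)
          simp only [tv_false hlt]
          refine ⟨_, .ite_false (by simpa [Expr.eval] using hlt) hr, ?_⟩
          simp only [Expr.cost, Expr.eval, hb0]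
          omega) (fun s' h => X.eval_congr hw.1 h) hb
    obtain ⟨s', t, h1, h2, h3⟩ := this
    refine ⟨s', t, h1, ?_, h3⟩
    simp [X.time]
    omega
  | sum x b e ih =>
    intro d hd s hs
    have hw0 := hw
    have hdeg0 := hdeg
    simp only [X.wf, Bool.and_eq_true, decide_eq_true_eq] at hw
    simp only [X.deg] at hdeg
    obtain ⟨⟨⟨hx10, hx⟩, hb⟩, hwe⟩ := hw
    set N := (s.var b).toNat with hN
    have hNb : ((N : ℕ) : ℤ) = s.var b := Int.toNat_of_nonneg (hs.size_nonneg b hb)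
    have hNB : (N : ℤ) ≤ Γ.B := by
      rw [hNb]; exact (le_abs_self _).trans (hs.var_le b (by omega))
    have hNL : N ≤ Γ.L := by
      have := hs.size_le b hb; omega
    set F : ℕ → ℤ := fun k => e.eval (s.setV x k) with hF
    have hFb : ∀ k < N, |F k| ≤ Γ.B ^ e.deg := fun k hk => X.abs_eval_le hwe
      (hs.setV_var hx10 (by rw [abs_of_nonneg (by positivity)]; omega))
    -- The accumulator holds partial sums, so these have to be small as well; at most `B` terms
    -- raise the degree by one.
    have hpart : ∀ k ≤ N, |∑ i ∈ Finset.Ico k N, F i| < 2 ^ Γ.L := by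
      intro k hk
      refine Γ.lt_of_le_pow hdeg ?_
      refine (Finset.abs_sum_le_sum_abs _ _).trans ?_
      refine (Finset.sum_le_card_nsmul _ _ (Γ.B ^ e.deg) ?_).trans ?_
      · intro i hi
        rw [Finset.mem_Ico] at hi
        exact hFb i hi.2
      · rw [Nat.card_Ico, nsmul_eq_mul, pow_succ, mul_comm]
        apply mul_le_mul_of_nonneg_left _ (pow_nonneg (by linarith [Γ.two_le]) _)
        omega
    set s3 := ((s.setV d 0).setV (d + 1) (s.var b)).setV (d + 2) (s.var x) with hs3
    have g3 : Good Γ s3 :=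
      ((hs.setV_scratch hd (by simp)).setV_scratch (by omega) (hs.lt b)).setV_scratch
        (by omega) (hs.lt x)
    set Inv : ℕ → State → Prop := fun k s' => k ≤ N ∧ s'.arr = s.arr ∧
      (∀ y < d, y ≠ x → s'.var y = s.var y) ∧ s'.var d = ∑ i ∈ Finset.Ico k N, F i ∧
      s'.var (d + 1) = k ∧ s'.var (d + 2) = s.var x ∧ Good Γ s' with hInv
    have hI3 : Inv N s3 := by
      refine ⟨le_rfl, rfl, ?_, ?_, ?_, ?_, g3⟩
      · intro y hy _
        simp [hs3, State.setV_var, show y ≠ d by omega, show y ≠ d + 1 by omega,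
          show y ≠ d + 2 by omega]
      · simp [hs3]
      · simp [hs3, hNb]
      · simp [hs3]
    obtain ⟨s4, t4, r4, ht4, h4⟩ := exists_run_loop (e := .var (d + 1))
      (p := (.seq (.assign (d + 1) (.sub (.var (d + 1)) (.lit 1)))
            (.seq (.assign x (.var (d + 1))) (.seq (e.comp (d + 3))
              (.assign d (.add (.var d) (.var (d + 3)))))))) (c := 1 + Γ.L)
      (T := e.time.eval Γ.L + 20 * (Γ.L + 1)) Inv
      (by
        rintro k s' ⟨hk, h1, h2, h3, h4, h5, h6⟩
        refine ⟨by simp [Expr.eval, h4], by simpa [Expr.cost] using h6.bits_var _, ?_⟩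
        have hk1 : |((k : ℕ) : ℤ)| ≤ Γ.B := by rw [abs_of_nonneg (by positivity)]; omega
        set sa := s'.setV (d + 1) k with hsa
        set sb := sa.setV x k with hsb
        have ga : Good Γ sa := h6.setV_scratch (by omega) (Γ.lt_of_le hk1)
        have gb : Good Γ sb := ga.setV_var hx10 hk1
        obtain ⟨sc, tc, rc, htc, cc⟩ := ih hwe (by omega) (d := d + 3) (by omega) gb
        have hag : Agree (s.setV x k) sb := by
          refine ⟨?_, h1⟩
          intro y hy
          by_cases hyx : y = x
          · simp [hsb, hyx]
          · simp [hsb, hsa, hyx, show y ≠ d + 1 by omega, h2 y (by omega) hyx]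
        have hval : sc.var (d + 3) = F k := by rw [cc.val, X.eval_congr hwe hag]
        have hvd : sc.var d = ∑ i ∈ Finset.Ico (k + 1) N, F i := by
          rw [cc.var d (by omega)]
          simp [hsb, hsa, show d ≠ x by omega, h3]
        have hsum : sc.var d + sc.var (d + 3) = ∑ i ∈ Finset.Ico k N, F i := by
          rw [hval, hvd, Finset.sum_eq_sum_Ico_succ_bot (show k < N by omega) F, add_comm]
        have ra : Run (.assign (d + 1) (.sub (.var (d + 1)) (.lit 1))) s' sa
            (1 + (Expr.sub (.var (d + 1)) (.lit 1)).cost s') := by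
          have := run_assign s' (d + 1) (.sub (.var (d + 1)) (.lit 1))
          simpa [Expr.eval, h4] using this
        have rb : Run (.assign x (.var (d + 1))) sa sb (1 + (Expr.var (d + 1)).cost sa) := by
          have := run_assign sa x (.var (d + 1))
          simpa [Expr.eval, hsa] using this
        have rd := run_assign sc d (.add (.var d) (.var (d + 3)))
        simp only [Expr.eval, hsum] at rd
        refine ⟨_, _, .seq ra (.seq rb (.seq rc rd)), ?_, ?_⟩
        · have b1 := h6.bits_var (d + 1)
          have b2 := ga.bits_var (d + 1)
          have b3 := cc.good.bits_var d
          have b4 := cc.good.bits_var (d + 3)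
          have b5 := bits_le (hpart k (by omega))
          have b6 := bits_le (Γ.lt_of_le hk1)
          have hb1 : bits 1 = 1 := by simp [bits]
          simp only [Expr.cost, Expr.eval, hsum, h4] at *
          push_cast
          rw [add_sub_cancel_right, hb1]
          push_cast at b1
          omega
        · refine ⟨by omega, ?_, ?_, ?_, ?_, ?_, ?_⟩
          · simp [cc.arr, hsb, hsa, h1]
          · intro y hy hyx
            rw [State.setV_var, if_neg (by omega), cc.var y (by omega)]
            simp [hsb, hsa, hyx, show y ≠ d + 1 by omega, h2 y hy hyx]
          · simp
          · rw [State.setV_var, if_neg (by omega), cc.var _ (by omega)]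
            simp [hsb, hsa]
          · rw [State.setV_var, if_neg (by omega), cc.var _ (by omega)]
            simp [hsb, hsa, h5, show d + 2 ≠ x by omega]
          · exact cc.good.setV_scratch hd (hpart k (by omega)))
      (by
        rintro s' ⟨hk, h1, h2, h3, h4, h5, h6⟩
        exact ⟨by simp [Expr.eval, h4], by simpa [Expr.cost] using h6.bits_var _⟩)
      N s3 hI3
    obtain ⟨-, h1, h2, h3, h4, h5, h6⟩ := h4
    have ra := run_assign s d (.lit 0)
    have rb := run_assign (s.setV d 0) (d + 1) (.var b)
    have hvb : (Expr.var b).eval (s.setV d 0) = s.var b := by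
      simp [Expr.eval, show b ≠ d by omega]
    have rc := run_assign ((s.setV d 0).setV (d + 1) (s.var b)) (d + 2) (.var x)
    have hvx : (Expr.var x).eval ((s.setV d 0).setV (d + 1) (s.var b)) = s.var x := by
      simp [Expr.eval, show x ≠ d by omega, show x ≠ d + 1 by omega]
    rw [hvb] at rb
    rw [hvx] at rc
    have re := run_assign s4 x (.var (d + 2))
    refine ⟨_, _, .seq ra (.seq rb (.seq rc (.seq r4 re))), ?_, ?_⟩
    · have b1 := hs.bits_var b
      have b2 := hs.bits_var x
      have b3 := h6.bits_var (d + 2)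
      have hb0 : bits 0 = 0 := by simp [bits]
      have e1 : (Expr.var b).cost (s.setV d 0) = 1 + bits (s.var b) := by
        simp [Expr.cost, show b ≠ d by omega]
      have e2 : (Expr.var x).cost ((s.setV d 0).setV (d + 1) (s.var b)) = 1 + bits (s.var x) := by
        simp [Expr.cost, show x ≠ d by omega, show x ≠ d + 1 by omega]
      rw [e1, e2]
      simp only [Expr.cost, hb0, X.time]
      have ht := ht4.trans (Nat.add_le_add_right (Nat.mul_le_mul_right _ hNL) _)
      simp
      have e3 : Γ.L * (1 + (1 + Γ.L) + (Polynomial.eval Γ.L e.time + 20 * (Γ.L + 1))) ≤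
        Γ.L * (Polynomial.eval Γ.L e.time + 60 * (Γ.L + 1)) := Nat.mul_le_mul_left _ (by omega)
      omega
    · refine ⟨h1, ?_, ?_, ?_⟩
      · intro y hy
        by_cases hyx : y = x
        · subst hyx; simp [Expr.eval, h5]
        · simp [hyx, h2 y hy hyx]
      · simp [show d ≠ x by omega, h3, X.eval, hF, hN]
      · exact h6.setV_var hx10 (by simp only [Expr.eval, h5]; exact hs.var_le x hx)
  | find x b e ih =>
    intro d hd s hs
    have hw0 := hw
    have hdeg0 := hdeg
    simp only [X.wf, Bool.and_eq_true, decide_eq_true_eq] at hw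
    simp only [X.deg] at hdeg
    obtain ⟨⟨⟨hx10, hx⟩, hb⟩, hwe⟩ := hw
    set N := (s.var b).toNat with hN
    have hNb : ((N : ℕ) : ℤ) = s.var b := Int.toNat_of_nonneg (hs.size_nonneg b hb)
    have hNB : (N : ℤ) ≤ Γ.B := by
      rw [hNb]; exact (le_abs_self _).trans (hs.var_le b (by omega))
    have hNL : N ≤ Γ.L := by
      have := hs.size_le b hb; omega
    set F : ℕ → Prop := fun k => 0 < e.eval (s.setV x k) with hF
    -- `G k` is the result when only the indices from `k` on have been tested; it is `N` while there
    -- is no hit.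
    set G : ℕ → ℕ := fun k => fnd N (fun i => k ≤ i ∧ F i) with hG
    have hGN : G N = N := by
      apply le_antisymm (fnd_le _ _)
      by_contra hlt
      have := fnd_spec (not_le.1 hlt)
      exact hlt this.1
    have hGb : ∀ k, |((G k : ℕ) : ℤ)| ≤ Γ.B := by
      intro k
      have : G k ≤ N := fnd_le _ _
      rw [abs_of_nonneg (by positivity)]; omega
    set s3 := ((s.setV d (s.var b)).setV (d + 1) (s.var b)).setV (d + 2) (s.var x) with hs3
    have g3 : Good Γ s3 :=
      ((hs.setV_scratch hd (hs.lt b)).setV_scratch (by omega) (hs.lt b)).setV_scratch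
        (by omega) (hs.lt x)
    set Inv : ℕ → State → Prop := fun k s' => k ≤ N ∧ s'.arr = s.arr ∧
      (∀ y < d, y ≠ x → s'.var y = s.var y) ∧ s'.var d = G k ∧
      s'.var (d + 1) = k ∧ s'.var (d + 2) = s.var x ∧ Good Γ s' with hInv
    have hI3 : Inv N s3 := by
      refine ⟨le_rfl, rfl, ?_, ?_, ?_, ?_, g3⟩
      · intro y hy _
        simp [hs3, State.setV_var, show y ≠ d by omega, show y ≠ d + 1 by omega,
          show y ≠ d + 2 by omega]
      · simp [hs3, hGN, hNb]
      · simp [hs3, hNb]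
      · simp [hs3]
    obtain ⟨s4, t4, r4, ht4, h4⟩ := exists_run_loop (e := .var (d + 1))
      (p := (.seq (.assign (d + 1) (.sub (.var (d + 1)) (.lit 1)))
            (.seq (.assign x (.var (d + 1))) (.seq (e.comp (d + 3))
              (.ite (.var (d + 3)) (.assign d (.var (d + 1))) .skip))))) (c := 1 + Γ.L)
      (T := e.time.eval Γ.L + 20 * (Γ.L + 1)) Inv
      (by
        rintro k s' ⟨hk, h1, h2, h3, h4, h5, h6⟩
        refine ⟨by simp [Expr.eval, h4], by simpa [Expr.cost] using h6.bits_var _, ?_⟩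
        have hk1 : |((k : ℕ) : ℤ)| ≤ Γ.B := by rw [abs_of_nonneg (by positivity)]; omega
        set sa := s'.setV (d + 1) k with hsa
        set sb := sa.setV x k with hsb
        have ga : Good Γ sa := h6.setV_scratch (by omega) (Γ.lt_of_le hk1)
        have gb : Good Γ sb := ga.setV_var hx10 hk1
        obtain ⟨sc, tc, rc, htc, cc⟩ := ih hwe (by omega) (d := d + 3) (by omega) gb
        have hag : Agree (s.setV x k) sb := by
          refine ⟨?_, h1⟩
          intro y hy
          by_cases hyx : y = x
          · simp [hsb, hyx]
          · simp [hsb, hsa, hyx, show y ≠ d + 1 by omega, h2 y (by omega) hyx]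
        have hval : 0 < sc.var (d + 3) ↔ F k := by rw [cc.val, X.eval_congr hwe hag]
        have hvd : sc.var d = G (k + 1) := by
          rw [cc.var d (by omega)]
          simp [hsb, hsa, show d ≠ x by omega, h3]
        have hvk : sc.var (d + 1) = k := by
          rw [cc.var _ (by omega)]
          simp [hsb, hsa]
        have ra : Run (.assign (d + 1) (.sub (.var (d + 1)) (.lit 1))) s' sa
            (1 + (Expr.sub (.var (d + 1)) (.lit 1)).cost s') := by
          have := run_assign s' (d + 1) (.sub (.var (d + 1)) (.lit 1))
          simpa [Expr.eval, h4] using this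
        have rb : Run (.assign x (.var (d + 1))) sa sb (1 + (Expr.var (d + 1)).cost sa) := by
          have := run_assign sa x (.var (d + 1))
          simpa [Expr.eval, hsa] using this
        have b1 := h6.bits_var (d + 1)
        have b2 := ga.bits_var (d + 1)
        have b3 := cc.good.bits_var (d + 1)
        have b4 := cc.good.bits_var (d + 3)
        have b6 := bits_le (Γ.lt_of_le hk1)
        have hb1 : bits 1 = 1 := by simp [bits]
        have hcost : (Expr.sub (.var (d + 1)) (.lit 1)).cost s' ≤ 5 * (Γ.L + 1) := by
          simp only [Expr.cost, Expr.eval, h4] at *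
          push_cast
          rw [add_sub_cancel_right, hb1]
          push_cast at b1
          omega
        have hrest : ∀ u : State, u.arr = sc.arr → (∀ y, y ≠ d → u.var y = sc.var y) →
            u.var d = G k → Good Γ u → Inv k u := by
          intro u hu1 hu2 hu3 hu4
          refine ⟨by omega, ?_, ?_, hu3, ?_, ?_, hu4⟩
          · simp [hu1, cc.arr, hsb, hsa, h1]
          · intro y hy hyx
            rw [hu2 y (by omega), cc.var y (by omega)]
            simp [hsb, hsa, hyx, show y ≠ d + 1 by omega, h2 y hy hyx]
          · rw [hu2 _ (by omega), hvk]
          · rw [hu2 _ (by omega), cc.var _ (by omega)]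
            simp [hsb, hsa, h5, show d + 2 ≠ x by omega]
        by_cases hFk : F k
        · have hGk : G k = k := by
            apply le_antisymm
            · exact Nat.sInf_le (Or.inr ⟨le_rfl, hFk⟩)
            · by_contra hlt
              have h7 : G k < N := by omega
              exact hlt (fnd_spec h7).1
          have rd := run_assign sc d (.var (d + 1))
          refine ⟨_, _, .seq ra (.seq rb (.seq rc (.ite_true (hval.2 hFk) rd))), ?_,
            hrest _ rfl ?_ ?_ ?_⟩
          · simp only [Expr.cost] at *
            omega
          · intro y hy; simp [hy]
          · simp [Expr.eval, hvk, hGk]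
          · exact cc.good.setV_scratch hd (cc.good.lt _)
        · have hGk : G k = G (k + 1) := by
            apply fnd_congr
            intro i hi
            constructor
            · rintro ⟨h7, h8⟩
              refine ⟨?_, h8⟩
              rcases eq_or_lt_of_le h7 with h9 | h9
              · exact absurd (h9 ▸ h8) hFk
              · exact h9
            · rintro ⟨h7, h8⟩
              exact ⟨by omega, h8⟩
          refine ⟨_, _, .seq ra (.seq rb (.seq rc (.ite_false (fun h => hFk (hval.1 h)) (.skip _)))),
            ?_, hrest _ rfl ?_ ?_ cc.good⟩
          · simp only [Expr.cost] at *
            omega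
          · intro y hy; rfl
          · rw [hvd, hGk])
      (by
        rintro s' ⟨hk, h1, h2, h3, h4, h5, h6⟩
        exact ⟨by simp [Expr.eval, h4], by simpa [Expr.cost] using h6.bits_var _⟩)
      N s3 hI3
    obtain ⟨-, h1, h2, h3, h4, h5, h6⟩ := h4
    have ra := run_assign s d (.var b)
    have rb := run_assign (s.setV d (s.var b)) (d + 1) (.var b)
    have hvb : (Expr.var b).eval (s.setV d (s.var b)) = s.var b := by
      simp [Expr.eval]
    have rc := run_assign ((s.setV d (s.var b)).setV (d + 1) (s.var b)) (d + 2) (.var x)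
    have hvx : (Expr.var x).eval ((s.setV d (s.var b)).setV (d + 1) (s.var b)) = s.var x := by
      simp [Expr.eval, show x ≠ d by omega, show x ≠ d + 1 by omega]
    rw [hvb] at rb
    rw [hvx] at rc
    have re := run_assign s4 x (.var (d + 2))
    refine ⟨_, _, .seq ra (.seq rb (.seq rc (.seq r4 re))), ?_, ?_⟩
    · have b1 := hs.bits_var b
      have b2 := hs.bits_var x
      have b3 := h6.bits_var (d + 2)
      have e1 : (Expr.var b).cost (s.setV d (s.var b)) = 1 + bits (s.var b) := by
        simp [Expr.cost]
      have e2 : (Expr.var x).cost ((s.setV d (s.var b)).setV (d + 1) (s.var b)) =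
          1 + bits (s.var x) := by
        simp [Expr.cost, show x ≠ d by omega, show x ≠ d + 1 by omega]
      rw [e1, e2]
      simp only [Expr.cost, X.time]
      have ht := ht4.trans (Nat.add_le_add_right (Nat.mul_le_mul_right _ hNL) _)
      simp
      have e3 : Γ.L * (1 + (1 + Γ.L) + (Polynomial.eval Γ.L e.time + 20 * (Γ.L + 1))) ≤
        Γ.L * (Polynomial.eval Γ.L e.time + 60 * (Γ.L + 1)) := Nat.mul_le_mul_left _ (by omega)
      omega
    · refine ⟨h1, ?_, ?_, ?_⟩
      · intro y hy
        by_cases hyx : y = x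
        · subst hyx; simp [Expr.eval, h5]
        · simp [hyx, h2 y hy hyx]
      · simp [show d ≠ x by omega, h3, X.eval, hG, hF, hN]
      · exact h6.setV_var hx10 (by simp only [Expr.eval, h5]; exact hs.var_le x hx)

end RAM

namespace RAM

/-! ### Commands with bounded loops -/

/-- Commands; `forTo x b c` runs `c` for `x = 0, 1, …` below the value of the size variable `b`. -/
inductive Cmd where
  | skip
  | set (x : ℕ) (e : X)
  | put (a : ℕ) (i e : X)
  | seq (c d : Cmd)
  | ite (e : X) (c d : Cmd)
  | forTo (x b : ℕ) (c : Cmd)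

namespace Cmd

def wf : Cmd → Bool
  | skip => true
  | set x e => decide (10 ≤ x) && decide (x < 100) && e.wf
  | put _ i e => i.wf && e.wf
  | seq c d => c.wf && d.wf
  | ite e c d => e.wf && c.wf && d.wf
  | forTo x b c => decide (10 ≤ x) && decide (x < 100) && decide (b < 10) && c.wf

def deg : Cmd → ℕ
  | skip => 0
  | set _ e => e.deg
  | put _ i e => max i.deg e.deg
  | seq c d => max c.deg d.deg
  | ite e c d => max e.deg (max c.deg d.deg)
  | forTo _ _ c => c.deg

/-- Compilation, with the variables from `d` on as scratch space. -/
def comp : ℕ → Cmd → Prog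
  | _, skip => .skip
  | d, set x e => .seq (e.comp d) (.assign x (.var d))
  | d, put a i e => .seq (i.comp d) (.seq (e.comp (d + 1)) (.put a (.var d) (.var (d + 1))))
  | d, seq c c' => .seq (c.comp d) (c'.comp d)
  | d, ite e c c' => .seq (e.comp d) (.ite (.var d) (c.comp d) (c'.comp d))
  | d, forTo x b c => .seq (.assign d (.lit 0)) (.seq (.assign (d + 1) (.var b))
      (.loop (.sub (.var (d + 1)) (.var d))
        (.seq (.assign x (.var d)) (.seq (c.comp (d + 2)) (.assign d (.add (.var d) (.lit 1)))))))

/-- A bound on the running time of the compiled command. -/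
noncomputable def time : Cmd → Polynomial ℕ
  | skip => 1
  | set _ e => e.time + 10 * (.X + 1)
  | put _ i e => i.time + e.time + 10 * (.X + 1)
  | seq c d => c.time + d.time + 1
  | ite e c d => e.time + c.time + d.time + 10 * (.X + 1)
  | forTo _ _ c => .X * (c.time + 40 * (.X + 1)) + 40 * (.X + 1)

/-- Weakest precondition: all stored values are at most `B`, and `Q` holds in the end. -/
def wp (B : ℤ) : Cmd → (State → Prop) → State → Prop
  | skip, Q, s => Q s
  | set x e, Q, s => |e.eval s| ≤ B ∧ Q (s.setV x (e.eval s))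
  | put a i e, Q, s => |e.eval s| ≤ B ∧ Q (s.setA a (i.eval s) (e.eval s))
  | seq c d, Q, s => c.wp B (d.wp B Q) s
  | ite e c d, Q, s => (0 < e.eval s → c.wp B Q s) ∧ (¬ 0 < e.eval s → d.wp B Q s)
  -- The number of rounds is read once, on entry; `I k` describes the memory after `k` rounds.
  | forTo x b c, Q, s => ∃ I : ℕ → State → Prop, I 0 s ∧
      (∀ k < (s.var b).toNat, ∀ s', I k s' → c.wp B (I (k + 1)) (s'.setV x k)) ∧
      ∀ s', I (s.var b).toNat s' → Q s'

/-- The variable `y` is not written. -/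
def keepsV (y : ℕ) : Cmd → Bool
  | skip => true
  | set x _ => decide (y ≠ x)
  | put _ _ _ => true
  | seq c d => c.keepsV y && d.keepsV y
  | ite _ c d => c.keepsV y && d.keepsV y
  | forTo x _ c => decide (y ≠ x) && c.keepsV y

/-- The array `b` is not written. -/
def keepsA (b : ℕ) : Cmd → Bool
  | skip => true
  | set _ _ => true
  | put a _ _ => decide (b ≠ a)
  | seq c d => c.keepsA b && d.keepsA b
  | ite _ c d => c.keepsA b && d.keepsA b
  | forTo _ _ c => c.keepsA b

/-- `s` and `s'` differ only in what `c` writes. -/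
structure Frame (c : Cmd) (s s' : State) : Prop where
  var : ∀ x, c.keepsV x = true → s'.var x = s.var x
  arr : ∀ a, c.keepsA a = true → s'.arr a = s.arr a

theorem wp_mono {B : ℤ} {c : Cmd} : ∀ {Q Q' : State → Prop}, (∀ s, Q s → Q' s) →
    ∀ {s : State}, c.wp B Q s → c.wp B Q' s := by
  induction c with
  | skip => intro Q Q' h s hs; exact h _ hs
  | set x e => intro Q Q' h s hs; exact ⟨hs.1, h _ hs.2⟩
  | put a i e => intro Q Q' h s hs; exact ⟨hs.1, h _ hs.2⟩
  | seq c d ihc ihd => intro Q Q' h s hs; exact ihc (fun s => ihd h) hs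
  | ite e c d ihc ihd =>
    intro Q Q' h s hs
    exact ⟨fun h1 => ihc h (hs.1 h1), fun h1 => ihd h (hs.2 h1)⟩
  | forTo x b c ih =>
    intro Q Q' h s hs
    obtain ⟨I, h0, h1, h2⟩ := hs
    exact ⟨I, h0, h1, fun s' hs' => h _ (h2 s' hs')⟩

/-- What is kept is described by predicates `pv` and `pa` that do not depend on the command, and
compared with a fixed memory `s₀`: in the induction a subcommand may keep more than the whole
command, and it starts from a different memory. -/
theorem wp_frame_aux {B : ℤ} {c : Cmd} {pv pa : ℕ → Prop} (hv : ∀ x, pv x → c.keepsV x = true)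
    (ha : ∀ a, pa a → c.keepsA a = true) : ∀ {Q : State → Prop} {s₀ s : State},
    (∀ x, pv x → s.var x = s₀.var x) → (∀ a, pa a → s.arr a = s₀.arr a) → c.wp B Q s →
    c.wp B (fun s' => Q s' ∧ (∀ x, pv x → s'.var x = s₀.var x) ∧
      ∀ a, pa a → s'.arr a = s₀.arr a) s := by
  induction c with
  | skip => intro Q s₀ s h1 h2 hs; exact ⟨hs, h1, h2⟩
  | set x e =>
    intro Q s₀ s h1 h2 hs
    refine ⟨hs.1, hs.2, fun y hy => ?_, h2⟩
    have := hv y hy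
    simp only [keepsV, decide_eq_true_eq] at this
    rw [State.setV_var, if_neg this, h1 y hy]
  | put a i e =>
    intro Q s₀ s h1 h2 hs
    refine ⟨hs.1, hs.2, h1, fun b hb => ?_⟩
    have := ha b hb
    simp only [keepsA, decide_eq_true_eq] at this
    rw [State.setA_arr, if_neg this, h2 b hb]
  | seq c d ihc ihd =>
    intro Q s₀ s h1 h2 hs
    simp only [keepsV, keepsA, Bool.and_eq_true] at hv ha
    refine wp_mono (c := c) ?_ (ihc (fun x hx => (hv x hx).1) (fun x hx => (ha x hx).1) h1 h2 hs)
    rintro s' ⟨h3, h4, h5⟩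
    exact ihd (fun x hx => (hv x hx).2) (fun x hx => (ha x hx).2) h4 h5 h3
  | ite e c d ihc ihd =>
    intro Q s₀ s h1 h2 hs
    simp only [keepsV, keepsA, Bool.and_eq_true] at hv ha
    exact ⟨fun h => ihc (fun x hx => (hv x hx).1) (fun x hx => (ha x hx).1) h1 h2 (hs.1 h),
      fun h => ihd (fun x hx => (hv x hx).2) (fun x hx => (ha x hx).2) h1 h2 (hs.2 h)⟩
  | forTo x b c ih =>
    intro Q s₀ s h1 h2 hs
    simp only [keepsV, keepsA, Bool.and_eq_true, decide_eq_true_eq] at hv ha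
    obtain ⟨I, hI0, hI1, hI2⟩ := hs
    refine ⟨fun k s' => I k s' ∧ (∀ x, pv x → s'.var x = s₀.var x) ∧
      ∀ a, pa a → s'.arr a = s₀.arr a, ⟨hI0, h1, h2⟩, ?_, ?_⟩
    · rintro k hk s' ⟨h3, h4, h5⟩
      refine ih (fun x hx => (hv x hx).2) ha ?_ h5 (hI1 k hk s' h3)
      intro y hy
      rw [State.setV_var, if_neg (hv y hy).1, h4 y hy]
    · rintro s' ⟨h3, h4⟩
      exact ⟨hI2 s' h3, h4⟩

theorem wp_frame {B : ℤ} {c : Cmd} {Q : State → Prop} {s : State} (h : c.wp B Q s) :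
    c.wp B (fun s' => Q s' ∧ Frame c s s') s :=
  wp_mono (fun _ h => ⟨h.1, h.2.1, h.2.2⟩) (wp_frame_aux (pv := fun x => c.keepsV x = true)
    (pa := fun a => c.keepsA a = true) (fun _ h => h) (fun _ h => h) (fun _ _ => rfl)
    (fun _ _ => rfl) h)

/-- The intermediate assertion `P` need only speak of what `c` writes; the frame carries over the
rest. -/
theorem wp_seq {B : ℤ} {c d : Cmd} {P Q : State → Prop} {s : State} (h : c.wp B P s)
    (h' : ∀ s', P s' → Frame c s s' → d.wp B Q s') : (seq c d).wp B Q s :=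
  wp_mono (fun s' hs' => h' s' hs'.1 hs'.2) (wp_frame h)

/-- Rule for loops with an invariant, in which everything that the loop does not write is known
to be unchanged. -/
theorem wp_forTo {B : ℤ} {x b N : ℕ} {c : Cmd} {Q : State → Prop} {s : State}
    (I : ℕ → State → Prop) (hN : s.var b = N) (h0 : I 0 s)
    (hstep : ∀ k < N, ∀ s', Frame (forTo x b c) s s' → I k s' →
      c.wp B (I (k + 1)) (s'.setV x k))
    (hend : ∀ s', Frame (forTo x b c) s s' → I N s' → Q s') : (forTo x b c).wp B Q s := by
  have hN' : (s.var b).toNat = N := by simp [hN]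
  refine ⟨fun k s' => I k s' ∧ Frame (forTo x b c) s s', ⟨h0, fun _ _ => rfl, fun _ _ => rfl⟩, ?_, ?_⟩
  · rintro k hk s' ⟨h1, h2⟩
    rw [hN'] at hk
    refine wp_mono ?_ (wp_frame (hstep k hk s' h2 h1))
    rintro s'' ⟨h3, h4⟩
    refine ⟨h3, fun y hy => ?_, fun a ha => ?_⟩
    · have hy' := hy
      simp only [keepsV, Bool.and_eq_true, decide_eq_true_eq] at hy
      rw [h4.var y hy.2, State.setV_var, if_neg hy.1, h2.var y hy']
    · rw [h4.arr a (by simpa only [keepsA] using ha), State.setV_arr, h2.arr a ha]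
  · rintro s' ⟨h1, h2⟩
    rw [hN'] at h1
    exact hend s' h2 h1

/-- Rule for filling an array. -/
theorem wp_fill {B : ℤ} {x b N a : ℕ} {e : X} {Q : State → Prop} {s : State} (f : ℕ → ℤ)
    (hN : s.var b = N)
    (hstep : ∀ k < N, ∀ s', Frame (forTo x b (put a (.var x) e)) s s' → s'.var x = k →
      (∀ i < k, s'.arr a (i : ℕ) = f i) → (∀ i : ℕ, k ≤ i → s'.arr a (i : ℕ) = s.arr a (i : ℕ)) →
      e.eval s' = f k ∧ |f k| ≤ B)
    (hend : ∀ s', Frame (forTo x b (put a (.var x) e)) s s' → (∀ i < N, s'.arr a (i : ℕ) = f i) →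
      (∀ i : ℕ, N ≤ i → s'.arr a (i : ℕ) = s.arr a (i : ℕ)) → Q s') :
    (forTo x b (put a (.var x) e)).wp B Q s := by
  refine wp_forTo (fun k s' => (∀ i < k, s'.arr a (i : ℕ) = f i) ∧
    ∀ i : ℕ, k ≤ i → s'.arr a (i : ℕ) = s.arr a (i : ℕ)) hN ⟨by simp, fun _ _ => rfl⟩ ?_ ?_
  · rintro k hk s' hF ⟨h1, h2⟩
    have hF' : Frame (forTo x b (put a (.var x) e)) s (s'.setV x k) := by
      refine ⟨fun y hy => ?_, hF.arr⟩
      have hy' := hy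
      simp only [keepsV, Bool.and_eq_true, decide_eq_true_eq] at hy
      rw [State.setV_var, if_neg hy.1, hF.var y hy']
    obtain ⟨h3, h4⟩ := hstep k hk (s'.setV x k) hF' (by simp) h1 h2
    · refine ⟨by rwa [h3], ?_, ?_⟩
      · intro i hi
        simp only [State.setA_arr, X.eval, if_true, State.setV_var, State.setV_arr,
          Function.update_apply, Nat.cast_inj]
        split_ifs with h
        · rw [h3, h]
        · exact h1 i (by omega)
      · intro i hi
        simp only [State.setA_arr, X.eval, if_true, State.setV_var, State.setV_arr,
          Function.update_apply, Nat.cast_inj]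
        rw [if_neg (by omega)]
        exact h2 i (by omega)
  · rintro s' hF ⟨h1, h2⟩
    exact hend s' hF h1 h2

/-- Soundness of `wp`. Here `σ` is the memory of the source command and `s` that of the machine;
they differ in scratch variables only. The scratch variables between `100` and `d` must survive,
because enclosing loops keep their counters and bounds there. -/
theorem exists_run_comp {Γ : Ctx} {c : Cmd} (hw : c.wf) (hdeg : c.deg ≤ Γ.D) :
    ∀ {d : ℕ}, 100 ≤ d → ∀ {Q : State → Prop} {σ s : State}, c.wp Γ.B Q σ → Agree σ s → Good Γ s →
      ∃ s' t σ', Run (c.comp d) s s' t ∧ t ≤ c.time.eval Γ.L ∧ Agree σ' s' ∧ Q σ' ∧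
        (∀ y, 100 ≤ y → y < d → s'.var y = s.var y) ∧ Good Γ s' := by
  have hL := Γ.one_lt_L
  induction c with
  | skip =>
    intro d hd Q σ s hwp hag hs
    exact ⟨s, 1, σ, .skip s, by simp [time], hag, hwp, fun _ _ _ => rfl, hs⟩
  | set x e =>
    intro d hd Q σ s hwp hag hs
    simp only [wf, Bool.and_eq_true, decide_eq_true_eq] at hw
    obtain ⟨s1, t1, r1, ht1, c1⟩ := X.exists_run_comp hw.2 hdeg hd hs
    have hag1 : Agree σ s1 := hag.trans ⟨fun x hx => c1.var x (by omega), c1.arr⟩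
    have hv : s1.var d = e.eval σ := by rw [c1.val, X.eval_congr hw.2 hag]
    have r2 := run_assign s1 x (.var d)
    simp only [Expr.eval, hv] at r2
    refine ⟨_, _, _, .seq r1 r2, ?_, hag1.setV _ _, hwp.2, ?_, c1.good.setV_var hw.1.1 hwp.1⟩
    · have := c1.good.bits_var d
      simp [time, Expr.cost]; omega
    · intro y hy hyd
      rw [State.setV_var, if_neg (by omega), c1.var y hyd]
  | put a i e =>
    intro d hd Q σ s hwp hag hs
    simp only [wf, Bool.and_eq_true] at hw
    simp only [deg, max_le_iff] at hdeg
    obtain ⟨s1, t1, r1, ht1, c1⟩ := X.exists_run_comp hw.1 hdeg.1 hd hs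
    have hag1 : Agree σ s1 := hag.trans ⟨fun x hx => c1.var x (by omega), c1.arr⟩
    obtain ⟨s2, t2, r2, ht2, c2⟩ := X.exists_run_comp hw.2 hdeg.2 (d := d + 1) (by omega) c1.good
    have hag2 : Agree σ s2 := hag1.trans ⟨fun x hx => c2.var x (by omega), c2.arr⟩
    have hv1 : s2.var d = i.eval σ := by rw [c2.var d (by omega), c1.val, X.eval_congr hw.1 hag]
    have hv2 : s2.var (d + 1) = e.eval σ := by rw [c2.val, X.eval_congr hw.2 hag1]
    have r3 : Run (.put a (.var d) (.var (d + 1))) s2 (s2.setA a (i.eval σ) (e.eval σ))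
        (1 + (Expr.var d).cost s2 + (Expr.var (d + 1)).cost s2) := by
      have := Run.put s2 a (.var d) (.var (d + 1))
      simp only [Expr.eval, hv1, hv2] at this
      exact this
    refine ⟨_, _, _, .seq r1 (.seq r2 r3), ?_, hag2.setA _ _ _, hwp.2, ?_, c2.good.setA _ _ hwp.1⟩
    · have h1 := c2.good.bits_var d
      have h2 := c2.good.bits_var (d + 1)
      simp [time, Expr.cost]; omega
    · intro y hy hyd
      rw [State.setA_var, c2.var y (by omega), c1.var y hyd]
  | seq c c' ih ih' =>
    intro d hd Q σ s hwp hag hs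
    simp only [wf, Bool.and_eq_true] at hw
    simp only [deg, max_le_iff] at hdeg
    obtain ⟨s1, t1, σ1, r1, ht1, hag1, hQ1, hf1, g1⟩ := ih hw.1 hdeg.1 hd hwp hag hs
    obtain ⟨s2, t2, σ2, r2, ht2, hag2, hQ2, hf2, g2⟩ := ih' hw.2 hdeg.2 hd hQ1 hag1 g1
    refine ⟨s2, _, σ2, .seq r1 r2, ?_, hag2, hQ2, ?_, g2⟩
    · simp [time]; omega
    · intro y hy hyd
      rw [hf2 y hy hyd, hf1 y hy hyd]
  | ite e c c' ih ih' =>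
    intro d hd Q σ s hwp hag hs
    simp only [wf, Bool.and_eq_true] at hw
    simp only [deg, max_le_iff] at hdeg
    obtain ⟨s1, t1, r1, ht1, c1⟩ := X.exists_run_comp hw.1.1 hdeg.1 hd hs
    have hag1 : Agree σ s1 := hag.trans ⟨fun x hx => c1.var x (by omega), c1.arr⟩
    have hv : s1.var d = e.eval σ := by rw [c1.val, X.eval_congr hw.1.1 hag]
    have hb := c1.good.bits_var d
    by_cases hpos : 0 < e.eval σ
    · obtain ⟨s2, t2, σ2, r2, ht2, hag2, hQ2, hf2, g2⟩ :=
        ih hw.1.2 hdeg.2.1 hd (hwp.1 hpos) hag1 c1.good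
      refine ⟨s2, _, σ2, .seq r1 (.ite_true (by simpa [Expr.eval, hv] using hpos) r2), ?_, hag2, hQ2,
        ?_, g2⟩
      · simp [time, Expr.cost]; omega
      · intro y hy hyd
        rw [hf2 y hy hyd, c1.var y hyd]
    · obtain ⟨s2, t2, σ2, r2, ht2, hag2, hQ2, hf2, g2⟩ :=
        ih' hw.2 hdeg.2.2 hd (hwp.2 hpos) hag1 c1.good
      refine ⟨s2, _, σ2, .seq r1 (.ite_false (by simpa [Expr.eval, hv] using hpos) r2), ?_, hag2, hQ2,
        ?_, g2⟩
      · simp [time, Expr.cost]; omega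
      · intro y hy hyd
        rw [hf2 y hy hyd, c1.var y hyd]
  | forTo x b c ih =>
    intro d hd Q σ s hwp hag hs
    simp only [wf, Bool.and_eq_true, decide_eq_true_eq] at hw
    simp only [deg] at hdeg
    obtain ⟨⟨⟨hx10, hx⟩, hb⟩, hwc⟩ := hw
    obtain ⟨I, hI0, hI1, hI2⟩ := hwp
    set N := (σ.var b).toNat with hN
    have hbσ : s.var b = σ.var b := hag.var b (by omega)
    have hNb : ((N : ℕ) : ℤ) = s.var b := by
      rw [hbσ]; exact Int.toNat_of_nonneg (hbσ ▸ hs.size_nonneg b hb)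
    have hNB : (N : ℤ) ≤ Γ.B := by
      rw [hNb]; exact (le_abs_self _).trans (hs.var_le b (by omega))
    have hNL : N ≤ Γ.L := by
      have := hs.size_le b hb; omega
    set s2 := (s.setV d 0).setV (d + 1) (s.var b) with hs2
    have g2 : Good Γ s2 :=
      (hs.setV_scratch hd (by simp)).setV_scratch (by omega) (hs.lt b)
    -- With `j` rounds to go, `k` have been done: `exists_run_loop` counts down and `wp` counts up.
    set Inv : ℕ → State → Prop := fun j s' => ∃ k σ', k + j = N ∧ Agree σ' s' ∧ I k σ' ∧
      s'.var d = k ∧ s'.var (d + 1) = N ∧ (∀ y, 100 ≤ y → y < d → s'.var y = s.var y) ∧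
      Good Γ s' with hInv
    have hI : Inv N s2 := by
      refine ⟨0, σ, by omega, hag.trans ⟨?_, rfl⟩, hI0, ?_, ?_, ?_, g2⟩
      · intro y hy
        simp [hs2, show y ≠ d by omega, show y ≠ d + 1 by omega]
      · simp [hs2]
      · simp [hs2, hNb]
      · intro y hy hyd
        simp [hs2, show y ≠ d by omega, show y ≠ d + 1 by omega]
    have hb1 : bits 1 = 1 := by simp [bits]
    have hb0 : bits 0 = 0 := by simp [bits]
    obtain ⟨s3, t3, r3, ht3, k, σ', hk, h1, h2, h3, h4, h5, h6⟩ := exists_run_loop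
      (e := .sub (.var (d + 1)) (.var d))
      (p := (.seq (.assign x (.var d)) (.seq (c.comp (d + 2)) (.assign d (.add (.var d) (.lit 1))))))
      (c := 5 * (Γ.L + 1)) (T := c.time.eval Γ.L + 15 * (Γ.L + 1)) Inv
      (by
        rintro j s' ⟨k, σ', hk, h1, h2, h3, h4, h5, h6⟩
        have hk1 : |((k : ℕ) : ℤ)| ≤ Γ.B := by rw [abs_of_nonneg (by positivity)]; omega
        have hk2 : |((k : ℕ) : ℤ) + 1| ≤ Γ.B := by rw [abs_of_nonneg (by positivity)]; omega
        have b1 := h6.bits_var d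
        have b2 := h6.bits_var (d + 1)
        have b3 := h6.bits_sub (d + 1) d
        refine ⟨by simp only [Expr.eval, h3, h4]; omega, by simp only [Expr.cost, Expr.eval]; omega, ?_⟩
        have gx : Good Γ (s'.setV x k) := h6.setV_var hx10 hk1
        obtain ⟨s4, t4, σ4, r4, ht4, hag4, hQ4, hf4, g4⟩ := ih hwc hdeg (d := d + 2) (by omega)
          (hI1 k (by omega) σ' h2) (h1.setV x k) gx
        have ra : Run (.assign x (.var d)) s' (s'.setV x k) (1 + (Expr.var d).cost s') := by
          have := run_assign s' x (.var d)
          simpa [Expr.eval, h3] using this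
        have hd4 : s4.var d = k := by
          rw [hf4 d hd (by omega), State.setV_var, if_neg (by omega), h3]
        have rb := run_assign s4 d (.add (.var d) (.lit 1))
        simp only [Expr.eval, hd4] at rb
        refine ⟨_, _, .seq ra (.seq r4 rb), ?_, k + 1, σ4, by omega,
          hag4.trans ⟨?_, rfl⟩, hQ4, ?_, ?_, ?_, ?_⟩
        · have b4 := g4.bits_var d
          have b5 := bits_le (Γ.lt_of_le hk2)
          simp only [Expr.cost, Expr.eval, hd4, hb1] at *
          omega
        · intro y hy
          rw [State.setV_var, if_neg (by omega)]
        · simp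
        · rw [State.setV_var, if_neg (by omega), hf4 _ (by omega) (by omega), State.setV_var,
            if_neg (by omega), h4]
        · intro y hy hyd
          rw [State.setV_var, if_neg (by omega), hf4 _ (by omega) (by omega), State.setV_var,
            if_neg (by omega), h5 y hy hyd]
        · exact g4.setV_scratch hd (Γ.lt_of_le hk2))
      (by
        rintro s' ⟨k, σ', hk, h1, h2, h3, h4, h5, h6⟩
        have b1 := h6.bits_var d
        have b2 := h6.bits_var (d + 1)
        have b3 := h6.bits_sub (d + 1) d
        refine ⟨by simp only [Expr.eval, h3, h4]; omega, by simp only [Expr.cost, Expr.eval]; omega⟩)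
      N s2 hI
    have ra := run_assign s d (.lit 0)
    have rb := run_assign (s.setV d 0) (d + 1) (.var b)
    have hvb : (Expr.var b).eval (s.setV d 0) = s.var b := by
      simp [Expr.eval, show b ≠ d by omega]
    rw [hvb] at rb
    have hkN : k = N := by omega
    subst hkN
    refine ⟨s3, _, σ', .seq ra (.seq rb r3), ?_, h1, hI2 σ' h2, h5, h6⟩
    have e1 : (Expr.var b).cost (s.setV d 0) = 1 + bits (s.var b) := by
      simp [Expr.cost, show b ≠ d by omega]
    have b1 := hs.bits_var b
    have ht := ht3.trans (Nat.add_le_add_right (Nat.mul_le_mul_right _ hNL) _)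
    rw [e1]
    simp only [Expr.cost, hb0, time]
    simp
    have e3 : Γ.L * (1 + 5 * (Γ.L + 1) + (Polynomial.eval Γ.L c.time + 15 * (Γ.L + 1))) ≤
      Γ.L * (Polynomial.eval Γ.L c.time + 40 * (Γ.L + 1)) := Nat.mul_le_mul_left _ (by omega)
    omega

end Cmd

end RAM

/-! ### Logical connectives and bounded quantifiers -/

namespace RAM

namespace X

/-- An expression counts as true if its value is positive; the connectives return 0 or 1. -/
def not (e : X) : X := lt e (lit 1)
def and (e f : X) : X := mul (lt (lit 0) e) (lt (lit 0) f)
def or (e f : X) : X := lt (lit 0) (add (lt (lit 0) e) (lt (lit 0) f))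
def eq (e f : X) : X := mul (lt e (add f (lit 1))) (lt f (add e (lit 1)))
def ex (x b : ℕ) (e : X) : X := lt (find x b e) (var b)
def all (x b : ℕ) (e : X) : X := not (ex x b (not e))

@[simp] theorem eval_lit (k : ℤ) (s : State) : (lit k).eval s = k := rfl
@[simp] theorem eval_var (x : ℕ) (s : State) : (var x).eval s = s.var x := rfl
@[simp] theorem eval_get (a : ℕ) (i : X) (s : State) : (get a i).eval s = s.arr a (i.eval s) := rfl
@[simp] theorem eval_add (e f : X) (s : State) : (add e f).eval s = e.eval s + f.eval s := rfl
@[simp] theorem eval_sub (e f : X) (s : State) : (sub e f).eval s = e.eval s - f.eval s := rfl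
@[simp] theorem eval_mul (e f : X) (s : State) : (mul e f).eval s = e.eval s * f.eval s := rfl
@[simp] theorem eval_div (e f : X) (s : State) : (div e f).eval s = e.eval s / f.eval s := rfl
@[simp] theorem eval_lt (e f : X) (s : State) : (lt e f).eval s = tv (e.eval s < f.eval s) := rfl
@[simp] theorem eval_sum (x b : ℕ) (e : X) (s : State) :
    (sum x b e).eval s = ∑ k ∈ Finset.range (s.var b).toNat, e.eval (s.setV x k) := rfl
@[simp] theorem eval_find (x b : ℕ) (e : X) (s : State) :
    (find x b e).eval s = fnd (s.var b).toNat fun k => 0 < e.eval (s.setV x k) := rfl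

@[simp] theorem eval_not (e : X) (s : State) : (not e).eval s = tv (¬ 0 < e.eval s) := by
  simp only [not, eval_lt, eval_lit]
  exact tv_congr (by omega)

theorem tv_mul_tv (p q : Prop) : tv p * tv q = tv (p ∧ q) := by
  unfold tv; by_cases hp : p <;> by_cases hq : q <;> simp [hp, hq]

@[simp] theorem eval_and (e f : X) (s : State) :
    (and e f).eval s = tv (0 < e.eval s ∧ 0 < f.eval s) := by
  simp [and, tv_mul_tv]

@[simp] theorem eval_or (e f : X) (s : State) :
    (or e f).eval s = tv (0 < e.eval s ∨ 0 < f.eval s) := by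
  simp only [or, eval_lt, eval_lit, eval_add]
  apply tv_congr
  unfold tv; by_cases hp : 0 < e.eval s <;> by_cases hq : 0 < f.eval s <;> simp [hp, hq]

@[simp] theorem eval_eq (e f : X) (s : State) :
    (eq e f).eval s = tv (e.eval s = f.eval s) := by
  simp only [eq, eval_mul, eval_lt, eval_lit, eval_add, tv_mul_tv]
  exact tv_congr (by omega)

@[simp] theorem eval_ex (x b : ℕ) (e : X) (s : State) :
    (ex x b e).eval s = tv (∃ k < (s.var b).toNat, 0 < e.eval (s.setV x k)) := by
  simp only [ex, eval_lt, eval_var, eval_find]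
  apply tv_congr
  rw [← fnd_lt_iff]
  omega

@[simp] theorem eval_all (x b : ℕ) (e : X) (s : State) :
    (all x b e).eval s = tv (∀ k < (s.var b).toNat, 0 < e.eval (s.setV x k)) := by
  simp only [all, eval_not, eval_ex, tv_pos]
  exact tv_congr (by push Not; rfl)

end X

/-! ### The program -/

namespace Aug

open X Cmd

/-- Memory layout. Variables: 0 to 5 hold n, m, r, n², 2m and 3; 10 and 11 the common denominators,
12 the best cost so far, 13 the threshold vertex, 14 the deleted colour. Arrays: 7 the best
selection so far, 10 domination, 11 and 12 scaled costs and values, 13 cross-links, 14 the cross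
value of each edge, 15 to 17 ends and costs of the pieces, 20 ground vertices, 21 dual values, 22
stamps, 23 kept pieces, 24 lowest vertices, 25 and 26 cheapest links for vertices and for pairs, 27
and 28 the two links of a pair, 30 and 31 potentials, 32 the assignment, 33 reached rows, 34 stamps
of columns, 35 parents, 36 colours, 37 the current selection. -/
def fill (x b a : ℕ) (e : X) : Cmd := forTo x b (put a (.var x) e)

def domX (v u : X) : X := get 10 (add (mul v (.var 0)) u)
def covX (v l : X) : X := eq (add (domX v (get 1 l)) (domX v (get 2 l))) (lit 1)
def pcX (q v : X) : X := and (domX v (get 15 q)) (not (domX v (get 16 q)))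

/-! Common denominators, domination, cross-links and pieces. -/

def prodDen (y a : ℕ) : Cmd := seq (set y (lit 1)) (forTo 20 1 (set y (mul (.var y) (get a (.var 20)))))

def scale (y a b c : ℕ) : Cmd := fill 20 1 a (mul (get b (.var 20)) (div (.var y) (get c (.var 20))))

def rowX (k : X) : X := div k (.var 0)
def colX (k : X) : X := sub k (mul (.var 0) (div k (.var 0)))

def domInit : Cmd := fill 20 3 10 (or (eq (rowX (.var 20)) (.var 2)) (not (eq (colX (.var 20)) (.var 2))))

/-- A walk to `u ≠ v` that avoids `v` reaches a neighbour of `u` just before. So domination is found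
by elimination: `v` remains a candidate for `u` only if it is one for all neighbours of `u`. The
cells are overwritten in place. -/
def domStep : Cmd := fill 20 3 10 (and (get 10 (.var 20)) (or (eq (rowX (.var 20)) (colX (.var 20)))
  (not (ex 50 0 (and (get 0 (add (mul (.var 50) (.var 0)) (colX (.var 20))))
    (not (domX (rowX (.var 20)) (.var 50))))))))

def domCmd : Cmd := seq domInit (forTo 21 0 domStep)

def crossCmd : Cmd := fill 20 1 13 (and (not (eq (get 1 (.var 20)) (.var 2)))
  (and (not (eq (get 2 (.var 20)) (.var 2)))
    (all 50 0 (or (eq (.var 50) (.var 2))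
      (not (and (domX (.var 50) (get 1 (.var 20))) (domX (.var 50) (get 2 (.var 20)))))))))

def zcCmd : Cmd := fill 20 0 14
  (sum 50 1 (mul (and (get 13 (.var 50)) (covX (.var 20) (.var 50))) (get 12 (.var 50))))

def caseX (a b : ℕ) : X := add (mul (lt (.var 20) (.var 1)) (get a (.var 20)))
  (mul (not (lt (.var 20) (.var 1))) (get b (sub (.var 20) (.var 1))))

def pieceCmd : Cmd := seq (fill 20 4 15 (caseX 1 2)) (seq (fill 20 4 16 (caseX 2 1))
  (fill 20 4 17 (caseX 11 11)))

/-! Covering by pieces: primal-dual phase and reverse deletion. -/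

def coveredX (v : X) : X := ex 60 4 (and (get 22 (.var 60)) (pcX (.var 60) v))

def resX (q : X) : X := sub (get 17 q) (sum 61 0 (mul (pcX q (.var 61)) (get 21 (.var 61))))

def groundCmd : Cmd := fill 20 0 20
  (and (not (eq (.var 20) (.var 2))) (not (lt (get 14 (.var 13)) (get 14 (.var 20)))))

def pickVertexX : X := find 50 0 (and (get 20 (.var 50)) (and (not (coveredX (.var 50)))
  (all 51 0 (not (and (and (get 20 (.var 51)) (not (coveredX (.var 51))))
    (and (domX (.var 50) (.var 51)) (not (eq (.var 51) (.var 50)))))))))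

def pickPieceX : X := find 50 4 (and (pcX (.var 50) (.var 22)) (all 51 4 (not (and
  (pcX (.var 51) (.var 22)) (lt (resX (.var 51)) (resX (.var 50)))))))

/-- The dual value of a lowest uncovered ground vertex is raised until a piece through it becomes
tight. That piece is stamped with the number of the round plus one, since 0 marks pieces that were
not taken. -/
def dualStep : Cmd := seq (set 22 pickVertexX) (ite (lt (.var 22) (.var 0))
  (seq (set 23 pickPieceX) (seq (put 21 (.var 22) (resX (.var 23)))
    (put 22 (.var 23) (add (.var 21) (lit 1))))) .skip)

def dualCmd : Cmd := seq (fill 20 0 21 (lit 0)) (seq (fill 20 4 22 (lit 0)) (forTo 21 0 dualStep))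

/-- Pieces are reconsidered in reverse order: round `k` treats the stamp `n - k`, and deletes its
piece if other kept pieces cover all of its ground vertices. -/
def pruneStep : Cmd := seq (set 22 (find 50 4 (eq (get 22 (.var 50)) (sub (.var 0) (.var 21)))))
  (ite (and (lt (.var 22) (.var 4)) (all 50 0 (not (and (and (get 20 (.var 50)) (pcX (.var 22) (.var 50)))
      (not (ex 51 4 (and (not (eq (.var 51) (.var 22))) (and (get 23 (.var 51))
        (pcX (.var 51) (.var 50)))))))))) (put 23 (.var 22) (lit 0)) .skip)

def pruneCmd : Cmd := seq (fill 20 4 23 (lt (lit 0) (get 22 (.var 20)))) (forTo 21 0 pruneStep)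

def upCmd : Cmd := seq groundCmd (seq dualCmd pruneCmd)

/-! Cheapest cross-links for the minimal elements, and for pairs of them. -/

def minimalCmd : Cmd := fill 20 0 24 (and (lt (get 14 (.var 13)) (get 14 (.var 20)))
  (all 50 0 (not (and (lt (get 14 (.var 13)) (get 14 (.var 50)))
    (and (domX (.var 20) (.var 50)) (not (eq (.var 50) (.var 20))))))))

def touchX (u l : X) : X := and (get 24 u) (and (get 13 l) (covX u l))

def singleCmd : Cmd := fill 20 0 25 (find 50 1 (and (touchX (.var 20) (.var 50))
  (all 51 1 (not (and (touchX (.var 20) (.var 51)) (lt (get 11 (.var 51)) (get 11 (.var 50))))))))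

def bothX (k l : X) : X :=
  and (not (eq (rowX k) (colX k))) (and (touchX (rowX k) l) (touchX (colX k) l))

def doubleCmd : Cmd := fill 20 3 26 (find 50 1 (and (bothX (.var 20) (.var 50))
  (all 51 1 (not (and (bothX (.var 20) (.var 51)) (lt (get 11 (.var 51)) (get 11 (.var 50))))))))

def directX : X := and (lt (get 26 (.var 20)) (.var 1)) (lt (get 11 (get 26 (.var 20)))
  (add (get 11 (get 25 (rowX (.var 20)))) (get 11 (get 25 (colX (.var 20))))))

/-- When a single link serves both vertices, the second place is filled with the index `m`, which is
beyond all links and has cost 0. -/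
def pairCmd : Cmd := seq
  (fill 20 3 27 (add (mul directX (get 26 (.var 20))) (mul (not directX) (get 25 (rowX (.var 20))))))
  (fill 20 3 28 (add (mul directX (.var 1)) (mul (not directX) (get 25 (colX (.var 20))))))

def prepCmd : Cmd := seq minimalCmd (seq singleCmd (seq doubleCmd pairCmd))

/-! The Hungarian method. -/

def slackX (k : X) : X := sub (sub (add (get 11 (get 27 k)) (get 11 (get 28 k))) (get 30 (rowX k)))
  (get 31 (colX k))

def eligX (k : X) : X := and (get 33 (rowX k)) (not (get 34 (colX k)))

/-- The potentials are shifted by the least slack between reached rows and unreached columns, and a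
column attaining it is reached. If it is matched, its row is reached too; otherwise variable 24
reports an augmenting path that ends in the column in variable 25. -/
def searchStep : Cmd :=
  seq (set 26 (find 50 3 (and (eligX (.var 50)) (all 51 3 (not (and (eligX (.var 51))
    (lt (slackX (.var 51)) (slackX (.var 50)))))))))
  (seq (set 27 (rowX (.var 26))) (seq (set 28 (colX (.var 26))) (seq (set 29 (slackX (.var 26)))
  (seq (fill 23 0 30 (add (get 30 (.var 23)) (mul (lt (lit 0) (get 33 (.var 23))) (.var 29))))
  (seq (fill 23 0 31 (sub (get 31 (.var 23)) (mul (lt (lit 0) (get 34 (.var 23))) (.var 29))))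
  (seq (put 35 (.var 28) (.var 27)) (seq (put 34 (.var 28) (add (.var 22) (lit 1)))
  (seq (set 30 (find 50 0 (and (lt (.var 50) (.var 20)) (eq (get 32 (.var 50)) (.var 28)))))
  (ite (lt (.var 30) (.var 0)) (put 33 (.var 30) (lit 1))
    (seq (set 24 (lit 1)) (set 25 (.var 28))))))))))))

/-- One flip along the augmenting path, from its free end backwards; it is the last one if the row
involved is the new row, in variable 20. -/
def augStep : Cmd := seq (set 27 (get 35 (.var 25))) (seq (set 28 (get 32 (.var 27)))
  (seq (put 32 (.var 27) (.var 25)) (ite (eq (.var 27) (.var 20)) (set 24 (lit 0)) (set 25 (.var 28)))))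

def searchCmd : Cmd := forTo 22 0 (ite (.var 24) .skip searchStep)

def augCmd : Cmd := forTo 22 0 (ite (.var 24) augStep .skip)

def rowCmd : Cmd := seq (fill 21 0 33 (eq (.var 21) (.var 20))) (seq (fill 21 0 34 (lit 0))
  (seq (set 24 (lit 0)) (seq searchCmd augCmd)))

def hungCmd : Cmd := seq (fill 20 0 30 (lit 0)) (seq (fill 20 0 31 (lit 0)) (seq (fill 20 0 32 (.var 0))
  (forTo 20 0 rowCmd)))

/-! Three-colouring the cycles of the permutation, and the selection of links. -/

def colorCmd : Cmd := seq (fill 20 0 36 (lit 3)) (forTo 20 0 (put 36 (.var 20) (find 50 5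
  (and (not (eq (.var 50) (get 36 (get 32 (.var 20))))) (not (ex 51 0 (and
    (eq (get 32 (.var 51)) (.var 20)) (eq (get 36 (.var 51)) (.var 50)))))))))

def fixX : X := eq (get 32 (.var 50)) (.var 50)
def offX : X := eq (get 36 (.var 50)) (.var 14)
def arcX : X := add (mul (.var 50) (.var 0)) (get 32 (.var 50))

def selectCmd : Cmd := fill 20 1 37 (or (or (get 23 (.var 20)) (get 23 (add (.var 1) (.var 20))))
  (ex 50 0 (or (and (or fixX (not offX)) (eq (get 27 arcX) (.var 20)))
    (and (and (not fixX) (not offX)) (eq (get 28 arcX) (.var 20))))))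

def keepCmd : Cmd := seq (set 31 (sum 50 1 (mul (lt (lit 0) (get 37 (.var 50))) (get 11 (.var 50)))))
  (ite (lt (.var 31) (.var 12)) (seq (set 12 (.var 31)) (fill 20 1 7 (get 37 (.var 20)))) .skip)

def candCmd : Cmd := seq upCmd (seq prepCmd (seq hungCmd (seq colorCmd
  (forTo 14 5 (seq selectCmd keepCmd)))))

def initCmd : Cmd := seq (set 12 (sum 50 1 (get 11 (.var 50)))) (fill 20 1 7 (lit 1))

def setupCmd : Cmd := seq (prodDen 10 4) (seq (prodDen 11 6) (seq (scale 10 11 3 4)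
  (seq (scale 11 12 5 6) (seq domCmd (seq crossCmd (seq zcCmd pieceCmd))))))

def roundCmd : Cmd := seq initCmd (forTo 13 0 candCmd)

def mainCmd : Cmd := seq setupCmd roundCmd

theorem mainCmd_wf : mainCmd.wf = true := by decide

end Aug

end RAM

namespace RAM

theorem sum_tv_le_one {s : Finset ℕ} {P : ℕ → Prop} (h : ∀ p ∈ s, ∀ q ∈ s, P p → P q → p = q) :
    ∑ q ∈ s, tv (P q) ≤ 1 := by
  by_cases hex : ∃ q ∈ s, P q
  · obtain ⟨q, hq, hP⟩ := hex
    rw [Finset.sum_eq_single q (fun p hp hne => tv_false fun hPp => hne (h p hp q hq hPp hP))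
      (fun hq' => absurd hq hq')]
    exact tv_le_one _
  · rw [Finset.sum_eq_zero fun q hq => tv_false fun hP => hex ⟨q, hq, hP⟩]
    norm_num

namespace Aug

/-! ### The combinatorial instance -/

/-- A rooted tree given by its domination relation, with links, costs and values. -/
structure Inst where
  n : ℕ
  m : ℕ
  r : ℕ
  src : ℕ → ℕ
  tgt : ℕ → ℕ
  C : ℕ → ℤ
  Z : ℕ → ℤ
  dom : ℕ → ℕ → Prop
  src_lt : ∀ l < m, src l < n
  tgt_lt : ∀ l < m, tgt l < n
  C_nonneg : ∀ l, 0 ≤ C l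
  Z_nonneg : ∀ l, 0 ≤ Z l
  C_of_le : ∀ l, m ≤ l → C l = 0
  dom_refl : ∀ v < n, dom v v
  dom_trans : ∀ {u v w}, dom u v → dom v w → dom u w
  dom_antisymm : ∀ {u v}, dom u v → dom v u → u = v
  dom_chain : ∀ {u v w}, dom u w → dom v w → dom u v ∨ dom v u
  dom_root : ∀ v < n, dom r v
  covered : ∀ v < n, v ≠ r → ∃ l < m, ¬(dom v (src l) ↔ dom v (tgt l))

namespace Inst

variable (I : Inst)

/-- The path of a link uses the edge from `v` to its parent exactly if one of its ends lies below
`v` and the other does not. -/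
def cov (v l : ℕ) : Prop := ¬(I.dom v (I.src l) ↔ I.dom v (I.tgt l))

/-- Two vertices other than the root are in the same tree of the forest without the root exactly if
some non-root vertex dominates both. -/
def cross (l : ℕ) : Prop :=
  I.src l ≠ I.r ∧ I.tgt l ≠ I.r ∧ ∀ v < I.n, v = I.r ∨ ¬(I.dom v (I.src l) ∧ I.dom v (I.tgt l))

noncomputable def zc (v : ℕ) : ℤ :=
  ∑ l ∈ Finset.range I.m, tv (I.cross l ∧ I.cov v l) * I.Z l

/-- Each link `l` yields two vertical pieces, `l` and `m + l`, that run up from its source and from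
its target to the apex. A piece consists of the vertices above its own end `pu` that are not above
the opposite end `pw`. -/
def pu (q : ℕ) : ℕ := if q < I.m then I.src q else I.tgt (q - I.m)
def pw (q : ℕ) : ℕ := if q < I.m then I.tgt q else I.src (q - I.m)
def pC (q : ℕ) : ℤ := if q < I.m then I.C q else I.C (q - I.m)
def pc (q v : ℕ) : Prop := I.dom v (I.pu q) ∧ ¬I.dom v (I.pw q)

/-- Vertices whose edge has to be covered by pieces, for the threshold given by `v₀`. -/
def ground (v₀ v : ℕ) : Prop := v ≠ I.r ∧ ¬ I.zc v₀ < I.zc v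

/-- Lowest vertices whose edge has to be covered by cross-links. -/
def lowest (v₀ v : ℕ) : Prop :=
  I.zc v₀ < I.zc v ∧ ∀ u < I.n, I.zc v₀ < I.zc u → I.dom v u → u = v

theorem pC_nonneg (q : ℕ) : 0 ≤ I.pC q := by
  unfold pC; split_ifs <;> exact I.C_nonneg _

theorem exists_piece {v : ℕ} (hv : v < I.n) (hr : v ≠ I.r) : ∃ q < 2 * I.m, I.pc q v := by
  obtain ⟨l, hl, h⟩ := I.covered v hv hr
  by_cases h1 : I.dom v (I.src l)
  · exact ⟨l, by omega, by simp only [pc, pu, pw, if_pos hl]; tauto⟩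
  · refine ⟨I.m + l, by omega, ?_⟩
    simp only [pc, pu, pw, if_neg (show ¬ I.m + l < I.m by omega), Nat.add_sub_cancel_left]
    tauto

variable {I}

theorem pc_convex {q u v w : ℕ} (h1 : I.pc q u) (h2 : I.pc q w) (huv : I.dom u v)
    (hvw : I.dom v w) : I.pc q v :=
  ⟨I.dom_trans hvw h2.1, fun h => h1.2 (I.dom_trans huv h)⟩

/-- The vertices above `v` that belong to two pieces through `v` are nested. -/
theorem pc_nested {p q v : ℕ} (hp : I.pc p v) (hq : I.pc q v) :
    (∀ f, I.dom f v → I.pc p f → I.pc q f) ∨ (∀ f, I.dom f v → I.pc q f → I.pc p f) := by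
  -- The vertices above `v` form a chain, in which both pieces are intervals ending at `v`; such
  -- intervals are nested.
  by_contra! h
  obtain ⟨⟨f, hf, hpf, hqf⟩, g, hg, hqg, hpg⟩ := h
  rcases I.dom_chain hf hg with h1 | h1
  · exact hpg (pc_convex hpf hp h1 hg)
  · exact hqf (pc_convex hqg hq h1 hf)

theorem pc_comparable {q u v : ℕ} (hu : I.pc q u) (hv : I.pc q v) : I.dom u v ∨ I.dom v u :=
  I.dom_chain hu.1 hv.1

variable (I)

/-- Some stamped piece covers `v`. -/
def stamped (st : ℕ → ℤ) (v : ℕ) : Prop := ∃ q < 2 * I.m, 0 < st q ∧ I.pc q v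

noncomputable def res (y : ℕ → ℤ) (q : ℕ) : ℤ :=
  I.pC q - ∑ v ∈ Finset.range I.n, tv (I.pc q v) * y v

open Classical in
/-- Invariant of the primal-dual phase. -/
structure DualInv (v₀ k : ℕ) (y st : ℕ → ℤ) : Prop where
  y_nonneg : ∀ v < I.n, 0 ≤ y v
  -- The number `j` is the stamp given when `v` was treated: stamped pieces through `v` carry stamp
  -- `j` or later, and all ground vertices strictly below `v` were covered before.
  y_supp : ∀ v < I.n, y v ≠ 0 → I.ground v₀ v ∧ I.stamped st v ∧
    ∃ j : ℤ, j ≤ k ∧ (∀ q < 2 * I.m, 0 < st q → I.pc q v → j ≤ st q) ∧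
      ∀ f < I.n, I.ground v₀ f → I.dom v f → f ≠ v → ∃ q < 2 * I.m, 0 < st q ∧ st q < j ∧ I.pc q f
  res_nonneg : ∀ q < 2 * I.m, 0 ≤ I.res y q
  st_nonneg : ∀ q < 2 * I.m, 0 ≤ st q
  st_le : ∀ q < 2 * I.m, st q ≤ k
  st_res : ∀ q < 2 * I.m, 0 < st q → I.res y q = 0
  st_inj : ∀ p < 2 * I.m, ∀ q < 2 * I.m, 0 < st p → st p = st q → p = q
  -- Each round covers a new ground vertex unless all are covered, so `n` rounds suffice.
  progress : ((Finset.range I.n).filter fun v => I.ground v₀ v ∧ ¬ I.stamped st v).card + k ≤ I.n ∨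
    ∀ v < I.n, I.ground v₀ v → I.stamped st v

variable {I}

/-- Among the vertices below `v` with property `P`, one with the most dominators, that is, of
greatest depth, will do. -/
theorem exists_lowest {P : ℕ → Prop} {v : ℕ} (hv : v < I.n) (hP : P v) :
    ∃ u < I.n, P u ∧ I.dom v u ∧ ∀ w < I.n, P w → I.dom u w → w = u := by
  classical
  set S := (Finset.range I.n).filter fun u => P u ∧ I.dom v u with hS
  have hne : S.Nonempty := ⟨v, by simp [hS, hv, hP, I.dom_refl v hv]⟩
  obtain ⟨u, hu, hmax⟩ := Finset.exists_max_image S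
    (fun u => ((Finset.range I.n).filter fun w => I.dom w u).card) hne
  simp only [hS, Finset.mem_filter, Finset.mem_range] at hu
  refine ⟨u, hu.1, hu.2.1, hu.2.2, ?_⟩
  intro w hw hPw huw
  by_contra hne'
  have h1 := hmax w (by simp [hS, hw, hPw, I.dom_trans hu.2.2 huw])
  refine absurd h1 (not_le.2 (Finset.card_lt_card ?_))
  refine ⟨?_, ?_⟩
  · intro x hx
    simp only [Finset.mem_filter, Finset.mem_range] at hx ⊢
    exact ⟨hx.1, I.dom_trans hx.2 huw⟩
  · intro hsub
    have : w ∈ (Finset.range I.n).filter fun x => I.dom x u :=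
      hsub (by simp [hw, I.dom_refl w hw])
    simp only [Finset.mem_filter] at this
    exact hne' (I.dom_antisymm this.2 huw)

theorem DualInv.init (v₀ : ℕ) {y st : ℕ → ℤ} (hy : ∀ v < I.n, y v = 0)
    (hst : ∀ q < 2 * I.m, st q = 0) : I.DualInv v₀ 0 y st := by
  have hres : ∀ q, I.res y q = I.pC q := by
    intro q
    rw [res, Finset.sum_eq_zero, sub_zero]
    intro v hv
    rw [hy v (Finset.mem_range.1 hv), mul_zero]
  refine ⟨fun v hv => (hy v hv).ge, fun v hv h => absurd (hy v hv) h, fun q _ => ?_,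
    fun q hq => (hst q hq).ge, fun q hq => (hst q hq).le, fun q hq h => ?_, fun p hp q _ h => ?_, ?_⟩
  · rw [hres]; exact I.pC_nonneg q
  · rw [hst q hq] at h; exact absurd h (lt_irrefl _)
  · rw [hst p hp] at h; exact absurd h (lt_irrefl _)
  · left
    classical
    rw [add_zero]
    exact (Finset.card_filter_le _ _).trans (by simp)

theorem DualInv.skip {v₀ k : ℕ} {y st : ℕ → ℤ} (h : I.DualInv v₀ k y st)
    (hall : ∀ v < I.n, I.ground v₀ v → I.stamped st v) : I.DualInv v₀ (k + 1) y st := by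
  refine ⟨h.y_nonneg, ?_, h.res_nonneg, h.st_nonneg, ?_, h.st_res, h.st_inj, Or.inr hall⟩
  · intro v hv hy
    obtain ⟨h1, h2, j, h3, h4⟩ := h.y_supp v hv hy
    exact ⟨h1, h2, j, by push_cast; omega, h4⟩
  · intro q hq
    have := h.st_le q hq
    push_cast; omega

/-- No stamped piece contains `v`, so tight pieces stay tight, and by minimality of the residual of
`q` the dual solution stays feasible. The choice of `v` as a lowest uncovered vertex gives `y_supp`
with `j = k + 1`. -/
theorem DualInv.step {v₀ k : ℕ} {y st : ℕ → ℤ} (h : I.DualInv v₀ k y st) {v q : ℕ} (hv : v < I.n)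
    (hG : I.ground v₀ v) (hun : ¬ I.stamped st v)
    (hlow : ∀ f < I.n, I.ground v₀ f → ¬ I.stamped st f → I.dom v f → f = v)
    (hq : q < 2 * I.m) (hqv : I.pc q v)
    (hmin : ∀ p < 2 * I.m, I.pc p v → I.res y q ≤ I.res y p) :
    I.DualInv v₀ (k + 1) (Function.update y v (I.res y q))
      (Function.update st q ((k : ℤ) + 1)) := by
  classical
  have hyv : y v = 0 := by
    by_contra h0
    exact hun (h.y_supp v hv h0).2.1
  have hstq : st q = 0 := by
    have h1 := h.st_nonneg q hq
    by_contra h0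
    exact hun ⟨q, hq, by omega, hqv⟩
  have hres : ∀ p, I.res (Function.update y v (I.res y q)) p =
      I.res y p - tv (I.pc p v) * I.res y q := by
    intro p
    generalize I.res y q = R
    have h1 : ∀ x ∈ Finset.range I.n, tv (I.pc p x) * Function.update y v R x =
        tv (I.pc p x) * y x + if x = v then tv (I.pc p v) * R else 0 := by
      intro x _
      by_cases hx : x = v
      · subst hx; simp [hyv]
      · simp [hx]
    rw [res, res, Finset.sum_congr rfl h1, Finset.sum_add_distrib, Finset.sum_ite_eq',
      if_pos (Finset.mem_range.2 hv)]
    ring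
  have hst' : ∀ p, 0 < Function.update st q ((k : ℤ) + 1) p ↔ p = q ∨ 0 < st p := by
    intro p
    rw [Function.update_apply]
    split_ifs with hp
    · simp [hp]
    · simp [hp]
  have hold : ∀ p < 2 * I.m, 0 < st p → Function.update st q ((k : ℤ) + 1) p = st p := by
    intro p hp h0
    rw [Function.update_of_ne]
    rintro rfl
    omega
  have hstamped : ∀ u, I.stamped st u → I.stamped (Function.update st q ((k : ℤ) + 1)) u := by
    rintro u ⟨p, hp, hp0, hpu⟩
    exact ⟨p, hp, (hst' p).2 (Or.inr hp0), hpu⟩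
  have hvst : I.stamped (Function.update st q ((k : ℤ) + 1)) v :=
    ⟨q, hq, (hst' q).2 (Or.inl rfl), hqv⟩
  have hr0 := h.res_nonneg q hq
  refine ⟨?_, ?_, ?_, ?_, ?_, ?_, ?_, ?_⟩
  · intro u hu
    rw [Function.update_apply]
    split_ifs
    · exact hr0
    · exact h.y_nonneg u hu
  · intro u hu hyu
    by_cases huv : u = v
    · subst huv
      refine ⟨hG, hvst, (k : ℤ) + 1, by push_cast; omega, ?_, ?_⟩
      · intro p hp h0 hpu
        rcases (hst' p).1 h0 with rfl | h1
        · simp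
        · exact absurd ⟨p, hp, h1, hpu⟩ hun
      · intro f hf hGf hdf hne
        have hsf : I.stamped st f := by
          by_contra h0
          exact hne (hlow f hf hGf h0 hdf)
        obtain ⟨p, hp, hp0, hpf⟩ := hsf
        refine ⟨p, hp, (hst' p).2 (Or.inr hp0), ?_, hpf⟩
        rw [hold p hp hp0]
        have := h.st_le p hp
        omega
    · rw [Function.update_of_ne huv] at hyu
      obtain ⟨h1, h2, j, h3, h4, h5⟩ := h.y_supp u hu hyu
      refine ⟨h1, hstamped u h2, j, by push_cast; omega, ?_, ?_⟩
      · intro p hp h0 hpu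
        rcases (hst' p).1 h0 with rfl | h6
        · rw [Function.update_self]; omega
        · rw [hold p hp h6]; exact h4 p hp h6 hpu
      · intro f hf hGf hdf hne
        obtain ⟨p, hp, hp0, hpj, hpf⟩ := h5 f hf hGf hdf hne
        exact ⟨p, hp, (hst' p).2 (Or.inr hp0), by rwa [hold p hp hp0], hpf⟩
  · intro p hp
    rw [hres]
    by_cases hpv : I.pc p v
    · rw [tv_true hpv]
      have := hmin p hp hpv
      linarith
    · rw [tv_false hpv]
      have := h.res_nonneg p hp
      linarith
  · intro p hp
    rw [Function.update_apply]
    split_ifs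
    · positivity
    · exact h.st_nonneg p hp
  · intro p hp
    rw [Function.update_apply]
    split_ifs
    · push_cast; exact le_rfl
    · have := h.st_le p hp
      push_cast; omega
  · intro p hp h0
    rw [hres]
    rcases (hst' p).1 h0 with rfl | h1
    · rw [tv_true hqv]; ring
    · rw [h.st_res p hp h1, tv_false (fun hpv => hun ⟨p, hp, h1, hpv⟩)]; ring
  · intro p hp p' hp' h0 heq
    rcases (hst' p).1 h0 with rfl | h1
    · by_contra hne
      rw [Function.update_self, Function.update_of_ne (Ne.symm hne)] at heq
      have := h.st_le p' hp'
      omega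
    · rw [hold p hp h1] at heq
      by_cases hpq : p' = q
      · subst hpq
        rw [Function.update_self] at heq
        have := h.st_le p hp
        omega
      · rw [Function.update_of_ne hpq] at heq
        exact h.st_inj p hp p' hp' h1 heq
  · rcases h.progress with h1 | h1
    · left
      have hlt : ((Finset.range I.n).filter fun u => I.ground v₀ u ∧
          ¬ I.stamped (Function.update st q ((k : ℤ) + 1)) u).card <
          ((Finset.range I.n).filter fun u => I.ground v₀ u ∧ ¬ I.stamped st u).card := by
        apply Finset.card_lt_card
        refine ⟨?_, ?_⟩
        · intro u hu
          simp only [Finset.mem_filter] at hu ⊢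
          exact ⟨hu.1, hu.2.1, fun h0 => hu.2.2 (hstamped u h0)⟩
        · intro hsub
          have := hsub (show v ∈ _ by simp [hv, hG, hun])
          simp only [Finset.mem_filter] at this
          exact this.2.2 hvst
      omega
    · right
      intro u hu hGu
      exact hstamped u (h1 u hu hGu)

theorem DualInv.all_stamped {v₀ : ℕ} {y st : ℕ → ℤ} (h : I.DualInv v₀ I.n y st) :
    ∀ v < I.n, I.ground v₀ v → I.stamped st v := by
  rcases h.progress with h1 | h1
  · classical
    intro v hv hG
    by_contra h0
    have h2 := Finset.card_eq_zero.1 (Nat.le_zero.1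
      (Nat.le_of_add_le_add_right (b := I.n) (by rwa [zero_add])))
    exact Finset.filter_eq_empty_iff.1 h2 (Finset.mem_range.2 hv) ⟨hG, h0⟩
  · exact h1

variable (I)

/-- Invariant of the reverse deletion. -/
structure PruneInv (v₀ k : ℕ) (st keep : ℕ → ℤ) : Prop where
  pos : ∀ q < 2 * I.m, 0 < keep q → 0 < st q
  covers : ∀ v < I.n, I.ground v₀ v → ∃ q < 2 * I.m, 0 < keep q ∧ I.pc q v
  -- A vertex that prevented the deletion of `q`: when `q` was considered, all pieces with smaller
  -- stamps were still present, so none of these contains it, and no other kept piece does.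
  witness : ∀ q < 2 * I.m, 0 < keep q → (I.n : ℤ) - k < st q →
    ∃ f < I.n, I.ground v₀ f ∧ I.pc q f ∧ (∀ p < 2 * I.m, 0 < st p → st p < st q → ¬ I.pc p f) ∧
      ∀ p < 2 * I.m, p ≠ q → 0 < keep p → ¬ I.pc p f
  old : ∀ q < 2 * I.m, 0 < st q → st q ≤ (I.n : ℤ) - k → 0 < keep q

variable {I}

theorem PruneInv.init {v₀ : ℕ} {y st keep : ℕ → ℤ} (h : I.DualInv v₀ I.n y st)
    (hk : ∀ q < 2 * I.m, (0 < keep q ↔ 0 < st q)) : I.PruneInv v₀ 0 st keep := by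
  refine ⟨fun q hq => (hk q hq).1, ?_, ?_, fun q hq h0 _ => (hk q hq).2 h0⟩
  · intro v hv hG
    obtain ⟨q, hq, h0, hc⟩ := h.all_stamped v hv hG
    exact ⟨q, hq, (hk q hq).2 h0, hc⟩
  · intro q hq _ h1
    have := h.st_le q hq
    push_cast at h1
    omega

/-- No piece has the stamp under consideration. -/
theorem PruneInv.skip {v₀ k : ℕ} {st keep : ℕ → ℤ} (h : I.PruneInv v₀ k st keep)
    (hno : ∀ q < 2 * I.m, st q ≠ (I.n : ℤ) - k) : I.PruneInv v₀ (k + 1) st keep := by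
  refine ⟨h.pos, h.covers, ?_, ?_⟩
  · intro q hq h0 h1
    push_cast at h1
    have := hno q hq
    exact h.witness q hq h0 (by omega)
  · intro q hq h0 h1
    push_cast at h1
    exact h.old q hq h0 (by omega)

/-- The piece under consideration is needed. -/
theorem PruneInv.keep {v₀ k : ℕ} {y st keep : ℕ → ℤ} (hd : I.DualInv v₀ I.n y st)
    (h : I.PruneInv v₀ k st keep) {q f : ℕ} (hq : q < 2 * I.m)
    (hst : st q = (I.n : ℤ) - k) (hf : f < I.n)
    (hG : I.ground v₀ f) (hqf : I.pc q f)
    (hno : ∀ p < 2 * I.m, p ≠ q → 0 < keep p → ¬ I.pc p f) : I.PruneInv v₀ (k + 1) st keep := by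
  refine ⟨h.pos, h.covers, ?_, ?_⟩
  · intro p hp h0 h1
    push_cast at h1
    by_cases hpq : p = q
    · subst hpq
      refine ⟨f, hf, hG, hqf, ?_, hno⟩
      intro p' hp' h2 h3
      refine hno p' hp' ?_ (h.old p' hp' h2 (by omega))
      rintro rfl
      omega
    · refine h.witness p hp h0 ?_
      by_contra h2
      exact hpq (hd.st_inj p hp q hq (h.pos p hp h0) (by omega))
  · intro p hp h0 h1
    push_cast at h1
    exact h.old p hp h0 (by omega)

/-- The piece under consideration is deleted. -/
theorem PruneInv.delete {v₀ k : ℕ} {y st keep : ℕ → ℤ} (hd : I.DualInv v₀ I.n y st)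
    (h : I.PruneInv v₀ k st keep) {q : ℕ} (hq : q < 2 * I.m)
    (hst : st q = (I.n : ℤ) - k)
    (hall : ∀ f < I.n, I.ground v₀ f → I.pc q f → ∃ p < 2 * I.m, p ≠ q ∧ 0 < keep p ∧ I.pc p f) :
    I.PruneInv v₀ (k + 1) st (Function.update keep q 0) := by
  have hpos : ∀ p, 0 < Function.update keep q 0 p ↔ p ≠ q ∧ 0 < keep p := by
    intro p
    rw [Function.update_apply]
    split_ifs with hp <;> simp [hp]
  refine ⟨fun p hp h0 => h.pos p hp ((hpos p).1 h0).2, ?_, ?_, ?_⟩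
  · intro v hv hG
    obtain ⟨p, hp, h0, hc⟩ := h.covers v hv hG
    by_cases hpq : p = q
    · subst hpq
      obtain ⟨p', hp', h1, h2, h3⟩ := hall v hv hG hc
      exact ⟨p', hp', (hpos p').2 ⟨h1, h2⟩, h3⟩
    · exact ⟨p, hp, (hpos p).2 ⟨hpq, h0⟩, hc⟩
  · intro p hp h0 h1
    push_cast at h1
    obtain ⟨hpq, h0'⟩ := (hpos p).1 h0
    have hne : st p ≠ st q := fun h2 => hpq (hd.st_inj p hp q hq (h.pos p hp h0') h2)
    obtain ⟨f, hf, hG, hpf, h2, h3⟩ := h.witness p hp h0' (by omega)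
    exact ⟨f, hf, hG, hpf, h2, fun p' hp' h4 h5 => h3 p' hp' h4 ((hpos p').1 h5).2⟩
  · intro p hp h0 h1
    push_cast at h1
    refine (hpos p).2 ⟨?_, h.old p hp h0 (by omega)⟩
    rintro rfl
    omega

/-- After reverse deletion every vertex with positive dual value is covered only once. -/
theorem PruneInv.unique {v₀ : ℕ} {y st keep : ℕ → ℤ} (hd : I.DualInv v₀ I.n y st)
    (h : I.PruneInv v₀ I.n st keep) {v p q : ℕ} (hv : v < I.n) (hy : y v ≠ 0) (hp : p < 2 * I.m)
    (hq : q < 2 * I.m) (hkp : 0 < keep p) (hkq : 0 < keep q) (hpv : I.pc p v) (hqv : I.pc q v) :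
    p = q := by
  -- Let `f` be the witness of `p`. If `f` is at or above `v`, then `q` covers it too, which is
  -- excluded. If `f` is strictly below `v`, then a piece stamped before `v` was treated covers `f`;
  -- but `p` contains `v` and was stamped no earlier than that, so its witness lies in no such
  -- piece.
  have key : ∀ p < 2 * I.m, ∀ q < 2 * I.m, 0 < keep p → 0 < keep q → I.pc p v → I.pc q v →
      (∀ f, I.dom f v → I.pc p f → I.pc q f) → p = q := by
    intro p hp q hq hkp hkq hpv hqv hsub
    by_contra hne
    obtain ⟨f, hf, hG, hpf, h1, h2⟩ := h.witness p hp hkp (by have := h.pos p hp hkp; omega)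
    obtain ⟨-, -, j, hj, hj1, hj2⟩ := hd.y_supp v hv hy
    by_cases hfv : f = v
    · subst hfv
      exact h2 q hq (Ne.symm hne) hkq hqv
    rcases pc_comparable hpf hpv with h3 | h3
    · exact h2 q hq (Ne.symm hne) hkq (hsub f h3 hpf)
    · obtain ⟨p', hp', h4, h5, h6⟩ := hj2 f hf hG h3 hfv
      have h7 := hj1 p hp (h.pos p hp hkp) hpv
      exact h1 p' hp' h4 (by omega) h6
  rcases pc_nested hpv hqv with h1 | h1
  · exact key p hp q hq hkp hkq hpv hqv h1
  · exact (key q hq p hp hkq hkp hqv hpv h1).symm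

variable (I)

/-- What the covering by pieces provides. -/
structure UpOut (v₀ : ℕ) (y keep : ℕ → ℤ) : Prop where
  y_nonneg : ∀ v < I.n, 0 ≤ y v
  y_supp : ∀ v < I.n, y v ≠ 0 → I.ground v₀ v
  feasible : ∀ q < 2 * I.m, ∑ v ∈ Finset.range I.n, tv (I.pc q v) * y v ≤ I.pC q
  covers : ∀ v < I.n, I.ground v₀ v → ∃ q < 2 * I.m, 0 < keep q ∧ I.pc q v
  cost_le : ∑ q ∈ Finset.range (2 * I.m), tv (0 < keep q) * I.pC q ≤ ∑ v ∈ Finset.range I.n, y v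

variable {I}

/-- Kept pieces are tight, so their costs are sums of dual values, in which each positive dual value
occurs at most once by `PruneInv.unique`. -/
theorem PruneInv.upOut {v₀ : ℕ} {y st keep : ℕ → ℤ} (hd : I.DualInv v₀ I.n y st)
    (h : I.PruneInv v₀ I.n st keep) : I.UpOut v₀ y keep := by
  refine ⟨hd.y_nonneg, fun v hv hy => (hd.y_supp v hv hy).1, ?_, h.covers, ?_⟩
  · intro q hq
    have := hd.res_nonneg q hq
    unfold res at this
    linarith
  · have h1 : ∑ q ∈ Finset.range (2 * I.m), tv (0 < keep q) * I.pC q =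
        ∑ q ∈ Finset.range (2 * I.m), ∑ v ∈ Finset.range I.n, tv (0 < keep q ∧ I.pc q v) * y v := by
      apply Finset.sum_congr rfl
      intro q hq
      rw [Finset.mem_range] at hq
      by_cases hk : 0 < keep q
      · have h2 := hd.st_res q hq (h.pos q hq hk)
        unfold res at h2
        rw [tv_true hk]
        simp only [hk, true_and, one_mul]
        linarith
      · simp [hk, tv]
    rw [h1, Finset.sum_comm]
    apply Finset.sum_le_sum
    intro v hv
    rw [Finset.mem_range] at hv
    by_cases hy : y v = 0
    · simp [hy]
    rw [← Finset.sum_mul]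
    have h3 : ∑ q ∈ Finset.range (2 * I.m), tv (0 < keep q ∧ I.pc q v) ≤ 1 := by
      refine sum_tv_le_one ?_
      intro p hp q hq h5 h6
      rw [Finset.mem_range] at hp hq
      exact h.unique hd hv hy hp hq h5.1 h6.1 h5.2 h6.2
    have h4 := hd.y_nonneg v hv
    nlinarith

end Inst

end Aug

end RAM

namespace RAM

namespace Aug

/-! ### The Hungarian method -/

section Hungarian

variable {n k : ℕ} {w : ℕ → ℕ → ℤ} {α β : ℕ → ℤ} {σ cs par : ℕ → ℕ}

/-- The rows below `k` are matched along tight pairs, with respect to feasible potentials;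
free columns other than `z` have potential `0`. -/
structure Matched (n k z : ℕ) (w : ℕ → ℕ → ℤ) (α β : ℕ → ℤ) (σ : ℕ → ℕ) : Prop where
  feas : ∀ i < n, ∀ j < n, α i + β j ≤ w i j
  lt : ∀ i < k, σ i < n
  inj : ∀ i < k, ∀ i' < k, σ i = σ i' → i = i'
  tight : ∀ i < k, α i + β (σ i) = w i (σ i)
  nonneg : ∀ i < n, 0 ≤ α i
  nonpos : ∀ j < n, β j ≤ 0
  free : ∀ j < n, j ≠ z → (∀ i < k, σ i ≠ j) → β j = 0

theorem Matched.exists_free {z : ℕ} (_ : Matched n k z w α β σ) (hk : k < n) :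
    ∃ j < n, ∀ i < k, σ i ≠ j := by
  by_contra! hcon
  have hsub : Finset.range n ⊆ (Finset.range k).image σ := by
    intro j hj
    obtain ⟨i, hi, hij⟩ := hcon j (Finset.mem_range.1 hj)
    exact Finset.mem_image.2 ⟨i, Finset.mem_range.2 hi, hij⟩
  have := (Finset.card_le_card hsub).trans Finset.card_image_le
  simp at this
  omega

/-- While some column is free, its potential is 0, and feasibility there bounds all row potentials
by an arc cost. This and the next bound keep the numbers in memory small. -/
theorem Matched.le_of_lt (h : Matched n k n w α β σ) (hk : k < n) {W : ℤ}
    (hW : ∀ i < n, ∀ j < n, w i j ≤ W) {i : ℕ} (hi : i < n) : α i ≤ W := by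
  obtain ⟨j, hj, hfree⟩ := h.exists_free hk
  have h1 := h.feas i hi j hj
  have h2 := h.free j hj hj.ne hfree
  have h3 := hW i hi j hj
  linarith

theorem Matched.neg_le_of_lt (h : Matched n k n w α β σ) (hk : k < n) {W : ℤ}
    (hW : ∀ i < n, ∀ j < n, w i j ≤ W) (hw : ∀ i < n, ∀ j < n, 0 ≤ w i j) {j : ℕ} (hj : j < n) :
    -W ≤ β j := by
  have hW0 : 0 ≤ W := (hw j hj j hj).trans (hW j hj j hj)
  by_cases hfree : ∀ i < k, σ i ≠ j
  · rw [h.free j hj hj.ne hfree]; linarith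
  · push Not at hfree
    obtain ⟨i, hi, rfl⟩ := hfree
    have h1 := h.tight i hi
    have h2 := h.le_of_lt hk hW (show i < n by omega)
    have h3 := hw i (by omega) (σ i) hj
    linarith

/-- `j` was reached from a row that was reached earlier. -/
def Reached (n k : ℕ) (w : ℕ → ℕ → ℤ) (α β : ℕ → ℤ) (σ cs par : ℕ → ℕ) (j : ℕ) : Prop :=
  par j < n ∧ α (par j) + β j = w (par j) j ∧
    -- The column matched to the parent row was reached strictly earlier, so following parents leads
    -- back to row `k`.
    (par j = k ∨ par j < k ∧ 0 < cs (σ (par j)) ∧ cs (σ (par j)) < cs j)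

open Classical in
/-- Search for an augmenting path from row `k`, after `t` steps. -/
structure Search (n k t : ℕ) (w : ℕ → ℕ → ℤ) (α β : ℕ → ℤ) (σ : ℕ → ℕ) (inR : ℕ → ℤ)
    (cs par : ℕ → ℕ) : Prop where
  mat : Matched n k n w α β σ
  row : ∀ i < n, (0 < inR i ↔ i = k ∨ i < k ∧ 0 < cs (σ i))
  cs_le : ∀ j < n, cs j ≤ t
  col : ∀ j < n, 0 < cs j → ∃ i < k, σ i = j
  reached : ∀ j < n, 0 < cs j → Reached n k w α β σ cs par j
  card : ((Finset.range n).filter fun j => 0 < cs j).card = t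

/-- An augmenting path ends in the free column `j`; its length is at most `t`. -/
structure Found (n k t : ℕ) (w : ℕ → ℕ → ℤ) (α β : ℕ → ℤ) (σ : ℕ → ℕ)
    (cs par : ℕ → ℕ) (j : ℕ) : Prop where
  mat : Matched n k j w α β σ
  lt : j < n
  pos : 0 < cs j
  le : cs j ≤ t
  free : ∀ i < k, σ i ≠ j
  reached : ∀ j' < n, 0 < cs j' → cs j' ≤ cs j → Reached n k w α β σ cs par j'

theorem Search.init (h : Matched n k n w α β σ) {inR : ℕ → ℤ} (hR : ∀ i < n, (0 < inR i ↔ i = k))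
    (hcs : ∀ j < n, cs j = 0) : Search n k 0 w α β σ inR cs par := by
  refine ⟨h, ?_, fun j hj => (hcs j hj).le, ?_, ?_, ?_⟩
  · intro i hi
    rw [hR i hi]
    constructor
    · exact Or.inl
    · rintro (h1 | ⟨h1, h2⟩)
      · exact h1
      · rw [hcs _ (h.lt i h1)] at h2
        exact absurd h2 (lt_irrefl _)
  · intro j hj h1; rw [hcs j hj] at h1; exact absurd h1 (lt_irrefl _)
  · intro j hj h1; rw [hcs j hj] at h1; exact absurd h1 (lt_irrefl _)
  · rw [Finset.card_eq_zero, Finset.filter_eq_empty_iff]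
    intro j hj
    rw [hcs j (Finset.mem_range.1 hj)]
    simp

theorem Search.exists_elig {t : ℕ} {inR : ℕ → ℤ} (h : Search n k t w α β σ inR cs par)
    (hk : k < n) : ∃ i < n, ∃ j < n, 0 < inR i ∧ cs j = 0 := by
  obtain ⟨j, hj, hfree⟩ := h.mat.exists_free hk
  refine ⟨k, hk, j, hj, (h.row k hk).2 (Or.inl rfl), ?_⟩
  by_contra h0
  obtain ⟨i, hi, hij⟩ := h.col j hj (Nat.pos_of_ne_zero h0)
  exact hfree i hi hij

/-- During the search only matched columns have been reached, and at least one column is free. -/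
theorem Search.lt {t : ℕ} {inR : ℕ → ℤ} (h : Search n k t w α β σ inR cs par)
    (hk : k < n) : t < n := by
  classical
  obtain ⟨-, -, j, hj, -, h0⟩ := h.exists_elig hk
  rw [← h.card]
  calc _ < (Finset.range n).card := by
        apply Finset.card_lt_card
        refine ⟨Finset.filter_subset _ _, fun hsub => ?_⟩
        have := (Finset.mem_filter.1 (hsub (Finset.mem_range.2 hj))).2
        omega
    _ = n := Finset.card_range n

variable {t i₁ j₁ : ℕ} {inR : ℕ → ℤ} {δ : ℤ}

/-- The change of the potentials. -/
theorem Search.matched_update (h : Search n k t w α β σ inR cs par) (hk : k < n) (hi : i₁ < n)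
    (hj : j₁ < n) (hδ : δ = w i₁ j₁ - α i₁ - β j₁)
    (hmin : ∀ i < n, ∀ j < n, 0 < inR i → cs j = 0 → δ ≤ w i j - α i - β j) :
    Matched n k n w (fun i => α i + tv (0 < inR i) * δ) (fun j => β j - tv (0 < cs j) * δ) σ := by
  have hδ0 : 0 ≤ δ := by
    have := h.mat.feas i₁ hi j₁ hj
    linarith
  -- If row and column are both reached or both not, the changes cancel; this applies to matched
  -- pairs, since a row below `k` is reached together with its column.
  have key : ∀ i < n, ∀ j < n, (0 < inR i ↔ 0 < cs j) →
      α i + tv (0 < inR i) * δ + (β j - tv (0 < cs j) * δ) = α i + β j := by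
    intro i _ j _ hiff
    rw [propext hiff]; ring
  refine ⟨?_, h.mat.lt, h.mat.inj, ?_, ?_, ?_, ?_⟩
  · intro i hi j hj
    have hf := h.mat.feas i hi j hj
    by_cases hr : 0 < inR i <;> by_cases hc : 0 < cs j
    · rw [tv_true hr, tv_true hc]; linarith
    · have := hmin i hi j hj hr (by omega)
      rw [tv_true hr, tv_false hc]; linarith
    · rw [tv_false hr, tv_true hc]; linarith
    · rw [tv_false hr, tv_false hc]; linarith
  · intro i hi
    have hin : i < n := by omega
    rw [← h.mat.tight i hi]
    apply key i hin _ (h.mat.lt i hi)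
    rw [h.row i hin]
    constructor
    · rintro (h1 | h1)
      · omega
      · exact h1.2
    · exact fun h1 => Or.inr ⟨hi, h1⟩
  · intro i hi
    have h1 := h.mat.nonneg i hi
    have h2 := mul_nonneg (tv_nonneg (0 < inR i)) hδ0
    linarith
  · intro j hj
    have h1 := h.mat.nonpos j hj
    have h2 := mul_nonneg (tv_nonneg (0 < cs j)) hδ0
    linarith
  · intro j hj hjz hfree
    have h0 : ¬ 0 < cs j := by
      intro h1
      obtain ⟨i, hi, hij⟩ := h.col j hj h1
      exact hfree i hi hij
    rw [tv_false h0, h.mat.free j hj hjz hfree]; ring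

/-- The new pair becomes tight by the choice of `δ`; an older tree pair consists of a reached row
and a reached column, for which the changes cancel. -/
theorem Search.reached_update (h : Search n k t w α β σ inR cs par) (hi : i₁ < n)
    (hR : 0 < inR i₁) (hC : cs j₁ = 0) (hδ : δ = w i₁ j₁ - α i₁ - β j₁) {j : ℕ}
    (hj : j < n) (hcs : 0 < Function.update cs j₁ (t + 1) j) :
    Reached n k w (fun i => α i + tv (0 < inR i) * δ) (fun j => β j - tv (0 < cs j) * δ) σ
      (Function.update cs j₁ (t + 1)) (Function.update par j₁ i₁) j := by
  by_cases hjj : j = j₁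
  · subst hjj
    refine ⟨by simpa using hi, ?_, ?_⟩
    · simp only [Function.update_self]
      rw [tv_true hR, hC, tv_false (lt_irrefl 0), hδ]; ring
    · simp only [Function.update_self]
      rcases (h.row i₁ hi).1 hR with h1 | ⟨h1, h2⟩
      · exact Or.inl h1
      · right
        have hne : σ i₁ ≠ j := by rintro h3; rw [h3] at h2; omega
        rw [Function.update_of_ne hne]
        have := h.cs_le (σ i₁) (h.mat.lt i₁ h1)
        exact ⟨h1, h2, by omega⟩
  · rw [Function.update_of_ne hjj] at hcs
    obtain ⟨h1, h2, h3⟩ := h.reached j hj hcs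
    refine ⟨by rwa [Function.update_of_ne hjj], ?_, ?_⟩
    · rw [Function.update_of_ne hjj, ← h2]
      have hr : 0 < inR (par j) := (h.row _ h1).2 (h3.imp id fun h4 => ⟨h4.1, h4.2.1⟩)
      beta_reduce
      rw [tv_true hr, tv_true hcs]; ring
    · rw [Function.update_of_ne hjj]
      rcases h3 with h3 | ⟨h3, h4, h5⟩
      · exact Or.inl h3
      · right
        have hne : σ (par j) ≠ j₁ := by rintro h6; rw [h6] at h4; omega
        rw [Function.update_of_ne hne, Function.update_of_ne hjj]
        exact ⟨h3, h4, h5⟩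

theorem Search.step (h : Search n k t w α β σ inR cs par) (hk : k < n) (hi : i₁ < n)
    (hj : j₁ < n) (hR : 0 < inR i₁) (hC : cs j₁ = 0) (hδ : δ = w i₁ j₁ - α i₁ - β j₁)
    (hmin : ∀ i < n, ∀ j < n, 0 < inR i → cs j = 0 → δ ≤ w i j - α i - β j)
    {i₂ : ℕ} (hi2 : i₂ < k) (hσ : σ i₂ = j₁) :
    Search n k (t + 1) w (fun i => α i + tv (0 < inR i) * δ) (fun j => β j - tv (0 < cs j) * δ) σ
      (Function.update inR i₂ 1) (Function.update cs j₁ (t + 1)) (Function.update par j₁ i₁) := by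
  classical
  refine ⟨h.matched_update hk hi hj hδ hmin, ?_, ?_, ?_,
    fun j hj => h.reached_update hi hR hC hδ hj, ?_⟩
  · intro i hi
    by_cases hii : i = i₂
    · subst hii
      simp [hσ, hi2]
    · rw [Function.update_of_ne hii, h.row i hi]
      have : i < k → σ i ≠ j₁ := fun h1 h2 => hii (h.mat.inj i h1 i₂ hi2 (h2.trans hσ.symm))
      constructor
      · rintro (h1 | ⟨h1, h2⟩)
        · exact Or.inl h1
        · right
          rw [Function.update_of_ne (this h1)]
          exact ⟨h1, h2⟩
      · rintro (h1 | ⟨h1, h2⟩)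
        · exact Or.inl h1
        · rw [Function.update_of_ne (this h1)] at h2
          exact Or.inr ⟨h1, h2⟩
  · intro j hj
    rw [Function.update_apply]
    split_ifs
    · exact le_rfl
    · have := h.cs_le j hj
      omega
  · intro j hj hcs
    by_cases hjj : j = j₁
    · exact ⟨i₂, hi2, hσ.trans hjj.symm⟩
    · rw [Function.update_of_ne hjj] at hcs
      exact h.col j hj hcs
  · have : ((Finset.range n).filter fun j => 0 < Function.update cs j₁ (t + 1) j) =
        insert j₁ ((Finset.range n).filter fun j => 0 < cs j) := by
      ext j
      simp only [Finset.mem_filter, Finset.mem_range, Finset.mem_insert]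
      by_cases hjj : j = j₁
      · subst hjj; simp [hj]
      · simp [hjj]
    have hc := h.card
    rw [show ((Finset.range n).filter fun j => 0 < Function.update cs j₁ (t + 1) j).card =
      (insert j₁ ((Finset.range n).filter fun j => 0 < cs j)).card by rw [this],
      Finset.card_insert_of_notMem (by simp [hC])]
    convert congrArg (· + 1) hc using 3

/-- The end of the path is exempt from the condition that free columns have potential 0. The
exemption is of use while the path is flipped: then the free end is a formerly matched column, whose
potential may be negative. -/
theorem Search.found (h : Search n k t w α β σ inR cs par) (hk : k < n) (hi : i₁ < n)
    (hj : j₁ < n) (hR : 0 < inR i₁) (hC : cs j₁ = 0) (hδ : δ = w i₁ j₁ - α i₁ - β j₁)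
    (hmin : ∀ i < n, ∀ j < n, 0 < inR i → cs j = 0 → δ ≤ w i j - α i - β j)
    (hfree : ∀ i < k, σ i ≠ j₁) :
    Found n k n w (fun i => α i + tv (0 < inR i) * δ) (fun j => β j - tv (0 < cs j) * δ) σ
      (Function.update cs j₁ (t + 1)) (Function.update par j₁ i₁) j₁ := by
  have hm := h.matched_update hk hi hj hδ hmin
  refine ⟨{ hm with free := fun j hj _ => hm.free j hj hj.ne }, hj, by simp, ?_, hfree,
    fun j hj h1 _ => h.reached_update hi hR hC hδ hj h1⟩
  have := h.lt hk
  simp only [Function.update_self]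
  omega

theorem Found.finish {j : ℕ} (h : Found n k t w α β σ cs par j) (hk : k < n) (hp : par j = k) :
    Matched n (k + 1) n w α β (Function.update σ k j) := by
  have hold : ∀ i < k, Function.update σ k j i = σ i := fun i hi =>
    Function.update_of_ne (by omega) _ _
  obtain ⟨-, h2, -⟩ := h.reached j h.lt h.pos le_rfl
  rw [hp] at h2
  refine ⟨h.mat.feas, ?_, ?_, ?_, h.mat.nonneg, h.mat.nonpos, ?_⟩
  · intro i hi
    rcases Nat.lt_succ_iff_lt_or_eq.1 hi with h1 | rfl
    · rw [hold i h1]; exact h.mat.lt i h1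
    · rw [Function.update_self]; exact h.lt
  · intro i hi i' hi' heq
    rcases Nat.lt_succ_iff_lt_or_eq.1 hi with h1 | rfl <;>
      rcases Nat.lt_succ_iff_lt_or_eq.1 hi' with h3 | rfl
    · rw [hold i h1, hold i' h3] at heq
      exact h.mat.inj i h1 i' h3 heq
    · rw [hold i h1, Function.update_self] at heq
      exact absurd heq (h.free i h1)
    · rw [hold i' h3, Function.update_self] at heq
      exact absurd heq.symm (h.free i' h3)
    · rfl
  · intro i hi
    rcases Nat.lt_succ_iff_lt_or_eq.1 hi with h1 | rfl
    · rw [hold i h1]; exact h.mat.tight i h1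
    · rw [Function.update_self]; exact h2
  · intro j' hj' _ hfree
    have hne := hfree k (by omega)
    rw [Function.update_self] at hne
    refine h.mat.free j' hj' (Ne.symm hne) fun i hi => ?_
    rw [← hold i hi]
    exact hfree i (by omega)

/-- The parent row of `j` takes column `j` and gives up its own, which becomes the free end of a
shorter path. The old end is matched now, so the exempt column moves along. -/
theorem Found.step {j : ℕ} (h : Found n k (t + 1) w α β σ cs par j) (hp : par j ≠ k) :
    Found n k t w α β (Function.update σ (par j) j) cs par (σ (par j)) := by
  obtain ⟨-, h2, h3⟩ := h.reached j h.lt h.pos le_rfl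
  obtain ⟨h3, h4, h5⟩ := h3.resolve_left hp
  have hσ : σ (par j) < n := h.mat.lt _ h3
  have hle := h.le
  refine ⟨⟨h.mat.feas, ?_, ?_, ?_, h.mat.nonneg, h.mat.nonpos, ?_⟩, hσ, h4, by omega, ?_, ?_⟩
  · intro i hi
    rw [Function.update_apply]
    split_ifs
    · exact h.lt
    · exact h.mat.lt i hi
  · intro i hi i' hi' heq
    simp only [Function.update_apply] at heq
    split_ifs at heq with h6 h7 h7
    · rw [h6, h7]
    · exact absurd heq.symm (h.free i' hi')
    · exact absurd heq (h.free i hi)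
    · exact h.mat.inj i hi i' hi' heq
  · intro i hi
    rw [Function.update_apply]
    split_ifs with h6
    · rw [h6]; exact h2
    · exact h.mat.tight i hi
  · intro j' hj' hjz hfree
    have hne := hfree _ h3
    rw [Function.update_self] at hne
    refine h.mat.free j' hj' (Ne.symm hne) fun i hi hij => ?_
    by_cases hip : i = par j
    · subst hip; exact hjz hij.symm
    · exact hfree i hi (by rwa [Function.update_of_ne hip])
  · intro i hi
    rw [Function.update_apply]
    split_ifs with h6
    · exact fun h7 => h.free _ h3 h7.symm
    · exact fun h7 => h6 (h.mat.inj i hi _ h3 h7)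
  · intro j' hj' h6 h7
    obtain ⟨h8, h9, h10⟩ := h.reached j' hj' h6 (by omega)
    refine ⟨h8, h9, h10.imp id ?_⟩
    rintro ⟨h11, h12, h13⟩
    -- Otherwise the stamp of `σ (par j)` would be smaller than that of `j'`, which is at most the
    -- stamp of `σ (par j)`.
    have hne : par j' ≠ par j := by
      intro h14
      rw [h14] at h13
      omega
    rw [Function.update_of_ne hne]
    exact ⟨h11, h12, h13⟩

end Hungarian

end Aug

end RAM

/-! ### Assignment duality and rounding with three colours -/

namespace RAM

namespace Aug

theorem Matched.exists_preimage {n z : ℕ} {w : ℕ → ℕ → ℤ} {α β : ℕ → ℤ} {σ : ℕ → ℕ}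
    (h : Matched n n z w α β σ) {j : ℕ} (hj : j < n) : ∃ i < n, σ i = j := by
  have hinj : Set.InjOn σ (Finset.range n : Set ℕ) := by
    intro i hi i' hi' heq
    exact h.inj i (by simpa using hi) i' (by simpa using hi') heq
  have himg : (Finset.range n).image σ = Finset.range n := by
    apply Finset.eq_of_subset_of_card_le
    · intro x hx
      obtain ⟨i, hi, rfl⟩ := Finset.mem_image.1 hx
      exact Finset.mem_range.2 (h.lt i (Finset.mem_range.1 hi))
    · rw [Finset.card_image_of_injOn hinj]
  have : j ∈ (Finset.range n).image σ := by rw [himg]; exact Finset.mem_range.2 hj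
  obtain ⟨i, hi, hij⟩ := Finset.mem_image.1 this
  exact ⟨i, Finset.mem_range.1 hi, hij⟩

theorem Matched.sum_eq {n z : ℕ} {w : ℕ → ℕ → ℤ} {α β : ℕ → ℤ} {σ : ℕ → ℕ}
    (h : Matched n n z w α β σ) :
    ∑ v ∈ Finset.range n, (α v + β v) = ∑ u ∈ Finset.range n, w u (σ u) := by
  have h1 : ∑ u ∈ Finset.range n, β (σ u) = ∑ v ∈ Finset.range n, β v := by
    apply Finset.sum_bij (fun i _ => σ i)
    · intro i hi
      exact Finset.mem_range.2 (h.lt i (Finset.mem_range.1 hi))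
    · intro i hi i' hi' heq
      exact h.inj i (Finset.mem_range.1 hi) i' (Finset.mem_range.1 hi') heq
    · intro j hj
      obtain ⟨i, hi, hij⟩ := h.exists_preimage (Finset.mem_range.1 hj)
      exact ⟨i, Finset.mem_range.2 hi, hij⟩
    · intro i _; rfl
  rw [Finset.sum_add_distrib, ← h1, ← Finset.sum_add_distrib]
  exact Finset.sum_congr rfl fun u hu => h.tight u (Finset.mem_range.1 hu)

namespace Inst

variable (I : Inst)

/-- What the choice of links for single vertices and for pairs of vertices provides. -/
structure PairOut (v₀ : ℕ) (μ : ℕ → ℤ) (p₁ p₂ : ℕ → ℕ → ℕ) : Prop where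
  mu_zero : ∀ u < I.n, ¬ I.lowest v₀ u → μ u = 0
  single : ∀ u < I.n, I.lowest v₀ u → ∀ l < I.m, I.cross l → I.cov u l → μ u ≤ I.C l
  le_add : ∀ u < I.n, ∀ v < I.n, I.C (p₁ u v) + I.C (p₂ u v) ≤ μ u + μ v
  le_left : ∀ u < I.n, ∀ v < I.n, μ u ≤ I.C (p₁ u v) + I.C (p₂ u v)
  le_right : ∀ u < I.n, ∀ v < I.n, μ v ≤ I.C (p₁ u v) + I.C (p₂ u v)
  double : ∀ u < I.n, ∀ v < I.n, u ≠ v → I.lowest v₀ u → I.lowest v₀ v → ∀ l < I.m, I.cross l →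
    I.cov u l → I.cov v l → I.C (p₁ u v) + I.C (p₂ u v) ≤ I.C l
  diag : ∀ u < I.n, I.C (p₁ u u) = μ u ∧ I.C (p₂ u u) = μ u
  cover_left : ∀ u < I.n, ∀ v < I.n, I.lowest v₀ u →
    ∃ l < I.m, (l = p₁ u v ∨ l = p₂ u v) ∧ I.cross l ∧ I.cov u l
  cover_right : ∀ u < I.n, ∀ v < I.n, I.lowest v₀ v →
    ∃ l < I.m, (l = p₁ u v ∨ l = p₂ u v) ∧ I.cross l ∧ I.cov v l
  cover_diag : ∀ u < I.n, I.lowest v₀ u →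
    p₁ u u < I.m ∧ I.cross (p₁ u u) ∧ I.cov u (p₁ u u)

/-- Link `l` is selected for colour `t`. -/
def chosen (p₁ p₂ : ℕ → ℕ → ℕ) (σ : ℕ → ℕ) (κ : ℕ → ℤ) (t : ℕ) (l : ℕ) : Prop :=
  ∃ u < I.n, ((σ u = u ∨ κ u ≠ t) ∧ p₁ u (σ u) = l) ∨ ((σ u ≠ u ∧ κ u ≠ t) ∧ p₂ u (σ u) = l)

/-- A colouring with three colours of the arcs `u → σ u`. -/
structure Coloring (σ : ℕ → ℕ) (κ : ℕ → ℤ) : Prop where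
  nonneg : ∀ u < I.n, 0 ≤ κ u
  lt : ∀ u < I.n, κ u < 3
  ne : ∀ u < I.n, σ u ≠ u → κ u ≠ κ (σ u)

/-- Costs are bounded by dual solutions for the two parts of the tree. -/
def Bound (v₀ : ℕ) (best : ℤ) : Prop :=
  ∃ y γ : ℕ → ℤ, (∀ v < I.n, 0 ≤ y v) ∧ (∀ v < I.n, 0 ≤ γ v) ∧
    (∀ v < I.n, y v ≠ 0 → I.ground v₀ v) ∧ (∀ v < I.n, γ v ≠ 0 → I.zc v₀ < I.zc v) ∧
    -- The factors 2 have different origins: a link splits into two pieces, and a cross-link bounds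
    -- the arcs between its two lowest vertices in both directions.
    (∀ l < I.m, ∑ v ∈ Finset.range I.n, tv (I.cov v l) * y v ≤ 2 * I.C l) ∧
    (∀ l < I.m, I.cross l → ∑ v ∈ Finset.range I.n, tv (I.cov v l) * γ v ≤ 2 * I.C l) ∧
    3 * best ≤ 3 * ∑ v ∈ Finset.range I.n, y v + 2 * ∑ v ∈ Finset.range I.n, γ v

variable {I} {v₀ : ℕ} {μ : ℕ → ℤ} {p₁ p₂ : ℕ → ℕ → ℕ} {α β κ : ℕ → ℤ} {σ : ℕ → ℕ} {z : ℕ}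

theorem Bound.mono {a b : ℤ} (h : I.Bound v₀ a) (hab : b ≤ a) : I.Bound v₀ b := by
  obtain ⟨y, γ, h1, h2, h3, h4, h5, h6, h7⟩ := h
  exact ⟨y, γ, h1, h2, h3, h4, h5, h6, by linarith⟩

theorem zc_nonneg (v : ℕ) : 0 ≤ I.zc v :=
  Finset.sum_nonneg fun l _ => mul_nonneg (tv_nonneg _) (I.Z_nonneg l)

theorem zc_root : I.zc I.r = 0 := by
  apply Finset.sum_eq_zero
  intro l hl
  rw [Finset.mem_range] at hl
  rw [tv_false, zero_mul]
  rintro ⟨-, h⟩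
  exact h (iff_of_true (I.dom_root _ (I.src_lt l hl)) (I.dom_root _ (I.tgt_lt l hl)))

theorem ne_root_of_lt {v : ℕ} (h : I.zc v₀ < I.zc v) : v ≠ I.r := by
  rintro rfl
  rw [zc_root] at h
  exact absurd (zc_nonneg v₀) (not_le.2 h)

/-- Consequently a link covers at most one lowest vertex on each of its two sides. -/
theorem lowest_unique {u v x : ℕ} (hu : u < I.n) (hv : v < I.n) (hlu : I.lowest v₀ u)
    (hlv : I.lowest v₀ v) (hux : I.dom u x) (hvx : I.dom v x) : u = v := by
  rcases I.dom_chain hux hvx with h | h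
  · exact (hlu.2 v hv hlv.1 h).symm
  · exact hlv.2 u hu hlu.1 h

/-- A cross-link that covers a vertex covers everything above, except the root. -/
theorem cov_of_cross {l u v : ℕ} (hu : u < I.n) (hr : u ≠ I.r) (hl : I.cross l) (huv : I.dom u v)
    (hc : I.cov v l) : I.cov u l := by
  have h1 := (hl.2.2 u hu).resolve_left hr
  unfold cov at *
  by_cases h2 : I.dom v (I.src l)
  · have h3 := I.dom_trans huv h2
    tauto
  · have h3 : I.dom v (I.tgt l) := by tauto
    have h4 := I.dom_trans huv h3
    tauto

/-- Let `u = σ i`. The tight arcs `i → u` and `u → σ u` cost at least `μ i` and `μ (σ u)`, while the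
arc `i → σ u` costs at most `μ i + μ (σ u)`. Adding the two equalities and subtracting feasibility
for the last arc leaves `α u + β u ≥ 0`. -/
theorem PairOut.gamma_nonneg (hp : I.PairOut v₀ μ p₁ p₂)
    (hm : Matched I.n I.n z (fun u v => I.C (p₁ u v) + I.C (p₂ u v)) α β σ) {u : ℕ} (hu : u < I.n) :
    0 ≤ α u + β u := by
  obtain ⟨i, hi, rfl⟩ := hm.exists_preimage hu
  have h1 := hm.tight i hi
  have h2 := hm.tight _ hu
  have hσ := hm.lt _ hu
  have h3 := hm.feas i hi _ hσ
  have h4 := hp.le_add i hi _ hσ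
  have h5 := hp.le_left i hi _ hu
  have h6 := hp.le_right _ hu _ hσ
  linarith

theorem PairOut.gamma_le (hp : I.PairOut v₀ μ p₁ p₂)
    (hm : Matched I.n I.n z (fun u v => I.C (p₁ u v) + I.C (p₂ u v)) α β σ) {u : ℕ} (hu : u < I.n) :
    α u + β u ≤ 2 * μ u := by
  have h1 := hm.feas u hu u hu
  have h2 := hp.le_add u hu u hu
  linarith

/-- The sum lies between 0 and `2 * μ u`, and `μ` vanishes at the other vertices. -/
theorem PairOut.lowest_of_ne (hp : I.PairOut v₀ μ p₁ p₂)
    (hm : Matched I.n I.n z (fun u v => I.C (p₁ u v) + I.C (p₂ u v)) α β σ) {u : ℕ} (hu : u < I.n)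
    (hne : α u + β u ≠ 0) : I.lowest v₀ u := by
  by_contra h
  have h1 := hp.gamma_nonneg hm hu
  have h2 := hp.gamma_le hm hu
  have h3 := hp.mu_zero u hu h
  omega

theorem sum_tv_mul_eq {n : ℕ} {P : ℕ → Prop} {g : ℕ → ℤ}
    (h : ∀ a < n, ∀ b < n, P a → P b → g a ≠ 0 → g b ≠ 0 → a = b) :
    ∑ v ∈ Finset.range n, tv (P v) * g v = 0 ∨
      ∃ a < n, P a ∧ g a ≠ 0 ∧ ∑ v ∈ Finset.range n, tv (P v) * g v = g a := by
  by_cases hex : ∃ a < n, P a ∧ g a ≠ 0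
  · obtain ⟨a, ha, hP, hg⟩ := hex
    right
    refine ⟨a, ha, hP, hg, ?_⟩
    rw [Finset.sum_eq_single a, tv_true hP, one_mul]
    · intro b hb hne
      by_cases hPb : P b
      · by_cases hgb : g b = 0
        · rw [hgb, mul_zero]
        · exact absurd (h b (Finset.mem_range.1 hb) a ha hPb hP hgb hg) hne
      · rw [tv_false hPb, zero_mul]
    · intro h0
      exact absurd (Finset.mem_range.2 ha) h0
  · left
    apply Finset.sum_eq_zero
    intro v hv
    by_cases hPv : P v
    · have : g v = 0 := by
        by_contra h0
        exact hex ⟨v, Finset.mem_range.1 hv, hPv, h0⟩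
      rw [this, mul_zero]
    · rw [tv_false hPv, zero_mul]

/-- The vertices covered by the link split into those above its source and those above its target,
and only one lowest vertex counts on each side. If there are two, `a` and `b`, add feasibility for
the arcs `a → b` and `b → a`, each of which costs at most as much as the link. -/
theorem PairOut.gamma_feasible (hp : I.PairOut v₀ μ p₁ p₂)
    (hm : Matched I.n I.n z (fun u v => I.C (p₁ u v) + I.C (p₂ u v)) α β σ) {l : ℕ} (hl : l < I.m)
    (hc : I.cross l) : ∑ v ∈ Finset.range I.n, tv (I.cov v l) * (α v + β v) ≤ 2 * I.C l := by
  set g : ℕ → ℤ := fun v => α v + β v with hg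
  have hsplit : ∑ v ∈ Finset.range I.n, tv (I.cov v l) * g v =
      ∑ v ∈ Finset.range I.n, tv (I.dom v (I.src l) ∧ ¬ I.dom v (I.tgt l)) * g v +
      ∑ v ∈ Finset.range I.n, tv (I.dom v (I.tgt l) ∧ ¬ I.dom v (I.src l)) * g v := by
    rw [← Finset.sum_add_distrib]
    apply Finset.sum_congr rfl
    intro v _
    unfold cov
    by_cases h1 : I.dom v (I.src l) <;> by_cases h2 : I.dom v (I.tgt l) <;> simp [h1, h2, tv]
  have hlow : ∀ v < I.n, g v ≠ 0 → I.lowest v₀ v := fun v hv => hp.lowest_of_ne hm hv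
  have hC := I.C_nonneg l
  have hone : ∀ a < I.n, g a ≠ 0 → I.cov a l → g a ≤ 2 * I.C l := by
    intro a ha hga hca
    have h1 := hp.gamma_le hm ha
    have h2 := hp.single a ha (hlow a ha hga) l hl hc hca
    simp only [hg]; linarith
  rw [hsplit]
  rcases sum_tv_mul_eq (n := I.n) (g := g) (P := fun v => I.dom v (I.src l) ∧ ¬ I.dom v (I.tgt l))
    (fun a ha b hb h1 h2 h3 h4 => lowest_unique ha hb (hlow a ha h3) (hlow b hb h4) h1.1 h2.1) with
    h1 | ⟨a, ha, hPa, hga, h1⟩ <;>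
  rcases sum_tv_mul_eq (n := I.n) (g := g) (P := fun v => I.dom v (I.tgt l) ∧ ¬ I.dom v (I.src l))
    (fun a ha b hb h1 h2 h3 h4 => lowest_unique ha hb (hlow a ha h3) (hlow b hb h4) h1.1 h2.1) with
    h2 | ⟨b, hb, hPb, hgb, h2⟩
  · rw [h1, h2]; linarith
  · rw [h1, h2]
    have := hone b hb hgb (by unfold cov; tauto)
    linarith
  · rw [h1, h2]
    have := hone a ha hga (by unfold cov; tauto)
    linarith
  · rw [h1, h2]
    have hab : a ≠ b := by rintro rfl; exact hPb.2 hPa.1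
    have hca : I.cov a l := by unfold cov; tauto
    have hcb : I.cov b l := by unfold cov; tauto
    have h3 := hp.double a ha b hb hab (hlow a ha hga) (hlow b hb hgb) l hl hc hca hcb
    have h4 := hp.double b hb a ha hab.symm (hlow b hb hgb) (hlow a ha hga) l hl hc hcb hca
    have h5 := hm.feas a ha b hb
    have h6 := hm.feas b hb a ha
    simp only [hg] at *
    linarith

theorem UpOut.feasible_link {y keep : ℕ → ℤ} (h : I.UpOut v₀ y keep) {l : ℕ} (hl : l < I.m) :
    ∑ v ∈ Finset.range I.n, tv (I.cov v l) * y v ≤ 2 * I.C l := by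
  have h1 := h.feasible l (by omega)
  have h2 := h.feasible (I.m + l) (by omega)
  have hn : ¬ I.m + l < I.m := by omega
  simp only [pC, pc, pu, pw, if_pos hl, if_neg hn, Nat.add_sub_cancel_left] at h1 h2
  have h3 := add_le_add h1 h2
  rw [← Finset.sum_add_distrib] at h3
  calc _ = _ := ?_
    _ ≤ _ := h3
    _ = _ := by ring
  apply Finset.sum_congr rfl
  intro v _
  unfold cov
  by_cases h1 : I.dom v (I.src l) <;> by_cases h2 : I.dom v (I.tgt l) <;> simp [h1, h2, tv]

/-- The selected links cover the part of the tree that is left to cross-links. -/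
theorem PairOut.chosen_covers (hp : I.PairOut v₀ μ p₁ p₂)
    (hm : Matched I.n I.n z (fun u v => I.C (p₁ u v) + I.C (p₂ u v)) α β σ)
    (hκ : I.Coloring σ κ) (t : ℕ) {v : ℕ} (hv : v < I.n) (hz : I.zc v₀ < I.zc v) :
    ∃ l < I.m, I.chosen p₁ p₂ σ κ t l ∧ I.cov v l := by
  obtain ⟨u, hu, hzu, hvu, hmin⟩ := exists_lowest (I := I) (P := fun x => I.zc v₀ < I.zc x) hv hz
  have hlu : I.lowest v₀ u := ⟨hzu, hmin⟩
  suffices h : ∃ l < I.m, I.chosen p₁ p₂ σ κ t l ∧ I.cross l ∧ I.cov u l by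
    obtain ⟨l, hl, h1, h2, h3⟩ := h
    exact ⟨l, hl, h1, cov_of_cross hv (ne_root_of_lt hz) h2 hvu h3⟩
  by_cases hfix : σ u = u
  · obtain ⟨h1, h2, h3⟩ := hp.cover_diag u hu hlu
    exact ⟨p₁ u u, h1, ⟨u, hu, Or.inl ⟨Or.inl hfix, by rw [hfix]⟩⟩, h2, h3⟩
  -- If the arc out of `u` is deleted, the arc into `u` has a different colour and remains; either
  -- of them serves `u`.
  by_cases hκu : κ u = t
  · obtain ⟨i, hi, hiu⟩ := hm.exists_preimage hu
    have hne : σ i ≠ i := by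
      intro h1
      have : i = u := h1.symm.trans hiu
      subst this
      exact hfix hiu
    have hκi : κ i ≠ t := by
      have := hκ.ne i hi hne
      rwa [hiu, hκu] at this
    obtain ⟨l, hl, h1, h2⟩ := hp.cover_right i hi u hu hlu
    refine ⟨l, hl, ⟨i, hi, ?_⟩, h2⟩
    rw [hiu]
    rcases h1 with h1 | h1
    · exact Or.inl ⟨Or.inr hκi, h1.symm⟩
    · exact Or.inr ⟨⟨by rwa [hiu] at hne, hκi⟩, h1.symm⟩
  · obtain ⟨l, hl, h1, h2⟩ := hp.cover_left u hu (σ u) (hm.lt u hu) hlu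
    refine ⟨l, hl, ⟨u, hu, ?_⟩, h2⟩
    rcases h1 with h1 | h1
    · exact Or.inl ⟨Or.inr hκu, h1.symm⟩
    · exact Or.inr ⟨⟨hfix, hκu⟩, h1.symm⟩

theorem sum_tv_eq_mul_le (A : Prop) (p : ℕ) :
    ∑ l ∈ Finset.range I.m, tv (A ∧ p = l) * I.C l ≤ tv A * I.C p := by
  by_cases hA : A
  · simp only [hA, true_and, tv_true, one_mul]
    by_cases hp : p < I.m
    · rw [Finset.sum_eq_single p]
      · rw [tv_true rfl, one_mul]
      · intro b _ hne
        rw [tv_false (Ne.symm hne), zero_mul]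
      · intro h; exact absurd (Finset.mem_range.2 hp) h
    · rw [Finset.sum_eq_zero]
      · exact I.C_nonneg p
      · intro l hl
        rw [Finset.mem_range] at hl
        rw [tv_false (by omega), zero_mul]
  · simp [hA, tv]

theorem sum_chosen_le (t : ℕ) :
    ∑ l ∈ Finset.range I.m, tv (I.chosen p₁ p₂ σ κ t l) * I.C l ≤
      ∑ u ∈ Finset.range I.n, (tv (σ u = u ∨ κ u ≠ t) * I.C (p₁ u (σ u)) +
        tv (σ u ≠ u ∧ κ u ≠ t) * I.C (p₂ u (σ u))) := by
  calc _ ≤ ∑ l ∈ Finset.range I.m, ∑ u ∈ Finset.range I.n,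
        (tv ((σ u = u ∨ κ u ≠ t) ∧ p₁ u (σ u) = l) * I.C l +
          tv ((σ u ≠ u ∧ κ u ≠ t) ∧ p₂ u (σ u) = l) * I.C l) := by
        apply Finset.sum_le_sum
        intro l _
        have hnn : ∀ u ∈ Finset.range I.n, 0 ≤ (tv ((σ u = u ∨ κ u ≠ t) ∧ p₁ u (σ u) = l) * I.C l +
          tv ((σ u ≠ u ∧ κ u ≠ t) ∧ p₂ u (σ u) = l) * I.C l) := fun u _ =>
          add_nonneg (mul_nonneg (tv_nonneg _) (I.C_nonneg l))
            (mul_nonneg (tv_nonneg _) (I.C_nonneg l))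
        by_cases hc : I.chosen p₁ p₂ σ κ t l
        · obtain ⟨u, hu, h⟩ := hc
          refine le_trans ?_ (Finset.single_le_sum hnn (Finset.mem_range.2 hu))
          have hC := I.C_nonneg l
          rw [tv_true ⟨u, hu, h⟩, one_mul]
          rcases h with h | h
          · rw [tv_true h]
            have := mul_nonneg (tv_nonneg ((σ u ≠ u ∧ κ u ≠ t) ∧ p₂ u (σ u) = l)) hC
            linarith
          · rw [tv_true h]
            have := mul_nonneg (tv_nonneg ((σ u = u ∨ κ u ≠ t) ∧ p₁ u (σ u) = l)) hC
            linarith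
        · rw [tv_false hc, zero_mul]
          exact Finset.sum_nonneg hnn
    _ = ∑ u ∈ Finset.range I.n, (∑ l ∈ Finset.range I.m,
          tv ((σ u = u ∨ κ u ≠ t) ∧ p₁ u (σ u) = l) * I.C l +
          ∑ l ∈ Finset.range I.m, tv ((σ u ≠ u ∧ κ u ≠ t) ∧ p₂ u (σ u) = l) * I.C l) := by
        rw [Finset.sum_comm]
        simp only [Finset.sum_add_distrib]
    _ ≤ _ := Finset.sum_le_sum fun u _ =>
        add_le_add (sum_tv_eq_mul_le _ _) (sum_tv_eq_mul_le _ _)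

/-- The three selections together cost at most twice the assignment. -/
theorem PairOut.sum_cost_le (hp : I.PairOut v₀ μ p₁ p₂)
    (hm : Matched I.n I.n z (fun u v => I.C (p₁ u v) + I.C (p₂ u v)) α β σ)
    (hκ : I.Coloring σ κ) :
    ∑ t ∈ Finset.range 3, ∑ l ∈ Finset.range I.m, tv (I.chosen p₁ p₂ σ κ t l) * I.C l ≤
      2 * ∑ v ∈ Finset.range I.n, (α v + β v) := by
  rw [hm.sum_eq, Finset.mul_sum]
  refine (Finset.sum_le_sum fun t _ => sum_chosen_le t).trans ?_
  rw [Finset.sum_comm]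
  apply Finset.sum_le_sum
  intro u hu
  rw [Finset.mem_range] at hu
  have h1 := I.C_nonneg (p₁ u (σ u))
  have h2 := I.C_nonneg (p₂ u (σ u))
  by_cases hfix : σ u = u
  -- At a fixed point one link is selected in all three cases, at total cost `3 * μ u`, while twice
  -- the arc costs `4 * μ u`.
  · obtain ⟨h3, h4⟩ := hp.diag u hu
    rw [hfix] at h1 h2 ⊢
    simp only [Finset.sum_range_succ, Finset.sum_range_zero, true_or, ne_eq, not_true,
      false_and, tv_true trivial, tv_false not_false]
    linarith
  -- Any other arc is deleted for exactly one of the three colours.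
  · have h3 := hκ.nonneg u hu
    have h4 := hκ.lt u hu
    simp only [hfix, ne_eq, false_or, not_false_eq_true, true_and, ← mul_add]
    rw [← Finset.sum_mul]
    apply mul_le_mul_of_nonneg_right _ (add_nonneg h1 h2)
    simp only [Finset.sum_range_succ, Finset.sum_range_zero]
    have h5 : κ u = 0 ∨ κ u = 1 ∨ κ u = 2 := by omega
    rcases h5 with h5 | h5 | h5 <;> simp [h5, tv]

/-- The selected links. -/
def Sel (keep : ℕ → ℤ) (p₁ p₂ : ℕ → ℕ → ℕ) (σ : ℕ → ℕ) (κ : ℕ → ℤ) (t l : ℕ) : Prop :=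
  (0 < keep l ∨ 0 < keep (I.m + l)) ∨ I.chosen p₁ p₂ σ κ t l

theorem Sel.covers {y keep : ℕ → ℤ} (hup : I.UpOut v₀ y keep) (hp : I.PairOut v₀ μ p₁ p₂)
    (hm : Matched I.n I.n z (fun u v => I.C (p₁ u v) + I.C (p₂ u v)) α β σ)
    (hκ : I.Coloring σ κ) (t : ℕ) {v : ℕ} (hv : v < I.n) (hr : v ≠ I.r) :
    ∃ l < I.m, I.Sel keep p₁ p₂ σ κ t l ∧ I.cov v l := by
  by_cases hz : I.zc v₀ < I.zc v
  · obtain ⟨l, hl, h1, h2⟩ := hp.chosen_covers hm hκ t hv hz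
    exact ⟨l, hl, Or.inr h1, h2⟩
  · obtain ⟨q, hq, h1, h2⟩ := hup.covers v hv ⟨hr, hz⟩
    simp only [pc, pu, pw] at h2
    by_cases hqm : q < I.m
    · simp only [if_pos hqm] at h2
      exact ⟨q, hqm, Or.inl (Or.inl h1), by unfold cov; tauto⟩
    · simp only [if_neg hqm] at h2
      refine ⟨q - I.m, by omega, Or.inl (Or.inr ?_), by unfold cov; tauto⟩
      rwa [Nat.add_sub_cancel' (not_lt.1 hqm)]

/-- Add the bounds for the three colours: each selection pays for the kept pieces, and by
`PairOut.sum_cost_le` the cross-links chosen in the three cases cost at most twice the sum of all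
potentials. -/
theorem Sel.bound {y keep : ℕ → ℤ} (hup : I.UpOut v₀ y keep) (hp : I.PairOut v₀ μ p₁ p₂)
    (hm : Matched I.n I.n z (fun u v => I.C (p₁ u v) + I.C (p₂ u v)) α β σ)
    (hκ : I.Coloring σ κ) {best : ℤ}
    (hbest : ∀ t < 3, best ≤ ∑ l ∈ Finset.range I.m, tv (I.Sel keep p₁ p₂ σ κ t l) * I.C l) :
    I.Bound v₀ best := by
  refine ⟨y, fun v => α v + β v, hup.y_nonneg, fun v hv => hp.gamma_nonneg hm hv, hup.y_supp,
    fun v hv hne => (hp.lowest_of_ne hm hv hne).1, fun l hl => hup.feasible_link hl,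
    fun l hl hc => hp.gamma_feasible hm hl hc, ?_⟩
  have hU : ∑ l ∈ Finset.range I.m, (tv (0 < keep l) + tv (0 < keep (I.m + l))) * I.C l =
      ∑ q ∈ Finset.range (2 * I.m), tv (0 < keep q) * I.pC q := by
    rw [two_mul, Finset.sum_range_add, ← Finset.sum_add_distrib]
    apply Finset.sum_congr rfl
    intro l hl
    rw [Finset.mem_range] at hl
    simp only [pC, if_pos hl, if_neg (show ¬ I.m + l < I.m by omega), Nat.add_sub_cancel_left]
    ring
  have hone : ∀ t, ∑ l ∈ Finset.range I.m, tv (I.Sel keep p₁ p₂ σ κ t l) * I.C l ≤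
      ∑ v ∈ Finset.range I.n, y v +
        ∑ l ∈ Finset.range I.m, tv (I.chosen p₁ p₂ σ κ t l) * I.C l := by
    intro t
    refine le_trans ?_ (add_le_add_left (hU.trans_le hup.cost_le) _)
    rw [← Finset.sum_add_distrib]
    apply Finset.sum_le_sum
    intro l _
    rw [← add_mul]
    apply mul_le_mul_of_nonneg_right _ (I.C_nonneg l)
    unfold Sel
    by_cases h1 : 0 < keep l <;> by_cases h2 : 0 < keep (I.m + l) <;>
      by_cases h3 : I.chosen p₁ p₂ σ κ t l <;> simp [h1, h2, h3, tv]
  have h0 := (hbest 0 (by norm_num)).trans (hone 0)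
  have h1 := (hbest 1 (by norm_num)).trans (hone 1)
  have h2 := (hbest 2 (by norm_num)).trans (hone 2)
  have h3 := hp.sum_cost_le hm hκ
  simp only [Finset.sum_range_succ, Finset.sum_range_zero] at h3
  linarith

end Inst

end Aug

end RAM

/-! ### The instance in memory -/

namespace RAM

/-- An array, as a function on the natural numbers. -/
def State.nat (s : State) (a : ℕ) : ℕ → ℤ := fun i => s.arr a (i : ℤ)

@[simp] theorem State.nat_setV (s : State) (x : ℕ) (v : ℤ) (a : ℕ) :
    (s.setV x v).nat a = s.nat a := rfl

theorem State.nat_setA (s : State) (a i : ℕ) (v : ℤ) :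
    (s.setA a (i : ℤ) v).nat a = Function.update (s.nat a) i v := by
  funext j
  simp [State.nat, Function.update_apply]

theorem State.nat_setA_ne (s : State) {a b : ℕ} (h : b ≠ a) (i v : ℤ) :
    (s.setA a i v).nat b = s.nat b := by
  funext j
  simp [State.nat, h]

theorem Cmd.Frame.nat {c : Cmd} {s s' : State} (h : Cmd.Frame c s s') {a : ℕ}
    (ha : c.keepsA a = true) : s'.nat a = s.nat a := by
  funext j
  rw [State.nat, h.arr a ha, State.nat]

namespace Aug

open X Cmd

/-- The memory holds the instance. -/
structure Env (I : Inst) (s : State) : Prop where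
  n : s.var 0 = I.n
  m : s.var 1 = I.m
  r : s.var 2 = I.r
  nn : s.var 3 = ((I.n * I.n : ℕ) : ℤ)
  mm : s.var 4 = ((2 * I.m : ℕ) : ℤ)
  three : s.var 5 = ((3 : ℕ) : ℤ)
  src : ∀ l < I.m, s.arr 1 (l : ℕ) = I.src l
  tgt : ∀ l < I.m, s.arr 2 (l : ℕ) = I.tgt l
  dom : ∀ v < I.n, ∀ u < I.n, s.arr 10 ((v : ℤ) * I.n + u) = tv (I.dom v u)
  C : ∀ l : ℕ, s.arr 11 (l : ℕ) = I.C l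
  cross : ∀ l < I.m, s.arr 13 (l : ℕ) = tv (I.cross l)
  zc : ∀ v < I.n, s.arr 14 (v : ℕ) = I.zc v
  pu : ∀ q < 2 * I.m, s.arr 15 (q : ℕ) = I.pu q
  pw : ∀ q < 2 * I.m, s.arr 16 (q : ℕ) = I.pw q
  pC : ∀ q < 2 * I.m, s.arr 17 (q : ℕ) = I.pC q

/-- The command does not write the memory that holds the instance. -/
def keepsEnv (c : Cmd) : Bool :=
  [0, 1, 2, 3, 4, 5].all (fun x => c.keepsV x) &&
    [1, 2, 10, 11, 13, 14, 15, 16, 17].all fun a => c.keepsA a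

theorem Env.congr {I : Inst} {s s' : State} (h : Env I s)
    (hv : ∀ x ∈ [0, 1, 2, 3, 4, 5], s'.var x = s.var x)
    (ha : ∀ a ∈ [1, 2, 10, 11, 13, 14, 15, 16, 17], s'.arr a = s.arr a) : Env I s' := by
  simp only [List.mem_cons, List.not_mem_nil, or_false, forall_eq_or_imp, forall_eq] at hv ha
  obtain ⟨v0, v1, v2, v3, v4, v5⟩ := hv
  obtain ⟨a1, a2, a10, a11, a13, a14, a15, a16, a17⟩ := ha
  constructor
  · rw [v0, h.n]
  · rw [v1, h.m]
  · rw [v2, h.r]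
  · rw [v3, h.nn]
  · rw [v4, h.mm]
  · rw [v5, h.three]
  · rw [a1]; exact h.src
  · rw [a2]; exact h.tgt
  · rw [a10]; exact h.dom
  · rw [a11]; exact h.C
  · rw [a13]; exact h.cross
  · rw [a14]; exact h.zc
  · rw [a15]; exact h.pu
  · rw [a16]; exact h.pw
  · rw [a17]; exact h.pC

theorem Env.frame {I : Inst} {s s' : State} {c : Cmd} (h : Env I s) (hf : Frame c s s')
    (hk : keepsEnv c = true) : Env I s' := by
  simp only [keepsEnv, Bool.and_eq_true, List.all_eq_true] at hk
  exact h.congr (fun x hx => hf.var x (hk.1 x hx)) (fun a ha => hf.arr a (hk.2 a ha))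

theorem Env.setV {I : Inst} {s : State} (h : Env I s) (x : ℕ) (v : ℤ) (hx : 10 ≤ x := by norm_num) :
    Env I (s.setV x v) := by
  refine h.congr (fun y hy => ?_) (fun _ _ => rfl)
  have : y ≤ 5 := by
    simp only [List.mem_cons, List.not_mem_nil, or_false] at hy
    omega
  rw [State.setV_var, if_neg (by omega)]

theorem Env.setA {I : Inst} {s : State} (h : Env I s) (a : ℕ) (i v : ℤ)
    (ha : 18 ≤ a := by norm_num) : Env I (s.setA a i v) := by
  refine h.congr (fun _ _ => rfl) (fun b hb => ?_)
  have : b ≤ 17 := by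
    simp only [List.mem_cons, List.not_mem_nil, or_false] at hb
    omega
  rw [State.setA_arr, if_neg (by omega)]

/-- The instance is small compared to the bound on all numbers. -/
structure Small (I : Inst) (B : ℤ) : Prop where
  size : ((I.n * I.n + 2 * I.m + I.n + 4 : ℕ) : ℤ) ≤ B
  -- An arc of the assignment uses two links, so it costs at most `B / 2`; a slack is at most an arc
  -- cost plus the size of a column potential, hence at most `B`.
  cost : 4 * ∑ l ∈ Finset.range I.m, I.C l ≤ B

section Eval

variable {I : Inst} {s : State} {B : ℤ}

theorem Small.C_le (hB : Small I B) (l : ℕ) : 4 * I.C l ≤ B := by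
  by_cases hl : l < I.m
  · have := Finset.single_le_sum (fun l _ => I.C_nonneg l) (Finset.mem_range.2 hl)
    have := hB.cost
    linarith
  · rw [I.C_of_le l (by omega)]
    have := hB.size
    omega

theorem Small.pC_le (hB : Small I B) (q : ℕ) : I.pC q ≤ B := by
  have h1 := hB.C_le q
  have h2 := hB.C_le (q - I.m)
  have h3 := I.C_nonneg q
  have h4 := I.C_nonneg (q - I.m)
  unfold Inst.pC
  split_ifs <;> linarith

theorem Small.abs_le (hB : Small I B) {k : ℕ} (hk : k ≤ I.n * I.n + 2 * I.m + I.n + 4) :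
    |(k : ℤ)| ≤ B := by
  have := hB.size
  rw [abs_of_nonneg (by positivity)]
  omega

theorem Small.abs_tv (hB : Small I B) (p : Prop) : |tv p| ≤ B := by
  have := hB.size
  have := abs_tv_le p
  omega

theorem Small.abs_fnd (hB : Small I B) {N : ℕ} (P : ℕ → Prop)
    (hN : N ≤ I.n * I.n + 2 * I.m + I.n + 4) : |((fnd N P : ℕ) : ℤ)| ≤ B :=
  hB.abs_le ((fnd_le N P).trans hN)

theorem Env.toNat_n (h : Env I s) : (s.var 0).toNat = I.n := by simp [h.n]
theorem Env.toNat_m (h : Env I s) : (s.var 1).toNat = I.m := by simp [h.m]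
theorem Env.toNat_nn (h : Env I s) : (s.var 3).toNat = I.n * I.n := by rw [h.nn, Int.toNat_natCast]
theorem Env.toNat_mm (h : Env I s) : (s.var 4).toNat = 2 * I.m := by rw [h.mm, Int.toNat_natCast]
theorem Env.toNat_three (h : Env I s) : (s.var 5).toNat = 3 := by rw [h.three, Int.toNat_natCast]

theorem pu_lt {q : ℕ} (hq : q < 2 * I.m) : I.pu q < I.n := by
  unfold Inst.pu
  split_ifs with h
  · exact I.src_lt q h
  · exact I.tgt_lt _ (by omega)

theorem pw_lt {q : ℕ} (hq : q < 2 * I.m) : I.pw q < I.n := by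
  unfold Inst.pw
  split_ifs with h
  · exact I.tgt_lt q h
  · exact I.src_lt _ (by omega)

theorem Env.eval_domX (h : Env I s) {v u : X} {a b : ℕ} (hv : v.eval s = a) (hu : u.eval s = b)
    (ha : a < I.n) (hb : b < I.n) : (domX v u).eval s = tv (I.dom a b) := by
  simp only [domX, eval_get, eval_add, eval_mul, eval_var, hv, hu, h.n]
  exact h.dom a ha b hb

theorem Env.eval_pcX (h : Env I s) {q v : X} {c a : ℕ} (hq : q.eval s = c) (hv : v.eval s = a)
    (hc : c < 2 * I.m) (ha : a < I.n) : (pcX q v).eval s = tv (I.pc c a) := by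
  rw [pcX, eval_and, eval_not,
    h.eval_domX hv (b := I.pu c) (by simp only [eval_get, hq]; exact h.pu c hc) ha (pu_lt hc),
    h.eval_domX hv (b := I.pw c) (by simp only [eval_get, hq]; exact h.pw c hc) ha (pw_lt hc)]
  simp only [tv_pos]
  rfl

theorem Env.eval_covX (h : Env I s) {v l : X} {a c : ℕ} (hv : v.eval s = a) (hl : l.eval s = c)
    (ha : a < I.n) (hc : c < I.m) : (covX v l).eval s = tv (I.cov a c) := by
  rw [covX, eval_eq, eval_add,
    h.eval_domX hv (b := I.src c) (by simp only [eval_get, hl]; exact h.src c hc) ha (I.src_lt c hc),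
    h.eval_domX hv (b := I.tgt c) (by simp only [eval_get, hl]; exact h.tgt c hc) ha (I.tgt_lt c hc)]
  apply tv_congr
  unfold Inst.cov tv
  by_cases h1 : I.dom a (I.src c) <;> by_cases h2 : I.dom a (I.tgt c) <;> simp [h1, h2]

theorem Env.eval_coveredX (h : Env I s) {x a : ℕ} (hx : s.var x = a) (ha : a < I.n) (hne : x ≠ 60) :
    (coveredX (.var x)).eval s = tv (I.stamped (s.nat 22) a) := by
  rw [coveredX, eval_ex, h.toNat_mm]
  apply tv_congr
  apply exists_congr
  intro q
  apply and_congr_right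
  intro hq
  rw [eval_and, (h.setV 60 q).eval_pcX (c := q) (a := a) (by simp) (by simp [hne, hx]) hq ha]
  simp [State.nat]

theorem Env.eval_resX (h : Env I s) {x q : ℕ} (hx : s.var x = q) (hq : q < 2 * I.m) (hne : x ≠ 61) :
    (resX (.var x)).eval s = I.res (s.nat 21) q := by
  rw [resX, eval_sub, eval_sum, h.toNat_n, Inst.res]
  congr 1
  · simp only [eval_get, eval_var, hx]
    exact h.pC q hq
  · apply Finset.sum_congr rfl
    intro v hv
    rw [Finset.mem_range] at hv
    rw [eval_mul, (h.setV 61 v).eval_pcX (c := q) (a := v) (by simp [hne, hx]) (by simp) hq hv]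
    simp [State.nat]

/-! ### The covering by pieces -/

variable {v₀ : ℕ}

theorem groundCmd_wp (h : Env I s) (hB : Small I B) (hv0 : s.var 13 = v₀) (hv : v₀ < I.n) :
    groundCmd.wp B (fun s' => ∀ v < I.n, s'.nat 20 v = tv (I.ground v₀ v)) s := by
  refine wp_fill (fun v => tv (I.ground v₀ v)) h.n ?_ (fun s' _ h1 _ => h1)
  intro k hk s' hf hx _ _
  have h' := h.frame hf rfl
  refine ⟨?_, hB.abs_tv _⟩
  have h13 : s'.var 13 = v₀ := by rw [hf.var 13 rfl, hv0]
  simp only [eval_and, eval_not, eval_eq, eval_lt, eval_get, eval_var, tv_pos, hx, h'.r, h13,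
    h'.zc v₀ hv, h'.zc k hk]
  apply tv_congr
  simp only [Inst.ground, Nat.cast_inj, ne_eq]

theorem pickVertex_eval (h : Env I s) (hG : ∀ v < I.n, s.nat 20 v = tv (I.ground v₀ v)) :
    pickVertexX.eval s = fnd I.n fun v => I.ground v₀ v ∧ ¬ I.stamped (s.nat 22) v ∧
      ∀ f < I.n, ¬((I.ground v₀ f ∧ ¬ I.stamped (s.nat 22) f) ∧ I.dom v f ∧ f ≠ v) := by
  rw [pickVertexX, eval_find, h.toNat_n]
  congr 1
  apply fnd_congr
  intro v hv
  have hv' := h.setV 50 v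
  have g1 := hG v hv
  simp only [State.nat] at g1
  simp only [eval_and, eval_not, eval_all, tv_pos, hv'.toNat_n]
  rw [hv'.eval_coveredX (a := v) (by simp) hv (by norm_num)]
  refine and_congr (by simp [g1]) (and_congr (by simp) (forall₂_congr fun f hf => ?_))
  have hf' := hv'.setV 51 f
  have g2 := hG f hf
  simp only [State.nat] at g2
  rw [hf'.eval_coveredX (a := f) (by simp) hf (by norm_num),
    hf'.eval_domX (a := v) (b := f) (by simp) (by simp) hv hf]
  simp [g2]

theorem pickPiece_eval (h : Env I s) {v : ℕ} (hv : v < I.n) (hx : s.var 22 = v) :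
    pickPieceX.eval s = fnd (2 * I.m) fun q => I.pc q v ∧
      ∀ p < 2 * I.m, I.pc p v → I.res (s.nat 21) q ≤ I.res (s.nat 21) p := by
  rw [pickPieceX, eval_find, h.toNat_mm]
  congr 1
  apply fnd_congr
  intro q hq
  have hq' := h.setV 50 q
  simp only [eval_and, eval_all, tv_pos, hq'.toNat_mm]
  rw [hq'.eval_pcX (c := q) (a := v) (by simp) (by simp [hx]) hq hv]
  refine and_congr (by simp) (forall₂_congr fun p hp => ?_)
  have hp' := hq'.setV 51 p
  simp only [eval_not, eval_and, eval_lt, tv_pos]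
  rw [hp'.eval_pcX (c := p) (a := v) (by simp) (by simp [hx]) hp hv,
    hp'.eval_resX (q := p) (by simp) hp (by norm_num),
    hp'.eval_resX (q := q) (by simp) hq (by norm_num)]
  simp

theorem dualStep_wp (h : Env I s) (hB : Small I B) {k : ℕ} (hk : k < I.n) (hx : s.var 21 = k)
    (hG : ∀ v < I.n, s.nat 20 v = tv (I.ground v₀ v)) (hd : I.DualInv v₀ k (s.nat 21) (s.nat 22)) :
    dualStep.wp B (fun s' => I.DualInv v₀ (k + 1) (s'.nat 21) (s'.nat 22)) s := by
  have hpv := pickVertex_eval h hG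
  set P : ℕ → Prop := fun v => I.ground v₀ v ∧ ¬ I.stamped (s.nat 22) v ∧
      ∀ f < I.n, ¬((I.ground v₀ f ∧ ¬ I.stamped (s.nat 22) f) ∧ I.dom v f ∧ f ≠ v) with hP
  set v := fnd I.n P with hvdef
  have h1 := h.setV 22 v
  refine ⟨by rw [hpv]; exact hB.abs_fnd _ (by omega), ?_⟩
  rw [hpv]
  constructor
  · intro hlt
    have hv : v < I.n := by simpa [h1.n, h.n] using hlt
    obtain ⟨hg, hun, hlow⟩ := fnd_spec hv
    have hpq := pickPiece_eval h1 hv (by simp)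
    simp only [State.nat_setV] at hpq
    set q := fnd (2 * I.m) fun q => I.pc q v ∧
      ∀ p < 2 * I.m, I.pc p v → I.res (s.nat 21) q ≤ I.res (s.nat 21) p with hqdef
    have hq : q < 2 * I.m := fnd_argmin (f := I.res (s.nat 21)) (I.exists_piece hv hg.1)
    obtain ⟨hqv, hmin⟩ := fnd_spec hq
    have h2 := h1.setV 23 q
    have hr0 := hd.res_nonneg q hq
    -- The stored dual value is at most the cost of a piece, which keeps it below `B`.
    have hr1 : I.res (s.nat 21) q ≤ I.pC q := by
      unfold Inst.res
      have : 0 ≤ ∑ v ∈ Finset.range I.n, tv (I.pc q v) * s.nat 21 v :=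
        Finset.sum_nonneg fun v hv => mul_nonneg (tv_nonneg _) (hd.y_nonneg v (Finset.mem_range.1 hv))
      linarith
    have hres := h2.eval_resX (q := q) (x := 23) (by simp) hq (by norm_num)
    simp only [State.nat_setV] at hres
    refine ⟨by rw [hpq]; exact hB.abs_fnd _ (by omega), ?_⟩
    rw [hpq]
    refine ⟨?_, ?_, ?_⟩
    · rw [hres, abs_of_nonneg hr0]
      exact hr1.trans (hB.pC_le q)
    · simp only [eval_add, eval_var, eval_lit, State.setA_var, State.setV_var]
      simp only [hx, Nat.reduceEqDiff, if_false]
      exact_mod_cast hB.abs_le (k := k + 1) (by omega)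
    · rw [hres]
      have := hd.step hv hg hun (fun f hf hGf hsf hdf => by
        by_contra hne
        exact hlow f hf ⟨⟨hGf, hsf⟩, hdf, hne⟩) hq hqv hmin
      convert this using 1
      · rw [State.nat_setA_ne _ (by norm_num)]
        simp only [eval_var, State.setV_var, Nat.reduceEqDiff, if_true, if_false]
        rw [State.nat_setA]
        rfl
      · simp only [eval_var, eval_add, eval_lit, State.setA_var, State.setV_var, Nat.reduceEqDiff,
          if_true, if_false, hx]
        rw [State.nat_setA, State.nat_setA_ne _ (by norm_num)]
        rfl
  · intro hlt
    have hv : ¬ v < I.n := by simpa [h1.n, h.n] using hlt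
    -- If a ground vertex were uncovered, the search would have found a lowest one.
    refine hd.skip ?_
    intro u hu hgu
    by_contra hsu
    obtain ⟨w, hw, hPw, -, hmin⟩ := Inst.exists_lowest (I := I)
      (P := fun x => I.ground v₀ x ∧ ¬ I.stamped (s.nat 22) x) hu ⟨hgu, hsu⟩
    refine hv (fnd_lt_iff.2 ⟨w, hw, hPw.1, hPw.2, ?_⟩)
    rintro f hf ⟨h3, h4, h5⟩
    exact h5 (hmin f hf h3 h4)

theorem dualCmd_wp (h : Env I s) (hB : Small I B)
    (hG : ∀ v < I.n, s.nat 20 v = tv (I.ground v₀ v)) :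
    dualCmd.wp B (fun s' => I.DualInv v₀ I.n (s'.nat 21) (s'.nat 22)) s := by
  have hB0 : |(0 : ℤ)| ≤ B := by simpa using hB.abs_le (k := 0) (by omega)
  refine wp_seq (P := fun s' => ∀ v < I.n, s'.nat 21 v = 0)
    (wp_fill (fun _ => 0) h.n (fun _ _ _ _ _ _ _ => ⟨rfl, hB0⟩) fun s' _ h1 _ => h1) ?_
  intro s1 hy hf1
  have h1 := h.frame hf1 rfl
  refine wp_seq (P := fun s' => ∀ q < 2 * I.m, s'.nat 22 q = 0)
    (wp_fill (fun _ => 0) h1.mm (fun _ _ _ _ _ _ _ => ⟨rfl, hB0⟩) fun s' _ h1 _ => h1) ?_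
  intro s2 hst hf2
  have h2 := h1.frame hf2 rfl
  have hG2 : s2.nat 20 = s.nat 20 := by rw [hf2.nat rfl, hf1.nat rfl]
  refine wp_forTo (fun k s' => I.DualInv v₀ k (s'.nat 21) (s'.nat 22)) h2.n ?_ ?_ ?_
  · refine Inst.DualInv.init v₀ ?_ hst
    rw [hf2.nat rfl]
    exact hy
  · intro k hk s' hf hd
    have h' := h2.frame hf rfl
    refine dualStep_wp (h'.setV 21 k) hB hk (by simp) ?_ hd
    rw [State.nat_setV, hf.nat rfl, hG2]
    exact hG
  · intro s' _ hd
    exact hd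

theorem pruneStep_wp (h : Env I s) (hB : Small I B) {k : ℕ} (hk : k < I.n) (hx : s.var 21 = k)
    (hG : ∀ v < I.n, s.nat 20 v = tv (I.ground v₀ v))
    (hd : I.DualInv v₀ I.n (s.nat 21) (s.nat 22)) (hp : I.PruneInv v₀ k (s.nat 22) (s.nat 23)) :
    pruneStep.wp B (fun s' => I.PruneInv v₀ (k + 1) (s.nat 22) (s'.nat 23)) s := by
  set P : ℕ → Prop := fun q => s.nat 22 q = (I.n : ℤ) - k with hP
  set q := fnd (2 * I.m) P with hqdef
  have heq : (find 50 4 (X.eq (get 22 (.var 50)) (sub (.var 0) (.var 21)))).eval s = q := by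
    rw [eval_find, h.toNat_mm, hqdef]
    congr 1
    apply fnd_congr
    intro q _
    simp [hP, State.nat, h.n, hx]
  have h1 := h.setV 22 q
  refine ⟨by rw [heq]; exact hB.abs_fnd _ (by omega), ?_⟩
  rw [heq]
  set D : Prop := ∀ f < I.n, I.ground v₀ f → I.pc q f →
    ∃ p < 2 * I.m, p ≠ q ∧ 0 < s.nat 23 p ∧ I.pc p f with hD
  have hcond : 0 < ((lt (.var 22) (.var 4)).and (all 50 0 (X.not (((get 20 (.var 50)).and
      (pcX (.var 22) (.var 50))).and (X.not (ex 51 4 ((X.not ((X.var 51).eq (.var 22))).and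
      ((get 23 (.var 51)).and (pcX (.var 51) (.var 50)))))))))).eval (s.setV 22 q) ↔
      q < 2 * I.m ∧ D := by
    rw [eval_and, tv_pos, eval_lt, tv_pos, eval_all, tv_pos, h1.toNat_n]
    have e1 : (X.var 22).eval (s.setV 22 q) < (X.var 4).eval (s.setV 22 q) ↔ q < 2 * I.m := by
      rw [eval_var, eval_var, h1.mm, State.setV_var, if_pos rfl]
      exact Nat.cast_lt
    rw [e1]
    refine and_congr_right fun hq => forall₂_congr fun f hf => ?_
    have hf' := h1.setV 50 f
    rw [eval_not, tv_pos, eval_and, tv_pos, eval_and, tv_pos, eval_not, tv_pos, eval_ex, tv_pos,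
      hf'.toNat_mm, hf'.eval_pcX (c := q) (a := f) (by simp) (by simp) hq hf, tv_pos]
    have e2 : 0 < ((get 20 (.var 50)).eval ((s.setV 22 q).setV 50 f)) ↔ I.ground v₀ f := by
      have := hG f hf
      simp only [State.nat] at this
      simp [this]
    have e3 : (∃ p < 2 * I.m, 0 < ((X.not ((X.var 51).eq (.var 22))).and ((get 23 (.var 51)).and
        (pcX (.var 51) (.var 50)))).eval (((s.setV 22 q).setV 50 f).setV 51 p)) ↔
        ∃ p < 2 * I.m, p ≠ q ∧ 0 < s.nat 23 p ∧ I.pc p f := by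
      apply exists_congr
      intro p
      refine and_congr_right fun hp => ?_
      have hp' := hf'.setV 51 p
      rw [eval_and, tv_pos, eval_and, tv_pos,
        hp'.eval_pcX (c := p) (a := f) (by simp) (by simp) hp hf]
      simp [State.nat]
    rw [e2, e3, not_and, not_not, and_imp]
  constructor
  · intro h2
    obtain ⟨hq, hall⟩ := hcond.1 h2
    refine ⟨by simpa using hB.abs_le (k := 0) (by omega), ?_⟩
    have := hp.delete hd hq (fnd_spec hq) hall
    convert this using 1
    simp only [eval_var, State.setV_var, if_true]
    rw [State.nat_setA]
    rfl
  · intro h2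
    rw [hcond] at h2
    by_cases hq : q < 2 * I.m
    · have h3 : ¬ D := fun hD' => h2 ⟨hq, hD'⟩
      simp only [hD, not_forall] at h3
      obtain ⟨f, hf, hg, hc, hno⟩ := h3
      exact hp.keep hd hq (fnd_spec hq) hf hg hc fun p hp' hne h4 h5 => hno ⟨p, hp', hne, h4, h5⟩
    · refine hp.skip fun p hp' h4 => hq (fnd_lt_iff.2 ⟨p, hp', h4⟩)

theorem pruneCmd_wp (h : Env I s) (hB : Small I B)
    (hG : ∀ v < I.n, s.nat 20 v = tv (I.ground v₀ v))
    (hd : I.DualInv v₀ I.n (s.nat 21) (s.nat 22)) :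
    pruneCmd.wp B (fun s' => I.UpOut v₀ (s.nat 21) (s'.nat 23)) s := by
  refine wp_seq (P := fun s' => ∀ q < 2 * I.m, s'.nat 23 q = tv (0 < s.nat 22 q))
    (wp_fill (fun q => tv (0 < s.nat 22 q)) h.mm ?_ fun s' _ h1 _ => h1) ?_
  · intro k _ s' hf hx _ _
    refine ⟨?_, hB.abs_tv _⟩
    simp only [eval_lt, eval_lit, eval_get, eval_var, hx]
    rw [hf.arr 22 rfl]
    rfl
  intro s1 hk hf1
  have h1 := h.frame hf1 rfl
  refine wp_forTo (fun k s' => I.PruneInv v₀ k (s.nat 22) (s'.nat 23)) h1.n ?_ ?_ ?_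
  · refine Inst.PruneInv.init hd ?_
    intro q hq
    rw [hk q hq, tv_pos]
  · intro k hk s' hf hp
    have h' := h1.frame hf rfl
    have e22 : s'.nat 22 = s.nat 22 := by rw [hf.nat rfl, hf1.nat rfl]
    have e21 : s'.nat 21 = s.nat 21 := by rw [hf.nat rfl, hf1.nat rfl]
    have e20 : s'.nat 20 = s.nat 20 := by rw [hf.nat rfl, hf1.nat rfl]
    have := pruneStep_wp (v₀ := v₀) (h'.setV 21 k) hB hk (by simp) (by rw [State.nat_setV, e20]; exact hG)
      (by rw [State.nat_setV, State.nat_setV, e22, e21]; exact hd)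
      (by rw [State.nat_setV, State.nat_setV, e22]; exact hp)
    rw [State.nat_setV, e22] at this
    exact this
  · intro s' _ hp
    exact hp.upOut hd

theorem upCmd_wp (h : Env I s) (hB : Small I B) (hv0 : s.var 13 = v₀) (hv : v₀ < I.n) :
    upCmd.wp B (fun s' => ∃ y, I.UpOut v₀ y (s'.nat 23)) s := by
  refine wp_seq (groundCmd_wp h hB hv0 hv) fun s1 hG hf1 => ?_
  have h1 := h.frame hf1 rfl
  refine wp_seq (dualCmd_wp h1 hB hG) fun s2 hd hf2 => ?_
  have h2 := h1.frame hf2 rfl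
  refine wp_mono (fun s' h3 => ⟨_, h3⟩) (pruneCmd_wp (v₀ := v₀) h2 hB ?_ hd)
  rw [hf2.nat rfl]
  exact hG

end Eval

end Aug

end RAM

/-! ### Cheapest links for lowest vertices and for pairs of them -/

namespace RAM

namespace Aug

open X Cmd

namespace Inst

variable (I : Inst)

def touch (v₀ u l : ℕ) : Prop := I.lowest v₀ u ∧ I.cross l ∧ I.cov u l

/-- A cheapest cross-link at `u`. -/
noncomputable def single (v₀ u : ℕ) : ℕ :=
  fnd I.m fun l => I.touch v₀ u l ∧ ∀ j < I.m, I.touch v₀ u j → I.C l ≤ I.C j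

def both (v₀ u v l : ℕ) : Prop := u ≠ v ∧ I.touch v₀ u l ∧ I.touch v₀ v l

/-- A cheapest cross-link that serves both `u` and `v`. -/
noncomputable def double (v₀ u v : ℕ) : ℕ :=
  fnd I.m fun l => I.both v₀ u v l ∧ ∀ j < I.m, I.both v₀ u v j → I.C l ≤ I.C j

def direct (v₀ u v : ℕ) : Prop :=
  I.double v₀ u v < I.m ∧ I.C (I.double v₀ u v) < I.C (I.single v₀ u) + I.C (I.single v₀ v)

open Classical in
noncomputable def fstLink (v₀ u v : ℕ) : ℕ :=
  if I.direct v₀ u v then I.double v₀ u v else I.single v₀ u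

-- In the direct case the index `m` stands for no link, at cost 0.
open Classical in
noncomputable def sndLink (v₀ u v : ℕ) : ℕ :=
  if I.direct v₀ u v then I.m else I.single v₀ v

variable {I}

theorem single_spec {v₀ u : ℕ} (h : I.single v₀ u < I.m) : I.touch v₀ u (I.single v₀ u) ∧
    ∀ j < I.m, I.touch v₀ u j → I.C (I.single v₀ u) ≤ I.C j := fnd_spec h

theorem double_spec {v₀ u v : ℕ} (h : I.double v₀ u v < I.m) :
    I.both v₀ u v (I.double v₀ u v) ∧
    ∀ j < I.m, I.both v₀ u v j → I.C (I.double v₀ u v) ≤ I.C j := fnd_spec h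

/-- The cross value at a lowest vertex exceeds a nonnegative threshold, so some cross-link covers
it. -/
theorem single_lt {v₀ u : ℕ} (hl : I.lowest v₀ u) : I.single v₀ u < I.m := by
  refine fnd_argmin (f := I.C) ?_
  by_contra! hno
  have h0 : I.zc u = 0 := by
    apply Finset.sum_eq_zero
    intro l hlm
    rw [tv_false, zero_mul]
    exact fun h => hno l (Finset.mem_range.1 hlm) ⟨hl, h⟩
  have h1 := hl.1
  have h2 := zc_nonneg (I := I) v₀
  omega

theorem single_le {v₀ u l : ℕ} (hlm : l < I.m) (h : I.touch v₀ u l) :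
    I.C (I.single v₀ u) ≤ I.C l := by
  have : I.single v₀ u < I.m := fnd_argmin (f := I.C) ⟨l, hlm, h⟩
  exact (single_spec this).2 l hlm h

/-- At a vertex that is not lowest no link qualifies, so `single` takes its default `m` of cost 0;
such vertices take part in the assignment for free. On the diagonal `both` fails by definition, so
the pair consists of two copies of the same link. -/
theorem pairOut (v₀ : ℕ) :
    I.PairOut v₀ (fun u => I.C (I.single v₀ u)) (I.fstLink v₀) (I.sndLink v₀) := by
  have hm : I.C I.m = 0 := I.C_of_le _ le_rfl
  have hle : ∀ u v, I.C (I.fstLink v₀ u v) + I.C (I.sndLink v₀ u v) ≤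
      I.C (I.single v₀ u) + I.C (I.single v₀ v) := by
    intro u v
    unfold fstLink sndLink
    split_ifs with h
    · rw [hm]; linarith [h.2]
    · exact le_rfl
  have hleft : ∀ u v, I.C (I.single v₀ u) ≤ I.C (I.fstLink v₀ u v) + I.C (I.sndLink v₀ u v) := by
    intro u v
    unfold fstLink sndLink
    split_ifs with h
    · rw [hm, add_zero]
      exact single_le h.1 (double_spec h.1).1.2.1
    · linarith [I.C_nonneg (I.single v₀ v)]
  have hright : ∀ u v, I.C (I.single v₀ v) ≤ I.C (I.fstLink v₀ u v) + I.C (I.sndLink v₀ u v) := by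
    intro u v
    unfold fstLink sndLink
    split_ifs with h
    · rw [hm, add_zero]
      exact single_le h.1 (double_spec h.1).1.2.2
    · linarith [I.C_nonneg (I.single v₀ u)]
  have hdiag : ∀ u, ¬ I.direct v₀ u u := fun u h => (double_spec h.1).1.1 rfl
  refine ⟨?_, ?_, fun u _ v _ => hle u v, fun u _ v _ => hleft u v,
    fun u _ v _ => hright u v, ?_, ?_, ?_, ?_, ?_⟩
  · intro u _ hl
    apply I.C_of_le
    by_contra h
    exact hl (single_spec (not_le.1 h)).1.1
  · intro u _ hl l hlm hc hcov
    exact single_le hlm ⟨hl, hc, hcov⟩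
  · intro u _ v _ huv hu hv l hlm hc hcu hcv
    have hb : I.both v₀ u v l := ⟨huv, ⟨hu, hc, hcu⟩, hv, hc, hcv⟩
    have hd : I.double v₀ u v < I.m := fnd_argmin (f := I.C) ⟨l, hlm, hb⟩
    have hdl := (double_spec hd).2 l hlm hb
    unfold fstLink sndLink
    split_ifs with h
    · rw [hm]; linarith
    · have : ¬ I.C (I.double v₀ u v) < I.C (I.single v₀ u) + I.C (I.single v₀ v) :=
        fun h' => h ⟨hd, h'⟩
      linarith
  · intro u _
    simp [fstLink, sndLink, hdiag u]
  · intro u hu v _ hl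
    by_cases h : I.direct v₀ u v
    · obtain ⟨h1, h2⟩ := (double_spec h.1).1.2.1
      exact ⟨_, h.1, Or.inl (by rw [fstLink, if_pos h]), h2⟩
    · have h1 := single_lt hl
      exact ⟨_, h1, Or.inl (by rw [fstLink, if_neg h]), (single_spec h1).1.2⟩
  · intro u _ v hv hl
    by_cases h : I.direct v₀ u v
    · obtain ⟨h1, h2⟩ := (double_spec h.1).1.2.2
      exact ⟨_, h.1, Or.inl (by rw [fstLink, if_pos h]), h2⟩
    · have h1 := single_lt hl
      exact ⟨_, h1, Or.inr (by rw [sndLink, if_neg h]), (single_spec h1).1.2⟩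
  · intro u hu hl
    have h1 := single_lt hl
    rw [fstLink, if_neg (hdiag u)]
    exact ⟨h1, (single_spec h1).1.2⟩

end Inst

section Eval

variable {I : Inst} {s : State} {B : ℤ} {v₀ : ℕ}

theorem Env.eval_rowX (h : Env I s) {k : X} {a : ℕ} (hk : k.eval s = a) :
    (rowX k).eval s = ((a / I.n : ℕ) : ℤ) := by
  simp [rowX, hk, h.n]

theorem Env.eval_colX (h : Env I s) {k : X} {a : ℕ} (hk : k.eval s = a) :
    (colX k).eval s = ((a % I.n : ℕ) : ℤ) := by
  simp only [colX, eval_sub, eval_mul, eval_div, eval_var, hk, h.n]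
  have := Nat.div_add_mod a I.n
  push_cast
  rw [← Int.emod_def]

theorem row_lt {n k : ℕ} (hk : k < n * n) : k / n < n := Nat.div_lt_of_lt_mul hk

theorem col_lt {n k : ℕ} (hk : k < n * n) : k % n < n := by
  apply Nat.mod_lt
  by_contra h
  have : n = 0 := by omega
  subst this
  simp at hk

theorem row_idx {n u v : ℕ} (hv : v < n) : (u * n + v) / n = u := by
  rw [Nat.mul_comm, Nat.mul_add_div (by omega), Nat.div_eq_of_lt hv, add_zero]

theorem col_idx {n u v : ℕ} (hv : v < n) : (u * n + v) % n = v := by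
  rw [Nat.mul_comm, Nat.mul_add_mod, Nat.mod_eq_of_lt hv]

theorem idx_lt {n u v : ℕ} (hu : u < n) (hv : v < n) : u * n + v < n * n := by
  have : (u + 1) * n ≤ n * n := Nat.mul_le_mul_right n hu
  rw [add_mul] at this
  omega

theorem minimalCmd_wp (h : Env I s) (hB : Small I B) (hv0 : s.var 13 = v₀) (hv : v₀ < I.n) :
    minimalCmd.wp B (fun s' => ∀ v < I.n, s'.nat 24 v = tv (I.lowest v₀ v)) s := by
  refine wp_fill (fun v => tv (I.lowest v₀ v)) h.n ?_ (fun s' _ h1 _ => h1)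
  intro k hk s' hf hx _ _
  have h' := h.frame hf rfl
  refine ⟨?_, hB.abs_tv _⟩
  have h13 : s'.var 13 = v₀ := by rw [hf.var 13 rfl, hv0]
  rw [eval_and, eval_all, tv_pos, h'.toNat_n]
  apply tv_congr
  refine and_congr (by simp [hx, h13, h'.zc v₀ hv, h'.zc k hk]) (forall₂_congr fun u hu => ?_)
  have hu' := h'.setV 50 u
  rw [eval_not, tv_pos, eval_and, tv_pos, eval_and, tv_pos,
    hu'.eval_domX (a := k) (b := u) (by simp [hx]) (by simp) hk hu, tv_pos]
  simp [h13, hx, h'.zc v₀ hv, h'.zc u hu]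

theorem Env.eval_touchX (h : Env I s) (hL : ∀ v < I.n, s.nat 24 v = tv (I.lowest v₀ v)) {u l : X}
    {a c : ℕ} (hu : u.eval s = a) (hl : l.eval s = c) (ha : a < I.n) (hc : c < I.m) :
    (touchX u l).eval s = tv (I.touch v₀ a c) := by
  rw [touchX, eval_and, eval_and, tv_pos, h.eval_covX hu hl ha hc]
  have := hL a ha
  simp only [State.nat] at this
  simp only [eval_get, hu, hl, this, h.cross c hc, tv_pos]
  rfl

theorem singleCmd_wp (h : Env I s) (hB : Small I B)
    (hL : ∀ v < I.n, s.nat 24 v = tv (I.lowest v₀ v)) :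
    singleCmd.wp B (fun s' => ∀ v < I.n, s'.nat 25 v = I.single v₀ v) s := by
  refine wp_fill (fun v => (I.single v₀ v : ℕ)) h.n ?_ (fun s' _ h1 _ => h1)
  intro k hk s' hf hx _ _
  have h' := h.frame hf rfl
  have hL' : ∀ v < I.n, s'.nat 24 v = tv (I.lowest v₀ v) := by rw [hf.nat rfl]; exact hL
  refine ⟨?_, hB.abs_fnd _ (by omega)⟩
  rw [eval_find, h'.toNat_m, Inst.single]
  congr 1
  apply fnd_congr
  intro l hl
  have hl' := h'.setV 50 l
  rw [eval_and, tv_pos, hl'.eval_touchX (v₀ := v₀) (by exact hL') (a := k) (c := l) (by simp [hx]) (by simp) hk hl,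
    tv_pos, eval_all, tv_pos, hl'.toNat_m]
  refine and_congr_right fun _ => forall₂_congr fun j hj => ?_
  have hj' := hl'.setV 51 j
  rw [eval_not, tv_pos, eval_and, tv_pos,
    hj'.eval_touchX (v₀ := v₀) (by exact hL') (a := k) (c := j) (by simp [hx]) (by simp) hk hj]
  simp [h'.C]

theorem Env.eval_bothX (h : Env I s) (hL : ∀ v < I.n, s.nat 24 v = tv (I.lowest v₀ v)) {k l : X}
    {a c : ℕ} (hk : k.eval s = a) (hl : l.eval s = c) (ha : a < I.n * I.n) (hc : c < I.m) :
    (bothX k l).eval s = tv (I.both v₀ (a / I.n) (a % I.n) c) := by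
  have hr := h.eval_rowX hk
  have hcl := h.eval_colX hk
  rw [bothX, eval_and, eval_and, tv_pos, h.eval_touchX hL hr hl (row_lt ha) hc,
    h.eval_touchX hL hcl hl (col_lt ha) hc, eval_not, eval_eq, hr, hcl]
  simp only [tv_pos, Nat.cast_inj]
  rfl

theorem doubleCmd_wp (h : Env I s) (hB : Small I B)
    (hL : ∀ v < I.n, s.nat 24 v = tv (I.lowest v₀ v)) :
    doubleCmd.wp B (fun s' => ∀ k < I.n * I.n, s'.nat 26 k = I.double v₀ (k / I.n) (k % I.n)) s := by
  refine wp_fill (fun k => (I.double v₀ (k / I.n) (k % I.n) : ℕ)) h.nn ?_ (fun s' _ h1 _ => h1)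
  intro k hk s' hf hx _ _
  have h' := h.frame hf rfl
  have hL' : ∀ v < I.n, s'.nat 24 v = tv (I.lowest v₀ v) := by rw [hf.nat rfl]; exact hL
  refine ⟨?_, hB.abs_fnd _ (by omega)⟩
  rw [eval_find, h'.toNat_m, Inst.double]
  congr 1
  apply fnd_congr
  intro l hl
  have hl' := h'.setV 50 l
  rw [eval_and, tv_pos, hl'.eval_bothX (v₀ := v₀) (by exact hL') (a := k) (c := l) (by simp [hx]) (by simp) hk hl,
    tv_pos, eval_all, tv_pos, hl'.toNat_m]
  refine and_congr_right fun _ => forall₂_congr fun j hj => ?_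
  have hj' := hl'.setV 51 j
  rw [eval_not, tv_pos, eval_and, tv_pos,
    hj'.eval_bothX (v₀ := v₀) (by exact hL') (a := k) (c := j) (by simp [hx]) (by simp) hk hj]
  simp [h'.C]

theorem Env.eval_directX (h : Env I s) (h1 : ∀ v < I.n, s.nat 25 v = I.single v₀ v)
    (h2 : ∀ k < I.n * I.n, s.nat 26 k = I.double v₀ (k / I.n) (k % I.n)) {k : ℕ}
    (hk : k < I.n * I.n) (hx : s.var 20 = k) :
    directX.eval s = tv (I.direct v₀ (k / I.n) (k % I.n)) := by
  have e1 := h1 _ (row_lt hk)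
  have e2 := h1 _ (col_lt hk)
  have e3 := h2 k hk
  have hr := h.eval_rowX (k := .var 20) (a := k) (by simp [hx])
  have hc := h.eval_colX (k := .var 20) (a := k) (by simp [hx])
  simp only [State.nat] at e1 e2 e3
  simp only [directX, eval_and, eval_lt, eval_get, eval_add, eval_var, hx, hr, hc, e1, e2, e3, h.C,
    h.m, tv_pos, Nat.cast_lt]
  rfl

theorem single_le_m (u : ℕ) : I.single v₀ u ≤ I.m := fnd_le _ _
theorem double_le_m (u v : ℕ) : I.double v₀ u v ≤ I.m := fnd_le _ _

theorem fstLink_le (u v : ℕ) : I.fstLink v₀ u v ≤ I.m := by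
  unfold Inst.fstLink
  split_ifs
  · exact double_le_m _ _
  · exact single_le_m _

theorem sndLink_le (u v : ℕ) : I.sndLink v₀ u v ≤ I.m := by
  unfold Inst.sndLink
  split_ifs
  · exact le_rfl
  · exact single_le_m _

/-- The arrays of links for pairs of vertices are in memory. -/
structure Pairs (I : Inst) (v₀ : ℕ) (s : State) : Prop where
  fst : ∀ k < I.n * I.n, s.nat 27 k = I.fstLink v₀ (k / I.n) (k % I.n)
  snd : ∀ k < I.n * I.n, s.nat 28 k = I.sndLink v₀ (k / I.n) (k % I.n)

theorem Pairs.congr {s' : State} (h : Pairs I v₀ s) (h1 : s'.nat 27 = s.nat 27)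
    (h2 : s'.nat 28 = s.nat 28) : Pairs I v₀ s' := by
  constructor
  · rw [h1]; exact h.fst
  · rw [h2]; exact h.snd

theorem pairCmd_wp (h : Env I s) (hB : Small I B) (h1 : ∀ v < I.n, s.nat 25 v = I.single v₀ v)
    (h2 : ∀ k < I.n * I.n, s.nat 26 k = I.double v₀ (k / I.n) (k % I.n)) :
    pairCmd.wp B (Pairs I v₀) s := by
  refine wp_seq (P := fun s' => ∀ k < I.n * I.n, s'.nat 27 k = I.fstLink v₀ (k / I.n) (k % I.n))
    (wp_fill (fun k => (I.fstLink v₀ (k / I.n) (k % I.n) : ℕ)) h.nn ?_ (fun s' _ h1 _ => h1)) ?_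
  · intro k hk s' hf hx _ _
    have h' := h.frame hf rfl
    refine ⟨?_, hB.abs_le ((fstLink_le _ _).trans (by omega))⟩
    have e1 := h1 _ (row_lt hk)
    have e3 := h2 k hk
    rw [← hf.nat rfl] at e1 e3
    have hr := h'.eval_rowX (k := .var 20) (a := k) (by simp [hx])
    have hd := h'.eval_directX (v₀ := v₀) (k := k) (by rw [hf.nat rfl]; exact h1)
      (by rw [hf.nat rfl]; exact h2) hk hx
    simp only [State.nat] at e1 e3
    simp only [eval_add, eval_mul, eval_not, eval_get, hd, hr, eval_var, hx, e1, e3, tv_pos]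
    unfold Inst.fstLink
    by_cases hdd : I.direct v₀ (k / I.n) (k % I.n) <;> simp [hdd, tv]
  intro s1 hfst hf1
  have h1' := h.frame hf1 rfl
  refine wp_fill (fun k => (I.sndLink v₀ (k / I.n) (k % I.n) : ℕ)) h1'.nn ?_
    (fun s' hf' h3 _ => ⟨by rw [hf'.nat rfl]; exact hfst, h3⟩)
  intro k hk s' hf hx _ _
  have h' := h1'.frame hf rfl
  refine ⟨?_, hB.abs_le ((sndLink_le _ _).trans (by omega))⟩
  have e1 := h1 _ (col_lt hk)
  rw [← hf1.nat rfl, ← hf.nat rfl] at e1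
  have hr := h'.eval_colX (k := .var 20) (a := k) (by simp [hx])
  have hd := h'.eval_directX (v₀ := v₀) (k := k) (by rw [hf.nat rfl, hf1.nat rfl]; exact h1)
    (by rw [hf.nat rfl, hf1.nat rfl]; exact h2) hk hx
  simp only [State.nat] at e1
  simp only [eval_add, eval_mul, eval_not, eval_get, hd, hr, eval_var, h'.m, e1, tv_pos]
  unfold Inst.sndLink
  by_cases hdd : I.direct v₀ (k / I.n) (k % I.n) <;> simp [hdd, tv]

theorem prepCmd_wp (h : Env I s) (hB : Small I B) (hv0 : s.var 13 = v₀) (hv : v₀ < I.n) :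
    prepCmd.wp B (Pairs I v₀) s := by
  refine wp_seq (minimalCmd_wp h hB hv0 hv) fun s1 hL hf1 => ?_
  have h1 := h.frame hf1 rfl
  refine wp_seq (singleCmd_wp h1 hB hL) fun s2 hS hf2 => ?_
  have h2 := h1.frame hf2 rfl
  refine wp_seq (doubleCmd_wp (v₀ := v₀) h2 hB (by rw [hf2.nat rfl]; exact hL)) fun s3 hD hf3 => ?_
  have h3 := h2.frame hf3 rfl
  exact pairCmd_wp h3 hB (by rw [hf3.nat rfl]; exact hS) hD

/-- The cost of an arc of the assignment problem. -/
noncomputable def arcCost (I : Inst) (v₀ u v : ℕ) : ℤ :=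
  I.C (I.fstLink v₀ u v) + I.C (I.sndLink v₀ u v)

theorem arcCost_nonneg (u v : ℕ) : 0 ≤ arcCost I v₀ u v :=
  add_nonneg (I.C_nonneg _) (I.C_nonneg _)

theorem Small.arcCost_le (hB : Small I B) (u v : ℕ) : 2 * arcCost I v₀ u v ≤ B := by
  have h1 := hB.C_le (I.fstLink v₀ u v)
  have h2 := hB.C_le (I.sndLink v₀ u v)
  unfold arcCost
  linarith

theorem Env.eval_slackX (h : Env I s) (hp : Pairs I v₀ s) {k : X} {a : ℕ} (hk : k.eval s = a)
    (ha : a < I.n * I.n) : (slackX k).eval s =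
      arcCost I v₀ (a / I.n) (a % I.n) - s.nat 30 (a / I.n) - s.nat 31 (a % I.n) := by
  have e1 := hp.fst a ha
  have e2 := hp.snd a ha
  simp only [State.nat] at e1 e2
  simp only [slackX, eval_sub, eval_add, eval_get, h.eval_rowX hk, h.eval_colX hk, hk, e1, e2, h.C]
  rfl

theorem Env.eval_eligX (h : Env I s) {k : X} {a : ℕ} (hk : k.eval s = a) :
    (eligX k).eval s = tv (0 < s.nat 33 (a / I.n) ∧ ¬ 0 < s.nat 34 (a % I.n)) := by
  simp only [eligX, eval_and, eval_not, eval_get, h.eval_rowX hk, h.eval_colX hk, tv_pos]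
  rfl

end Eval

end Aug

end RAM

/-! ### The program for the Hungarian method -/

namespace RAM

namespace Aug

open X Cmd

section Eval

variable {I : Inst} {s : State} {B : ℤ} {v₀ k : ℕ}

/-- The memory holds the state of the search. -/
def SearchSt (I : Inst) (v₀ k t : ℕ) (s : State) : Prop :=
  ∃ (α β inR : ℕ → ℤ) (σ cs par : ℕ → ℕ), (∀ i < I.n, s.nat 30 i = α i) ∧
    (∀ j < I.n, s.nat 31 j = β j) ∧ (∀ i < I.n, s.nat 32 i = σ i) ∧ (∀ i < I.n, s.nat 33 i = inR i) ∧
    (∀ j < I.n, s.nat 34 j = cs j) ∧ (∀ j < I.n, 0 < cs j → s.nat 35 j = par j) ∧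
    Search I.n k t (arcCost I v₀) α β σ inR cs par

/-- The memory holds an augmenting path. -/
def FoundSt (I : Inst) (v₀ k t : ℕ) (s : State) : Prop :=
  ∃ (α β : ℕ → ℤ) (σ cs par : ℕ → ℕ) (j : ℕ), (∀ i < I.n, s.nat 30 i = α i) ∧
    (∀ j < I.n, s.nat 31 j = β j) ∧ (∀ i < I.n, s.nat 32 i = σ i) ∧
    (∀ j < I.n, 0 < cs j → s.nat 35 j = par j) ∧ s.var 25 = j ∧
    Found I.n k t (arcCost I v₀) α β σ cs par j

/-- The memory holds a partial assignment. -/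
def MatchedSt (I : Inst) (v₀ k : ℕ) (s : State) : Prop :=
  ∃ (α β : ℕ → ℤ) (σ : ℕ → ℕ), (∀ i < I.n, s.nat 30 i = α i) ∧
    (∀ j < I.n, s.nat 31 j = β j) ∧ (∀ i < I.n, s.nat 32 i = σ i) ∧
    Matched I.n k I.n (arcCost I v₀) α β σ

theorem searchStep_wp (h : Env I s) (hp : Pairs I v₀ s) (hB : Small I B) (hk : k < I.n) {t : ℕ}
    (h20 : s.var 20 = k) (h22 : s.var 22 = t) (h24 : s.var 24 = 0) (hS : SearchSt I v₀ k t s) :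
    searchStep.wp B (fun s' => (s'.var 24 = 0 ∧ SearchSt I v₀ k (t + 1) s') ∨
      (s'.var 24 = 1 ∧ FoundSt I v₀ k I.n s')) s := by
  obtain ⟨α, β, inR, σ, cs, par, a30, a31, a32, a33, a34, a35, hS⟩ := hS
  have ht := hS.lt hk
  have hwB : ∀ i < I.n, ∀ j < I.n, arcCost I v₀ i j ≤ B / 2 := fun i _ j _ => by
    have := hB.arcCost_le (v₀ := v₀) i j
    omega
  have hw0 : ∀ i < I.n, ∀ j < I.n, 0 ≤ arcCost I v₀ i j := fun i _ j _ => arcCost_nonneg i j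
  set E : ℕ → Prop := fun a => 0 < inR (a / I.n) ∧ cs (a % I.n) = 0 with hE
  set g : ℕ → ℤ := fun a => arcCost I v₀ (a / I.n) (a % I.n) - α (a / I.n) - β (a % I.n) with hg
  have hslack : ∀ {x a : ℕ} {u : State}, Env I u → Pairs I v₀ u → u.nat 30 = s.nat 30 →
      u.nat 31 = s.nat 31 → u.var x = a → a < I.n * I.n → (slackX (.var x)).eval u = g a := by
    intro x a u hu hpu e1 e2 hx ha
    rw [hu.eval_slackX hpu (k := .var x) (a := a) (by simpa using hx) ha, e1, e2,
      a30 _ (row_lt ha), a31 _ (col_lt ha)]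
  have helig : ∀ {x a : ℕ} {u : State}, Env I u → u.nat 33 = s.nat 33 →
      u.nat 34 = s.nat 34 → u.var x = a → a < I.n * I.n → (eligX (.var x)).eval u = tv (E a) := by
    intro x a u hu e1 e2 hx ha
    rw [hu.eval_eligX (k := .var x) (a := a) (by simpa using hx), e1, e2,
      a33 _ (row_lt ha), a34 _ (col_lt ha)]
    apply tv_congr
    simp [hE]
  set P : ℕ → Prop := fun a => E a ∧ ∀ b < I.n * I.n, E b → g a ≤ g b with hP
  set p := fnd (I.n * I.n) P with hpdef
  have hfind : (find 50 3 (X.and (eligX (.var 50)) (all 51 3 (X.not (X.and (eligX (.var 51))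
      (lt (slackX (.var 51)) (slackX (.var 50)))))))).eval s = p := by
    rw [eval_find, h.toNat_nn, hpdef]
    congr 1
    apply fnd_congr
    intro a ha
    have ha' := h.setV 50 a
    rw [eval_and, tv_pos, helig ha' rfl rfl (by simp) ha, tv_pos, eval_all, tv_pos, ha'.toNat_nn]
    refine and_congr_right fun _ => forall₂_congr fun b hb => ?_
    have hb' := ha'.setV 51 b
    have hpb : Pairs I v₀ ((s.setV 50 a).setV 51 b) := hp.congr rfl rfl
    rw [eval_not, tv_pos, eval_and, tv_pos, helig hb' rfl rfl (by simp) hb, tv_pos, eval_lt, tv_pos,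
      hslack hb' hpb rfl rfl (by simp) hb, hslack (a := a) hb' hpb rfl rfl (by simp) ha]
    rw [not_and, not_lt]
  have hpn : p < I.n * I.n := by
    obtain ⟨i, hi, j, hj, h1, h2⟩ := hS.exists_elig hk
    refine fnd_argmin (f := g) ⟨i * I.n + j, idx_lt hi hj, ?_⟩
    simp only [hE, row_idx hj, col_idx hj]
    exact ⟨h1, h2⟩
  obtain ⟨⟨hR, hC⟩, hmin⟩ : P p := fnd_spec hpn
  set i₁ := p / I.n with hi1
  set j₁ := p % I.n with hj1
  have hi : i₁ < I.n := row_lt hpn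
  have hj : j₁ < I.n := col_lt hpn
  set δ : ℤ := arcCost I v₀ i₁ j₁ - α i₁ - β j₁ with hδ
  have hmin' : ∀ i < I.n, ∀ j < I.n, 0 < inR i → cs j = 0 → δ ≤ arcCost I v₀ i j - α i - β j := by
    intro i hi j hj h1 h2
    have := hmin (i * I.n + j) (idx_lt hi hj) (by
      simp only [hE, row_idx hj, col_idx hj]; exact ⟨h1, h2⟩)
    simpa only [hg, row_idx hj, col_idx hj] using this
  have hδ0 : 0 ≤ δ := by
    have := hS.mat.feas i₁ hi j₁ hj
    linarith
  -- Row potentials are nonnegative, and both the arc cost and the negated column potential are at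
  -- most `B / 2`.
  have hδB : δ ≤ B := by
    have h1 := hS.mat.nonneg i₁ hi
    have h2 := hS.mat.neg_le_of_lt hk hwB hw0 hj
    have h3 := hwB i₁ hi j₁ hj
    omega
  have hm := hS.matched_update hk hi hj hδ hmin'
  refine ⟨by rw [hfind]; exact hB.abs_fnd _ (by omega), ?_⟩
  rw [hfind]
  have h1 := h.setV 26 p
  have e1 := h1.eval_rowX (k := .var 26) (a := p) (by simp)
  refine ⟨by rw [e1]; exact hB.abs_le (by omega), ?_⟩
  rw [e1]
  have h2 := h1.setV 27 i₁
  have e2 := h2.eval_colX (k := .var 26) (a := p) (by simp)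
  refine ⟨by rw [e2]; exact hB.abs_le (by omega), ?_⟩
  rw [e2]
  have h3 := h2.setV 28 j₁
  have e3 := hslack (x := 26) (a := p) h3 (hp.congr rfl rfl) rfl rfl (by simp) hpn
  refine ⟨by rw [e3]; exact abs_le.2 ⟨by show -B ≤ δ; linarith, hδB⟩, ?_⟩
  rw [e3]
  change wp B _ _ ((((s.setV 26 p).setV 27 i₁).setV 28 j₁).setV 29 δ)
  have h4 := h3.setV 29 δ
  set s4 := (((s.setV 26 p).setV 27 i₁).setV 28 j₁).setV 29 δ with hs4
  refine wp_seq (P := fun s' => ∀ i < I.n, s'.nat 30 i = α i + tv (0 < inR i) * δ)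
    (wp_fill (fun i => α i + tv (0 < inR i) * δ) h4.n ?_ (fun s' _ h1 _ => h1)) ?_
  · intro i hi s' hf hx _ hold
    refine ⟨?_, ?_⟩
    · have q1 := hold i le_rfl
      have q2 : s'.arr 33 i = inR i := by rw [hf.arr 33 rfl]; exact a33 i hi
      have q3 : s'.var 29 = δ := by rw [hf.var 29 rfl]; simp [hs4]
      have q4 : s4.arr 30 i = α i := a30 i hi
      simp only [eval_add, eval_mul, eval_lt, eval_lit, eval_get, eval_var, hx, q1, q2, q3, q4]
    · have q1 := hm.nonneg i hi
      have q2 := hm.le_of_lt hk hwB hi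
      rw [abs_of_nonneg q1]
      omega
  intro s5 b30 hf5
  have h5 := h4.frame hf5 rfl
  refine wp_seq (P := fun s' => ∀ j < I.n, s'.nat 31 j = β j - tv (0 < cs j) * δ)
    (wp_fill (fun j => β j - tv (0 < cs j) * δ) h5.n ?_ (fun s' _ h1 _ => h1)) ?_
  · intro j hj s' hf hx _ hold
    refine ⟨?_, ?_⟩
    · have q1 := hold j le_rfl
      have q2 : s'.arr 34 j = cs j := by rw [hf.arr 34 rfl, hf5.arr 34 rfl]; exact a34 j hj
      have q3 : s'.var 29 = δ := by rw [hf.var 29 rfl, hf5.var 29 rfl]; simp [hs4]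
      have q4 : s5.arr 31 j = β j := by rw [hf5.arr 31 rfl]; exact a31 j hj
      simp only [eval_sub, eval_mul, eval_lt, eval_lit, eval_get, eval_var, hx, q1, q2, q3, q4,
        Nat.cast_pos]
    · have q1 := hm.nonpos j hj
      have q2 := hm.neg_le_of_lt hk hwB hw0 hj
      rw [abs_of_nonpos q1]
      omega
  intro s6 b31 hf6
  have h6 := h5.frame hf6 rfl
  have v28 : s6.var 28 = j₁ := by rw [hf6.var 28 rfl, hf5.var 28 rfl]; simp [hs4]
  have v27 : s6.var 27 = i₁ := by rw [hf6.var 27 rfl, hf5.var 27 rfl]; simp [hs4]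
  have v22 : s6.var 22 = t := by rw [hf6.var 22 rfl, hf5.var 22 rfl]; simp [hs4, h22]
  have v20 : s6.var 20 = k := by rw [hf6.var 20 rfl, hf5.var 20 rfl]; simp [hs4, h20]
  have v24 : s6.var 24 = 0 := by rw [hf6.var 24 rfl, hf5.var 24 rfl]; simp [hs4, h24]
  have b30' : s6.nat 30 = s5.nat 30 := hf6.nat rfl
  have b32 : s6.nat 32 = s.nat 32 := by rw [hf6.nat rfl, hf5.nat rfl]; rfl
  have b33 : s6.nat 33 = s.nat 33 := by rw [hf6.nat rfl, hf5.nat rfl]; rfl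
  have b34 : s6.nat 34 = s.nat 34 := by rw [hf6.nat rfl, hf5.nat rfl]; rfl
  have b35 : s6.nat 35 = s.nat 35 := by rw [hf6.nat rfl, hf5.nat rfl]; rfl
  refine ⟨by rw [eval_var, v27]; exact hB.abs_le (by omega), ?_⟩
  rw [eval_var, eval_var, v27, v28]
  have h7 := h6.setA 35 j₁ i₁
  refine ⟨?_, ?_⟩
  · simp only [eval_add, eval_var, eval_lit, State.setA_var, v22]
    exact_mod_cast hB.abs_le (k := t + 1) (by omega)
  have e8 : ((X.var 22).add (.lit 1)).eval (s6.setA 35 j₁ i₁) = ((t + 1 : ℕ) : ℤ) := by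
    simp [v22]
  have e9 : (X.var 28).eval (s6.setA 35 j₁ i₁) = j₁ := by simp [v28]
  rw [e8, e9]
  have h8 := h7.setA 34 j₁ ((t + 1 : ℕ) : ℤ)
  set s8 := (s6.setA 35 j₁ i₁).setA 34 j₁ ((t + 1 : ℕ) : ℤ) with hs8
  -- The row matched to the new column, or `n` if that column is free and an augmenting path has
  -- been found.
  set i₂ := fnd I.n fun i => i < k ∧ σ i = j₁ with hi2
  have e10 : (find 50 0 (X.and (lt (.var 50) (.var 20)) (X.eq (get 32 (.var 50)) (.var 28)))).eval s8
      = i₂ := by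
    rw [eval_find, h8.toNat_n, hi2]
    congr 1
    apply fnd_congr
    intro i hi
    have q1 : s6.arr 32 i = σ i := by
      have := a32 i hi
      rwa [← b32] at this
    simp [hs8, v20, v28, q1]
  refine ⟨by rw [e10]; exact hB.abs_fnd _ (by omega), ?_⟩
  rw [e10]
  have h9 := h8.setV 30 i₂
  set s9 := s8.setV 30 i₂ with hs9
  have n30 : s9.nat 30 = s6.nat 30 := by
    rw [hs9, State.nat_setV, hs8, State.nat_setA_ne _ (by norm_num), State.nat_setA_ne _ (by norm_num)]
  have n31 : s9.nat 31 = s6.nat 31 := by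
    rw [hs9, State.nat_setV, hs8, State.nat_setA_ne _ (by norm_num), State.nat_setA_ne _ (by norm_num)]
  have n32 : s9.nat 32 = s.nat 32 := by
    rw [hs9, State.nat_setV, hs8, State.nat_setA_ne _ (by norm_num), State.nat_setA_ne _ (by norm_num),
      b32]
  have n33 : s9.nat 33 = s.nat 33 := by
    rw [hs9, State.nat_setV, hs8, State.nat_setA_ne _ (by norm_num), State.nat_setA_ne _ (by norm_num),
      b33]
  have n34 : s9.nat 34 = Function.update (s.nat 34) j₁ ((t + 1 : ℕ) : ℤ) := by
    rw [hs9, State.nat_setV, hs8, State.nat_setA, State.nat_setA_ne _ (by norm_num), b34]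
  have n35 : s9.nat 35 = Function.update (s.nat 35) j₁ (i₁ : ℤ) := by
    rw [hs9, State.nat_setV, hs8, State.nat_setA_ne _ (by norm_num), State.nat_setA, b35]
  have c30 : ∀ i < I.n, s9.nat 30 i = α i + tv (0 < inR i) * δ := by rw [n30, b30']; exact b30
  have c31 : ∀ i < I.n, s9.nat 31 i = β i - tv (0 < cs i) * δ := by rw [n31]; exact b31
  have c34 : ∀ j < I.n, s9.nat 34 j = (Function.update cs j₁ (t + 1) j : ℕ) := by
    intro j hj
    rw [n34, Function.update_apply, Function.update_apply]
    split_ifs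
    · rfl
    · exact a34 j hj
  have c35 : ∀ j < I.n, 0 < Function.update cs j₁ (t + 1) j →
      s9.nat 35 j = (Function.update par j₁ i₁ j : ℕ) := by
    intro j hj hc
    rw [n35, Function.update_apply, Function.update_apply]
    split_ifs with hjj
    · rfl
    · rw [Function.update_of_ne hjj] at hc
      exact a35 j hj hc
  constructor
  · intro hlt
    have hi2n : i₂ < I.n := by simpa [h9.n, hs9, h8.n] using hlt
    obtain ⟨hi2k, hσ⟩ := fnd_spec hi2n
    refine ⟨by simpa using hB.abs_le (k := 1) (by omega), Or.inl ⟨?_, ?_⟩⟩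
    · simp [hs9, hs8, v24]
    · have e11 : (X.var 30).eval s9 = i₂ := by simp [hs9]
      rw [e11, eval_lit]
      refine ⟨_, _, _, _, _, _, ?_, ?_, ?_, ?_, ?_, ?_,
        hS.step hk hi hj hR hC hδ hmin' hi2k hσ⟩
      · rw [State.nat_setA_ne _ (by norm_num)]; exact c30
      · rw [State.nat_setA_ne _ (by norm_num)]; exact c31
      · rw [State.nat_setA_ne _ (by norm_num), n32]; exact a32
      · intro i hi
        rw [State.nat_setA, Function.update_apply, Function.update_apply]
        split_ifs
        · rfl
        · rw [n33]; exact a33 i hi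
      · rw [State.nat_setA_ne _ (by norm_num)]; exact c34
      · rw [State.nat_setA_ne _ (by norm_num)]; exact c35
  · intro hlt
    have hi2n : ¬ i₂ < I.n := by simpa [h9.n, hs9, h8.n] using hlt
    refine ⟨by simpa using hB.abs_le (k := 1) (by omega), ?_, Or.inr ⟨?_, ?_⟩⟩
    · simp only [eval_var, State.setV_var, hs9, hs8, State.setA_var]
      simp only [Nat.reduceEqDiff, if_false, v28]
      exact hB.abs_le (by omega)
    · simp
    · refine ⟨_, _, _, _, _, j₁, ?_, ?_, ?_, ?_, ?_, hS.found hk hi hj hR hC hδ hmin'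
        (fun i hi hσ => hi2n (fnd_lt_iff.2 ⟨i, by omega, hi, hσ⟩))⟩
      · exact c30
      · exact c31
      · rw [State.nat_setV, State.nat_setV, n32]; exact a32
      · exact c35
      · simp [hs9, hs8, v28]

/-- The bound `hcol` on the whole assignment array is required because the last flip reads the entry
of the unmatched row `k`, about which `Found` says nothing. -/
theorem augStep_wp (hB : Small I B) (hk : k < I.n) {t : ℕ}
    (h20 : s.var 20 = k) (h24 : s.var 24 = 1) (hF : FoundSt I v₀ k (t + 1) s)
    (hcol : ∀ i < I.n, |s.nat 32 i| ≤ B) :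
    augStep.wp B (fun s' => ((s'.var 24 = 1 ∧ FoundSt I v₀ k t s') ∨
      (s'.var 24 = 0 ∧ MatchedSt I v₀ (k + 1) s')) ∧ ∀ i < I.n, |s'.nat 32 i| ≤ B) s := by
  obtain ⟨α, β, σ, cs, par, j, a30, a31, a32, a35, h25, hF⟩ := hF
  have q1 : s.arr 35 j = par j := a35 j hF.lt hF.pos
  have e1 : (get 35 (.var 25)).eval s = par j := by simp [h25, q1]
  have hpar := (hF.reached j hF.lt hF.pos le_rfl).1
  refine ⟨by rw [e1]; exact hB.abs_le (by omega), ?_⟩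
  rw [e1]
  have q2 : s.arr 32 (par j : ℕ) = σ (par j) := a32 _ hpar
  have e2 : (get 32 (.var 27)).eval (s.setV 27 (par j)) = σ (par j) := by simp [q2]
  refine ⟨by rw [e2, ← a32 _ hpar]; exact hcol _ hpar, ?_⟩
  rw [e2]
  have hjB : |(j : ℤ)| ≤ B := hB.abs_le (by have := hF.lt; omega)
  refine ⟨by simpa [h25] using hjB, ?_⟩
  have e3 : (X.var 27).eval ((s.setV 27 (par j)).setV 28 (σ (par j))) = par j := by simp
  have e4 : (X.var 25).eval ((s.setV 27 (par j)).setV 28 (σ (par j))) = j := by simp [h25]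
  rw [e3, e4]
  set s3 := ((s.setV 27 (par j)).setV 28 (σ (par j))).setA 32 (par j) j with hs3
  have n30 : s3.nat 30 = s.nat 30 := by rw [hs3, State.nat_setA_ne _ (by norm_num)]; rfl
  have n31 : s3.nat 31 = s.nat 31 := by rw [hs3, State.nat_setA_ne _ (by norm_num)]; rfl
  have n35 : s3.nat 35 = s.nat 35 := by rw [hs3, State.nat_setA_ne _ (by norm_num)]; rfl
  have n32 : s3.nat 32 = Function.update (s.nat 32) (par j) (j : ℤ) := by
    rw [hs3, State.nat_setA]; rfl
  have c32 : ∀ i < I.n, s3.nat 32 i = (Function.update σ (par j) j i : ℕ) := by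
    intro i hi
    rw [n32, Function.update_apply, Function.update_apply]
    split_ifs
    · rfl
    · exact a32 i hi
  have hcol' : ∀ i < I.n, |s3.nat 32 i| ≤ B := by
    intro i hi
    rw [n32, Function.update_apply]
    split_ifs
    · exact hjB
    · exact hcol i hi
  have hcond : 0 < (X.eq (.var 27) (.var 20)).eval s3 ↔ par j = k := by
    simp [hs3, h20]
  constructor
  · intro hc
    rw [hcond] at hc
    refine ⟨by simpa using hB.abs_le (k := 0) (by omega), Or.inr ⟨by simp, ?_⟩, hcol'⟩
    refine ⟨α, β, _, ?_, ?_, ?_, hF.finish hk hc⟩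
    · rw [State.nat_setV, n30]; exact a30
    · rw [State.nat_setV, n31]; exact a31
    · rw [State.nat_setV, ← hc]; exact c32
  · intro hc
    rw [hcond] at hc
    have hlt := (hF.step hc).lt
    refine ⟨?_, Or.inl ⟨?_, ?_⟩, hcol'⟩
    · simpa [hs3] using hB.abs_le (k := σ (par j)) (by omega)
    · simp [hs3, h24]
    · refine ⟨α, β, _, cs, par, _, ?_, ?_, ?_, ?_, ?_, hF.step hc⟩
      · rw [State.nat_setV, n30]; exact a30
      · rw [State.nat_setV, n31]; exact a31
      · exact c32
      · rw [State.nat_setV, n35]; exact a35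
      · simp [hs3]

theorem rowCmd_wp (h : Env I s) (hp : Pairs I v₀ s) (hB : Small I B) (hk : k < I.n)
    (h20 : s.var 20 = k) (hM : MatchedSt I v₀ k s) (hcol : ∀ i < I.n, |s.nat 32 i| ≤ B) :
    rowCmd.wp B (fun s' => MatchedSt I v₀ (k + 1) s' ∧ ∀ i < I.n, |s'.nat 32 i| ≤ B) s := by
  have hB0 : |(0 : ℤ)| ≤ B := by simpa using hB.abs_le (k := 0) (by omega)
  obtain ⟨α, β, σ, a30, a31, a32, hM⟩ := hM
  refine wp_seq (P := fun s' => ∀ i < I.n, s'.nat 33 i = tv (i = k))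
    (wp_fill (fun i => tv (i = k)) h.n ?_ (fun s' _ h1 _ => h1)) ?_
  · intro i _ s' hf hx _ _
    refine ⟨?_, hB.abs_tv _⟩
    have : s'.var 20 = k := by rw [hf.var 20 rfl, h20]
    simp [hx, this]
  intro s1 b33 hf1
  have h1 := h.frame hf1 rfl
  refine wp_seq (P := fun s' => ∀ i < I.n, s'.nat 34 i = 0)
    (wp_fill (fun _ => 0) h1.n (fun _ _ _ _ _ _ _ => ⟨rfl, hB0⟩) (fun s' _ h1 _ => h1)) ?_
  intro s2 b34 hf2
  have h2 := h1.frame hf2 rfl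
  refine ⟨hB0, ?_⟩
  rw [eval_lit]
  have h3 := h2.setV 24 0
  set s3 := s2.setV 24 0 with hs3
  have hp3 : Pairs I v₀ s3 := hp.congr (by rw [hs3, State.nat_setV, hf2.nat rfl, hf1.nat rfl])
    (by rw [hs3, State.nat_setV, hf2.nat rfl, hf1.nat rfl])
  have h203 : s3.var 20 = k := by simp [hs3, hf2.var 20 rfl, hf1.var 20 rfl, h20]
  have n30 : s3.nat 30 = s.nat 30 := by rw [hs3, State.nat_setV, hf2.nat rfl, hf1.nat rfl]
  have n31 : s3.nat 31 = s.nat 31 := by rw [hs3, State.nat_setV, hf2.nat rfl, hf1.nat rfl]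
  have n32 : s3.nat 32 = s.nat 32 := by rw [hs3, State.nat_setV, hf2.nat rfl, hf1.nat rfl]
  have n33 : s3.nat 33 = s1.nat 33 := by rw [hs3, State.nat_setV, hf2.nat rfl]
  refine wp_seq (P := fun s' => s'.var 24 = 1 ∧ FoundSt I v₀ k I.n s')
    (wp_forTo (fun t s' => (s'.var 24 = 0 ∧ SearchSt I v₀ k t s') ∨
      (s'.var 24 = 1 ∧ FoundSt I v₀ k I.n s')) h3.n ?_ ?_ ?_) ?_
  · left
    refine ⟨by simp [hs3], α, β, fun i => tv (i = k), σ, fun _ => 0, fun _ => 0, ?_, ?_, ?_, ?_, ?_,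
      ?_, Search.init hM (fun i _ => tv_pos) (fun _ _ => rfl)⟩
    · rw [n30]; exact a30
    · rw [n31]; exact a31
    · rw [n32]; exact a32
    · rw [n33]; exact b33
    · exact b34
    · intro j _ hj
      exact absurd hj (lt_irrefl _)
  · intro t ht s' hf hI
    constructor
    · intro hpos
      rcases hI with ⟨h24, -⟩ | ⟨h24, hF⟩
      · simp [h24] at hpos
      · exact Or.inr ⟨by simp [h24], hF⟩
    · intro hpos
      rcases hI with ⟨h24, hS⟩ | ⟨h24, -⟩
      · exact searchStep_wp ((h3.frame hf rfl).setV 22 t)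
          ((hp3.congr (hf.nat rfl) (hf.nat rfl)).congr rfl rfl) hB hk
          (by simp [hf.var 20 rfl, h203]) (by simp) (by simp [h24]) hS
      · simp [h24] at hpos
  · intro s' _ hI
    -- The search cannot still be running after `n` steps, by `Search.lt`.
    rcases hI with ⟨-, _, _, _, _, _, _, -, -, -, -, -, -, hS⟩ | hI
    · exact absurd (hS.lt hk) (lt_irrefl _)
    · exact hI
  intro s4 hF hf4
  have h4 := h3.frame hf4 rfl
  have h204 : s4.var 20 = k := by rw [hf4.var 20 rfl, h203]
  refine wp_forTo (fun t s' => ((s'.var 24 = 1 ∧ FoundSt I v₀ k (I.n - t) s') ∨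
      (s'.var 24 = 0 ∧ MatchedSt I v₀ (k + 1) s')) ∧ ∀ i < I.n, |s'.nat 32 i| ≤ B) h4.n
      ⟨Or.inl hF, ?_⟩ ?_ ?_
  · rw [hf4.nat rfl, n32]; exact hcol
  · rintro t ht s' hf ⟨hI, hc⟩
    constructor
    · intro hpos
      rcases hI with ⟨h24, hF'⟩ | ⟨h24, -⟩
      · have : I.n - t = I.n - (t + 1) + 1 := by omega
        rw [this] at hF'
        exact augStep_wp hB hk (by simp [hf.var 20 rfl, h204]) (by simp [h24]) hF' hc
      · simp [h24] at hpos
    · intro hpos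
      rcases hI with ⟨h24, -⟩ | ⟨h24, hM'⟩
      · simp [h24] at hpos
      · exact ⟨Or.inr ⟨by simp [h24], hM'⟩, hc⟩
  · rintro s' _ ⟨hI, hc⟩
    -- After `n` flips the length bound is 0, but the end of a path has a positive stamp.
    rcases hI with ⟨-, _, _, _, _, _, _, -, -, -, -, -, hF'⟩ | hI
    · have h5 := hF'.le
      have h6 := hF'.pos
      omega
    · exact ⟨hI.2, hc⟩

theorem hungCmd_wp (h : Env I s) (hp : Pairs I v₀ s) (hB : Small I B) :
    hungCmd.wp B (MatchedSt I v₀ I.n) s := by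
  have hB0 : |(0 : ℤ)| ≤ B := by simpa using hB.abs_le (k := 0) (by omega)
  refine wp_seq (P := fun s' => ∀ i < I.n, s'.nat 30 i = 0)
    (wp_fill (fun _ => 0) h.n (fun _ _ _ _ _ _ _ => ⟨rfl, hB0⟩) (fun s' _ h1 _ => h1)) ?_
  intro s1 b30 hf1
  have h1 := h.frame hf1 rfl
  refine wp_seq (P := fun s' => ∀ i < I.n, s'.nat 31 i = 0)
    (wp_fill (fun _ => 0) h1.n (fun _ _ _ _ _ _ _ => ⟨rfl, hB0⟩) (fun s' _ h1 _ => h1)) ?_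
  intro s2 b31 hf2
  have h2 := h1.frame hf2 rfl
  refine wp_seq (P := fun s' => ∀ i < I.n, s'.nat 32 i = I.n)
    (wp_fill (fun _ => I.n) h2.n (fun _ _ s' hf _ _ _ => ⟨(h2.frame hf rfl).n, hB.abs_le (by omega)⟩)
      (fun s' _ h1 _ => h1)) ?_
  intro s3 b32 hf3
  have h3 := h2.frame hf3 rfl
  have hp3 : Pairs I v₀ s3 := hp.congr (by rw [hf3.nat rfl, hf2.nat rfl, hf1.nat rfl])
    (by rw [hf3.nat rfl, hf2.nat rfl, hf1.nat rfl])
  refine wp_forTo (fun k s' => MatchedSt I v₀ k s' ∧ ∀ i < I.n, |s'.nat 32 i| ≤ B) h3.n ?_ ?_ ?_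
  · refine ⟨⟨fun _ => 0, fun _ => 0, fun _ => I.n, ?_, ?_, b32, ?_⟩, ?_⟩
    · rw [hf3.nat rfl, hf2.nat rfl]; exact b30
    · rw [hf3.nat rfl]; exact b31
    · refine ⟨fun i _ j _ => by simpa using arcCost_nonneg i j, by simp, by simp, by simp, by simp,
        by simp, by simp⟩
    · intro i hi
      rw [b32 i hi]
      exact hB.abs_le (by omega)
  · rintro k hk s' hf ⟨hM, hc⟩
    exact rowCmd_wp ((h3.frame hf rfl).setV 20 k) ((hp3.congr (hf.nat rfl) (hf.nat rfl)).congr rfl rfl)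
      hB hk (by simp) hM hc
  · intro s' _ hI
    exact hI.1

end Eval

end Aug

end RAM

/-! ### Colouring, selection of links and the loop over all thresholds -/

namespace RAM

namespace Aug

open X Cmd

section Color

variable {n : ℕ} {σ : ℕ → ℕ} {κ : ℕ → ℤ} {k : ℕ}

/-- The vertices below `k` are properly coloured. -/
structure PreColoring (n k : ℕ) (σ : ℕ → ℕ) (κ : ℕ → ℤ) : Prop where
  nonneg : ∀ u < k, 0 ≤ κ u
  lt : ∀ u < k, κ u < 3
  -- The value 3 marks uncoloured vertices and conflicts with none of the colours 0, 1, 2.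
  rest : ∀ u < n, k ≤ u → κ u = 3
  ne : ∀ u < k, σ u < k → σ u ≠ u → κ u ≠ κ (σ u)

/-- The least colour that is not used at a neighbour of `k`. -/
noncomputable def freeColor (n k : ℕ) (σ : ℕ → ℕ) (κ : ℕ → ℤ) : ℕ :=
  fnd 3 fun c => (c : ℤ) ≠ κ (σ k) ∧ ¬ ∃ i < n, σ i = k ∧ κ i = c

/-- By injectivity `k` has only one preimage, so at most two colours are forbidden: that of `σ k`
and that of the preimage. -/
theorem freeColor_lt (hinj : ∀ i < n, ∀ j < n, σ i = σ j → i = j) : freeColor n k σ κ < 3 := by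
  rw [freeColor, fnd_lt_iff]
  obtain ⟨a, ha⟩ : ∃ a : ℤ, ∀ i < n, σ i = k → κ i = a := by
    by_cases h : ∃ i < n, σ i = k
    · obtain ⟨i, hi, hk⟩ := h
      exact ⟨κ i, fun j hj hjk => by rw [hinj j hj i hi (hjk.trans hk.symm)]⟩
    · push Not at h
      exact ⟨0, fun i hi hk => absurd hk (h i hi)⟩
  have hex : ∃ c < 3, ((c : ℕ) : ℤ) ≠ κ (σ k) ∧ (c : ℤ) ≠ a := by
    by_contra! hcon
    have h0 := hcon 0 (by norm_num)
    have h1 := hcon 1 (by norm_num)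
    have h2 := hcon 2 (by norm_num)
    push_cast at h0 h1 h2
    omega
  obtain ⟨c, hc, h1, h2⟩ := hex
  exact ⟨c, hc, h1, fun ⟨i, hi, hik, hκ⟩ => h2 (hκ.symm.trans (ha i hi hik))⟩

theorem PreColoring.step (h : PreColoring n k σ κ) (hk : k < n)
    (hinj : ∀ i < n, ∀ j < n, σ i = σ j → i = j) :
    PreColoring n (k + 1) σ (Function.update κ k (freeColor n k σ κ : ℤ)) := by
  have hlt := freeColor_lt (k := k) (κ := κ) hinj
  obtain ⟨h1, h2⟩ := fnd_spec (show fnd 3 _ < 3 from hlt)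
  change ((freeColor n k σ κ : ℕ) : ℤ) ≠ _ at h1
  change ¬ ∃ i < n, σ i = k ∧ κ i = ((freeColor n k σ κ : ℕ) : ℤ) at h2
  refine ⟨?_, ?_, ?_, ?_⟩
  · intro u hu
    rw [Function.update_apply]
    split_ifs with huk
    · positivity
    · exact h.nonneg u (by omega)
  · intro u hu
    rw [Function.update_apply]
    split_ifs with huk
    · exact_mod_cast hlt
    · exact h.lt u (by omega)
  · intro u hu hku
    rw [Function.update_of_ne (by omega)]
    exact h.rest u hu (by omega)
  · intro u hu hσ hne
    rw [Function.update_apply, Function.update_apply]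
    split_ifs with h3 h4 h4
    · exact absurd (h4.trans h3.symm) hne
    · rw [h3]; exact h1
    · intro h5
      exact h2 ⟨u, by omega, h4, h5⟩
    · exact h.ne u (by omega) (by omega) hne

end Color

section Eval

variable {I : Inst} {s : State} {B : ℤ} {v₀ : ℕ}

theorem colorCmd_wp (h : Env I s) (hB : Small I B) {σ : ℕ → ℕ}
    (hσ : ∀ i < I.n, s.nat 32 i = σ i) (hlt : ∀ i < I.n, σ i < I.n)
    (hinj : ∀ i < I.n, ∀ j < I.n, σ i = σ j → i = j) :
    colorCmd.wp B (fun s' => I.Coloring σ (s'.nat 36)) s := by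
  refine wp_seq (P := fun s' => ∀ i < I.n, s'.nat 36 i = 3)
    (wp_fill (fun _ => 3) h.n
      (fun _ _ _ _ _ _ _ => ⟨rfl, by simpa using hB.abs_le (k := 3) (by omega)⟩)
      (fun s' _ h1 _ => h1)) ?_
  intro s1 b36 hf1
  have h1 := h.frame hf1 rfl
  refine wp_forTo (fun k s' => PreColoring I.n k σ (s'.nat 36)) h1.n ?_ ?_ ?_
  · exact ⟨by simp, by simp, fun u hu _ => b36 u hu, by simp⟩
  · intro k hk s' hf hI
    have h2 := (h1.frame hf rfl).setV 20 k
    have a32 : ∀ i < I.n, s'.arr 32 (i : ℕ) = σ i := by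
      intro i hi
      have := hσ i hi
      rwa [← hf1.nat rfl, ← hf.nat rfl] at this
    have heval : (find 50 5 (X.and (X.not (X.eq (.var 50) (get 36 (get 32 (.var 20)))))
        (X.not (ex 51 0 (X.and (X.eq (get 32 (.var 51)) (.var 20))
          (X.eq (get 36 (.var 51)) (.var 50))))))).eval (s'.setV 20 k) =
        freeColor I.n k σ (s'.nat 36) := by
      rw [eval_find, h2.toNat_three, freeColor]
      congr 1
      apply fnd_congr
      intro c _
      have h3 := h2.setV 50 c
      rw [eval_and, tv_pos, eval_not, tv_pos, eval_not, tv_pos, eval_ex, tv_pos, h3.toNat_n]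
      refine and_congr (by simp [a32 k hk, State.nat]) (not_congr (exists_congr fun i =>
        and_congr_right fun hi => ?_))
      simp [a32 i hi, State.nat]
    have hc := freeColor_lt (n := I.n) (k := k) (κ := s'.nat 36) hinj
    refine ⟨by rw [heval]; exact hB.abs_le (by omega), ?_⟩
    rw [heval]
    have e1 : (X.var 20).eval (s'.setV 20 k) = k := by simp
    rw [e1]
    change PreColoring _ _ _ (State.nat _ _)
    rw [State.nat_setA]
    exact hI.step hk hinj
  · intro s' _ hI
    exact ⟨hI.nonneg, hI.lt, fun u hu hne => hI.ne u hu (hlt u hu) hne⟩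

theorem selectCmd_wp (h : Env I s) (hp : Pairs I v₀ s) (hB : Small I B) {σ : ℕ → ℕ} {t : ℕ}
    (hσ : ∀ i < I.n, s.nat 32 i = σ i) (hlt : ∀ i < I.n, σ i < I.n) (ht : s.var 14 = t) :
    selectCmd.wp B (fun s' => ∀ l < I.m, s'.nat 37 l =
      tv (I.Sel (s.nat 23) (I.fstLink v₀) (I.sndLink v₀) σ (s.nat 36) t l)) s := by
  refine wp_fill (fun l => tv (I.Sel (s.nat 23) (I.fstLink v₀) (I.sndLink v₀) σ (s.nat 36) t l)) h.m
    ?_ (fun s' _ h1 _ => h1)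
  intro l hl s' hf hx _ _
  refine ⟨?_, hB.abs_tv _⟩
  have h1 := h.frame hf rfl
  have hp1 : Pairs I v₀ s' := hp.congr (hf.nat rfl) (hf.nat rfl)
  have a14 : s'.var 14 = t := by rw [hf.var 14 rfl, ht]
  have a23 : s'.arr 23 = s.arr 23 := hf.arr 23 rfl
  have a36 : s'.arr 36 = s.arr 36 := hf.arr 36 rfl
  have a32 : ∀ i < I.n, s'.arr 32 (i : ℕ) = σ i := by
    intro i hi
    have := hσ i hi
    rwa [← hf.nat rfl] at this
  rw [eval_or]
  apply tv_congr
  refine or_congr ?_ ?_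
  · rw [eval_or, tv_pos]
    simp only [eval_get, eval_add, eval_var, hx, h1.m, a23, State.nat]
    push_cast
    rfl
  · rw [eval_ex, tv_pos, h1.toNat_n]
    refine exists_congr fun u => and_congr_right fun hu => ?_
    have harc : arcX.eval (s'.setV 50 u) = ((u * I.n + σ u : ℕ) : ℤ) := by
      simp [arcX, h1.n, a32 u hu]
    have hidx := idx_lt hu (hlt u hu)
    have q27 : (get 27 arcX).eval (s'.setV 50 u) = I.fstLink v₀ u (σ u) := by
      have := hp1.fst _ hidx
      rw [row_idx (hlt u hu), col_idx (hlt u hu)] at this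
      rw [eval_get, harc]
      exact this
    have q28 : (get 28 arcX).eval (s'.setV 50 u) = I.sndLink v₀ u (σ u) := by
      have := hp1.snd _ hidx
      rw [row_idx (hlt u hu), col_idx (hlt u hu)] at this
      rw [eval_get, harc]
      exact this
    have qfix : 0 < fixX.eval (s'.setV 50 u) ↔ σ u = u := by
      simp [fixX, a32 u hu]
    have qoff : 0 < offX.eval (s'.setV 50 u) ↔ s.nat 36 u = t := by
      simp [offX, a14, a36, State.nat]
    have q20 : (X.var 20).eval (s'.setV 50 u) = l := by simp [hx]
    simp only [eval_or, eval_and, eval_not, eval_eq, tv_pos, qfix, qoff, q27, q28, q20,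
      Nat.cast_inj, ne_eq]

/-- The memory holds a set of links that covers the tree, and its cost. -/
def Kept (I : Inst) (s : State) : Prop :=
  ∃ F : ℕ → Prop, (∀ l < I.m, s.nat 7 l = tv (F l)) ∧
    (∀ v < I.n, v ≠ I.r → ∃ l < I.m, F l ∧ I.cov v l) ∧
    s.var 12 = ∑ l ∈ Finset.range I.m, tv (F l) * I.C l

theorem Small.abs_cost_le (hB : Small I B) (F : ℕ → Prop) :
    |∑ l ∈ Finset.range I.m, tv (F l) * I.C l| ≤ B := by
  rw [abs_of_nonneg (Finset.sum_nonneg fun l _ => mul_nonneg (tv_nonneg _) (I.C_nonneg l))]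
  have h1 : ∑ l ∈ Finset.range I.m, tv (F l) * I.C l ≤ ∑ l ∈ Finset.range I.m, I.C l :=
    Finset.sum_le_sum fun l _ => by
      have := I.C_nonneg l
      nlinarith [tv_le_one (F l)]
  have h2 : 0 ≤ ∑ l ∈ Finset.range I.m, I.C l := Finset.sum_nonneg fun l _ => I.C_nonneg l
  have := hB.cost
  linarith

theorem Kept.congr {s' : State} (h : Kept I s) (h7 : s'.nat 7 = s.nat 7)
    (h12 : s'.var 12 = s.var 12) : Kept I s' := by
  obtain ⟨F, h1, h2, h3⟩ := h
  exact ⟨F, by rwa [h7], h2, by rwa [h12]⟩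

theorem keepCmd_wp (h : Env I s) (hB : Small I B) (hk : Kept I s) {F : ℕ → Prop}
    (hF : ∀ l < I.m, s.nat 37 l = tv (F l))
    (hcov : ∀ v < I.n, v ≠ I.r → ∃ l < I.m, F l ∧ I.cov v l) :
    keepCmd.wp B (fun s' => Kept I s' ∧ s'.var 12 ≤ s.var 12 ∧
      s'.var 12 ≤ ∑ l ∈ Finset.range I.m, tv (F l) * I.C l) s := by
  set K := ∑ l ∈ Finset.range I.m, tv (F l) * I.C l with hK
  have heval : (X.sum 50 1 (mul (lt (lit 0) (get 37 (.var 50))) (get 11 (.var 50)))).eval s = K := by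
    rw [eval_sum, h.toNat_m]
    apply Finset.sum_congr rfl
    intro l hl
    rw [Finset.mem_range] at hl
    have h1 := hF l hl
    simp only [State.nat] at h1
    simp [h1, h.C]
  refine ⟨by rw [heval]; exact hB.abs_cost_le F, ?_⟩
  rw [heval]
  have hcond : 0 < (lt (.var 31) (.var 12)).eval (s.setV 31 K) ↔ K < s.var 12 := by simp
  constructor
  · intro hlt
    rw [hcond] at hlt
    have e : (X.var 31).eval (s.setV 31 K) = K := by simp
    refine ⟨by rw [e]; exact hB.abs_cost_le F, ?_⟩
    rw [e]
    have h2 := (h.setV 31 K).setV 12 K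
    refine wp_fill (fun l => tv (F l)) h2.m ?_ ?_
    · intro l hl s' hf hx _ _
      refine ⟨?_, hB.abs_tv _⟩
      have h1 := hF l hl
      simp only [State.nat] at h1
      simp only [eval_get, eval_var, hx, hf.arr 37 rfl, State.setV_arr, h1]
    · intro s' hf h3 _
      have h12 : s'.var 12 = K := by rw [hf.var 12 rfl]; simp
      exact ⟨⟨F, h3, hcov, h12⟩, by rw [h12]; exact hlt.le, h12.le⟩
  · intro hlt
    rw [hcond] at hlt
    refine ⟨hk.congr rfl (by simp), by simp, ?_⟩
    simpa using not_lt.1 hlt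

theorem candCmd_wp (h : Env I s) (hB : Small I B) (hv0 : s.var 13 = v₀) (hv : v₀ < I.n)
    (hk : Kept I s) : candCmd.wp B (fun s' => Kept I s' ∧ s'.var 12 ≤ s.var 12 ∧
      I.Bound v₀ (s'.var 12)) s := by
  refine wp_seq (upCmd_wp h hB hv0 hv) fun s1 hup hf1 => ?_
  obtain ⟨y, hup⟩ := hup
  have h1 := h.frame hf1 rfl
  refine wp_seq (prepCmd_wp (v₀ := v₀) h1 hB (by rw [hf1.var 13 rfl, hv0]) hv) fun s2 hp hf2 => ?_
  have h2 := h1.frame hf2 rfl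
  refine wp_seq (hungCmd_wp h2 hp hB) fun s3 hm hf3 => ?_
  obtain ⟨α, β, σ, -, -, hσ, hm⟩ := hm
  have h3 := h2.frame hf3 rfl
  refine wp_seq (colorCmd_wp h3 hB hσ hm.lt hm.inj) fun s4 hκ hf4 => ?_
  have h4 := h3.frame hf4 rfl
  have hup4 : I.UpOut v₀ y (s4.nat 23) := by
    rwa [hf4.nat rfl, hf3.nat rfl, hf2.nat rfl]
  have hp4 : Pairs I v₀ s4 := (hp.congr (hf3.nat rfl) (hf3.nat rfl)).congr (hf4.nat rfl) (hf4.nat rfl)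
  have hσ4 : ∀ i < I.n, s4.nat 32 i = σ i := by rwa [hf4.nat rfl]
  have v12 : s4.var 12 = s.var 12 := by
    rw [hf4.var 12 rfl, hf3.var 12 rfl, hf2.var 12 rfl, hf1.var 12 rfl]
  have hk4 : Kept I s4 := hk.congr
    (by rw [hf4.nat rfl, hf3.nat rfl, hf2.nat rfl, hf1.nat rfl]) v12
  refine wp_forTo (fun t s' => Kept I s' ∧ s'.var 12 ≤ s.var 12 ∧ ∀ j < t, s'.var 12 ≤
    ∑ l ∈ Finset.range I.m, tv (I.Sel (s4.nat 23) (I.fstLink v₀) (I.sndLink v₀) σ (s4.nat 36) j l)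
      * I.C l) h4.three ⟨hk4, v12.le, by simp⟩ ?_ ?_
  · rintro t ht s' hf ⟨hk', hle, hall⟩
    have h5 := (h4.frame hf rfl).setV 14 t
    have n23 : (s'.setV 14 t).nat 23 = s4.nat 23 := by rw [State.nat_setV, hf.nat rfl]
    have n36 : (s'.setV 14 t).nat 36 = s4.nat 36 := by rw [State.nat_setV, hf.nat rfl]
    have hsel := selectCmd_wp (v₀ := v₀) (s := s'.setV 14 t) (t := t) h5
      ((hp4.congr (hf.nat rfl) (hf.nat rfl)).congr rfl rfl) hB
      (σ := σ) (by rw [State.nat_setV, hf.nat rfl]; exact hσ4) hm.lt (by simp)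
    rw [n23, n36] at hsel
    refine wp_seq hsel fun s6 hF hf6 => ?_
    have h6 := h5.frame hf6 rfl
    have w12 : s6.var 12 = s'.var 12 := by rw [hf6.var 12 rfl]; simp
    refine wp_mono ?_ (keepCmd_wp h6 hB (hk'.congr (by rw [hf6.nat rfl]; rfl) w12) hF
      (fun v hv hr => Inst.Sel.covers hup4 (I.pairOut v₀) hm hκ t hv hr))
    rintro s7 ⟨k1, k2, k3⟩
    rw [w12] at k2
    refine ⟨k1, k2.trans hle, fun j hj => ?_⟩
    rcases Nat.lt_succ_iff_lt_or_eq.1 hj with hj | rfl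
    · exact k2.trans (hall j hj)
    · exact k3
  · rintro s' _ ⟨hk', hle, hall⟩
    exact ⟨hk', hle, Inst.Sel.bound hup4 (I.pairOut v₀) hm hκ hall⟩

theorem initCmd_wp (h : Env I s) (hB : Small I B) : initCmd.wp B (Kept I) s := by
  have heval : (X.sum 50 1 (get 11 (.var 50))).eval s =
      ∑ l ∈ Finset.range I.m, tv True * I.C l := by
    rw [eval_sum, h.toNat_m]
    apply Finset.sum_congr rfl
    intro l _
    simp [h.C, tv_true]
  refine ⟨by rw [heval]; exact hB.abs_cost_le fun _ => True, ?_⟩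
  rw [heval]
  refine wp_fill (fun _ => 1) (h.setV 12 _).m
    (fun _ _ _ _ _ _ _ => ⟨rfl, by simpa using hB.abs_le (k := 1) (by omega)⟩) ?_
  intro s' hf h1 _
  refine ⟨fun _ => True, fun l hl => (h1 l hl).trans (tv_true trivial).symm, ?_, ?_⟩
  · intro v hv hr
    obtain ⟨l, hl, hc⟩ := I.covered v hv hr
    exact ⟨l, hl, trivial, hc⟩
  · rw [hf.var 12 rfl]; simp

/-- Every vertex is tried as threshold vertex, so the final cost satisfies the bounds for all
thresholds at once. The analysis may pick the one that fits λ. -/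
theorem roundCmd_wp (h : Env I s) (hB : Small I B) :
    roundCmd.wp B (fun s' => Kept I s' ∧ ∀ v < I.n, I.Bound v (s'.var 12)) s := by
  refine wp_seq (initCmd_wp h hB) fun s1 hk hf1 => ?_
  have h1 := h.frame hf1 rfl
  refine wp_forTo (fun k s' => Kept I s' ∧ ∀ v < k, I.Bound v (s'.var 12)) h1.n ⟨hk, by simp⟩ ?_
    (fun s' _ hI => hI)
  rintro k hk s' hf ⟨hkept, hall⟩
  refine wp_mono ?_ (candCmd_wp ((h1.frame hf rfl).setV 13 k) hB (by simp) hk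
    (hkept.congr rfl (by simp)))
  rintro s2 ⟨h2, h3, h4⟩
  refine ⟨h2, fun v hv => ?_⟩
  rcases Nat.lt_succ_iff_lt_or_eq.1 hv with hv | rfl
  · exact (hall v hv).mono (by simpa using h3)
  · exact h4

end Eval

end Aug

end RAM

/-! ### Paths in trees, domination and its relation to path edges -/

namespace SimpleGraph

variable {V : Type*} {T : SimpleGraph V}

section Walk

variable [DecidableEq V]

theorem Walk.IsPath.eq_of_mem_takeUntil_of_mem_dropUntil {u v w x : V} {p : T.Walk u v}
    (hp : p.IsPath) (hw : w ∈ p.support) (h1 : x ∈ (p.takeUntil w hw).support)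
    (h2 : x ∈ (p.dropUntil w hw).support) : x = w := by
  have hn := hp.support_nodup
  rw [← p.take_spec hw, Walk.support_append] at hn
  rw [← Walk.cons_tail_support (p.dropUntil w hw), List.mem_cons] at h2
  rcases h2 with h2 | h2
  · exact h2
  · exact absurd h2 (List.disjoint_of_nodup_append hn h1)

end Walk

theorem IsTree.mem_support_of_isPath (hT : T.IsTree) {u v x : V} {p : T.Walk u v} (hp : p.IsPath)
    (hx : x ∈ p.support) (q : T.Walk u v) : x ∈ q.support := by
  classical
  have : p = q.bypass := (hT.existsUnique_path u v).unique hp q.bypass_isPath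
  rw [this] at hx
  exact q.support_bypass_subset_support hx

theorem IsTree.mem_pathEdges_iff (hT : T.IsTree) {u v : V} {e : Sym2 V} :
    e ∈ pathEdges T u v ↔ ∀ q : T.Walk u v, e ∈ q.edges := by
  classical
  constructor
  · rintro ⟨p, hp, he⟩ q
    have : p = q.bypass := (hT.existsUnique_path u v).unique hp q.bypass_isPath
    rw [this] at he
    exact q.edges_bypass_subset_edges he
  · intro h
    obtain ⟨p, hp, -⟩ := hT.existsUnique_path u v
    exact ⟨p, hp, h p⟩

/-! ### Domination with respect to a root -/

/-- Every walk from the root to `u` meets `v`. -/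
def Dom (T : SimpleGraph V) (r v u : V) : Prop := ∀ p : T.Walk r u, v ∈ p.support

variable {r : V}

theorem Dom.refl (v : V) : T.Dom r v v := fun p => p.end_mem_support

theorem Dom.root (v : V) : T.Dom r r v := fun p => p.start_mem_support

theorem Dom.trans {u v w : V} (h1 : T.Dom r u v) (h2 : T.Dom r v w) : T.Dom r u w := by
  classical
  intro p
  exact p.support_takeUntil_subset_support (h2 p) (h1 (p.takeUntil v (h2 p)))

theorem Dom.antisymm (hT : T.IsTree) {u v : V} (h1 : T.Dom r u v) (h2 : T.Dom r v u) : u = v := by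
  classical
  by_contra hne
  obtain ⟨p, hp, -⟩ := hT.existsUnique_path r v
  exact Walk.endpoint_notMem_support_takeUntil hp (h1 p) (Ne.symm hne) (h2 _)

/-- Suppose a walk to `v` avoids `u` and a walk to `u` avoids `v`. Continuing the first along the
path from `v` to `w`, `u` must occur on that path; continuing the second from there, `v` must occur
after `u`. But a path visits its start `v` only once. -/
theorem Dom.chain (hT : T.IsTree) {u v w : V} (h1 : T.Dom r u w) (h2 : T.Dom r v w) :
    T.Dom r u v ∨ T.Dom r v u := by
  classical
  by_contra! hcon
  obtain ⟨hu, hv⟩ := hcon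
  simp only [Dom, not_forall] at hu hv
  obtain ⟨q1, hq1⟩ := hu
  obtain ⟨q2, hq2⟩ := hv
  obtain ⟨d, hd, -⟩ := hT.existsUnique_path v w
  have hud : u ∈ d.support := by
    have := h1 (q1.append d)
    rw [Walk.mem_support_append_iff] at this
    exact this.resolve_left hq1
  have hvd : v ∈ (d.dropUntil u hud).support := by
    have := h2 (q2.append (d.dropUntil u hud))
    rw [Walk.mem_support_append_iff] at this
    exact this.resolve_left hq2
  have := hd.eq_of_mem_takeUntil_of_mem_dropUntil hud (Walk.start_mem_support _) hvd
  subst this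
  exact hq1 q1.end_mem_support

/-- The path from the root to `a` either passes through `b` or can be prolonged to `b`. -/
theorem Dom.of_adj (hT : T.IsTree) {a b : V} (h : T.Adj a b) : T.Dom r a b ∨ T.Dom r b a := by
  obtain ⟨p, hp, -⟩ := hT.existsUnique_path r a
  by_cases hb : b ∈ p.support
  · exact Or.inr (hT.mem_support_of_isPath hp hb)
  · refine Or.inl (hT.mem_support_of_isPath (hp.concat hb h) ?_)
    simp

theorem exists_adj_dom (hT : T.IsTree) {v : V} (hv : v ≠ r) : ∃ a, T.Adj a v ∧ T.Dom r a v := by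
  obtain ⟨p, hp, -⟩ := hT.existsUnique_path r v
  refine ⟨p.penultimate, p.adj_penultimate (Walk.not_nil_of_ne hv.symm),
    hT.mem_support_of_isPath hp ?_⟩
  exact p.getVert_mem_support _

theorem exists_child (hT : T.IsTree) {v : V} (hv : v ≠ r) : ∃ c, T.Adj r c ∧ T.Dom r c v := by
  obtain ⟨p, hp, -⟩ := hT.existsUnique_path r v
  refine ⟨p.snd, p.adj_snd (Walk.not_nil_of_ne hv.symm), hT.mem_support_of_isPath hp ?_⟩
  exact p.getVert_mem_support _

/-- The edges of a path, in terms of domination. -/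
theorem Dom.mem_pathEdges_iff (hT : T.IsTree) {a b : V} (hab : T.Adj a b) (hd : T.Dom r a b)
    (x y : V) : s(a, b) ∈ pathEdges T x y ↔ ¬(T.Dom r b x ↔ T.Dom r b y) := by
  classical
  have hne : a ≠ b := hab.ne
  -- `R` is connectedness after deletion of the edge `{a, b}`. The vertices dominated by `b` form
  -- the component of `b`, all others that of the root.
  set R : V → V → Prop := fun x y => ∃ q : T.Walk x y, s(a, b) ∉ q.edges with hR
  have hsymm : ∀ {x y}, R x y → R y x := fun ⟨q, hq⟩ => ⟨q.reverse, by simpa using hq⟩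
  have htrans : ∀ {x y z}, R x y → R y z → R x z := fun ⟨q, hq⟩ ⟨q', hq'⟩ =>
    ⟨q.append q', by simp [hq, hq']⟩
  have hbad : ¬ T.Dom r b a := fun h => hne (Dom.antisymm hT hd h)
  have hroot : ∀ x, ¬ T.Dom r b x → R r x := by
    intro x h
    simp only [Dom, not_forall] at h
    obtain ⟨q, hq⟩ := h
    exact ⟨q, fun he => hq (q.snd_mem_support_of_mem_edges he)⟩
  have hedge : ∀ q : T.Walk r b, s(a, b) ∈ q.edges := by
    obtain ⟨p, hp, -⟩ := hT.existsUnique_path r a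
    have hb : b ∉ p.support := fun h => hbad (hT.mem_support_of_isPath hp h)
    refine hT.mem_pathEdges_iff.1 ⟨p.concat hab, hp.concat hb hab, ?_⟩
    simp [Walk.edges_concat]
  have hdown : ∀ x, T.Dom r b x → R b x := by
    intro x h
    obtain ⟨p, hp, -⟩ := hT.existsUnique_path r x
    refine ⟨p.dropUntil b (h p), fun he => hne ?_⟩
    exact hp.eq_of_mem_takeUntil_of_mem_dropUntil (h p) (hd _) (Walk.fst_mem_support_of_mem_edges _ he)
  have hsep : ∀ x, T.Dom r b x → ¬ R r x := by
    intro x h hrx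
    obtain ⟨q, hq⟩ := htrans hrx (hsymm (hdown x h))
    exact hq (hedge q)
  have hRiff : s(a, b) ∈ pathEdges T x y ↔ ¬ R x y := by
    rw [hT.mem_pathEdges_iff]
    simp [hR]
  rw [hRiff]
  apply not_congr
  by_cases hx : T.Dom r b x <;> by_cases hy : T.Dom r b y
  · simp only [hx, hy, iff_true]
    exact htrans (hsymm (hdown x hx)) (hdown y hy)
  · simp only [hx, hy, iff_false, not_true]
    exact fun h => hsep x hx (htrans (hroot y hy) (hsymm h))
  · simp only [hx, hy, iff_true]
    exact ⟨fun h => (hsep y hy (htrans (hroot x hx) h)).elim, fun h => h.elim⟩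
  · simp only [hx, hy, iff_true]
    exact htrans (hsymm (hroot x hx)) (hroot y hy)

/-- Let `c` be the child of the root above `x`. If `c` is not above `y`, every walk from `x` to `y`
uses the edge from the root to `c` and so meets the root. Conversely, the root paths to `x` and `y`
avoid the root from a common dominator `v ≠ r` on. -/
theorem reachable_induce_iff (hT : T.IsTree) {x y : V} (hx : x ≠ r) (hy : y ≠ r) :
    (T.induce {w | w ≠ r}).Reachable ⟨x, hx⟩ ⟨y, hy⟩ ↔
      ∃ v, v ≠ r ∧ T.Dom r v x ∧ T.Dom r v y := by
  classical
  constructor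
  · rintro ⟨q⟩
    obtain ⟨c, hc, hcx⟩ := exists_child hT hx
    refine ⟨c, hc.ne', hcx, ?_⟩
    by_contra hcy
    have hmem := (Dom.mem_pathEdges_iff hT hc (Dom.root c) x y).2 (by tauto)
    have h1 := hT.mem_pathEdges_iff.1 hmem (q.map (Embedding.induce _).toHom)
    have h2 := Walk.fst_mem_support_of_mem_edges _ h1
    obtain ⟨w, -, hw⟩ := List.mem_map.1
      ((congrArg (r ∈ ·) (Walk.support_map (Embedding.induce {w | w ≠ r}).toHom q)).mp h2)
    exact w.2 hw
  · rintro ⟨v, hv, hvx, hvy⟩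
    have key : ∀ z (hz : z ≠ r), T.Dom r v z →
        (T.induce {w | w ≠ r}).Reachable ⟨v, hv⟩ ⟨z, hz⟩ := by
      intro z hz hvz
      obtain ⟨p, hp, -⟩ := hT.existsUnique_path r z
      refine ⟨(p.dropUntil v (hvz p)).induce {w | w ≠ r} fun w hw hwr => ?_⟩
      subst hwr
      exact hv (hp.eq_of_mem_takeUntil_of_mem_dropUntil (hvz p) (Walk.start_mem_support _) hw).symm
    exact (key x hx hvx).symm.trans (key y hy hvy)

end SimpleGraph

/-! ### From rooted trees with links to combinatorial instances -/

namespace RootedPair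

open SimpleGraph

variable {n m : ℕ} (P : RootedPair n m)

/-- Extension of a function on links by a default value. -/
def extend {α : Type*} (f : Fin m → α) (a : α) (l : ℕ) : α := if h : l < m then f ⟨l, h⟩ else a

theorem extend_of_lt {α : Type*} (f : Fin m → α) (a : α) {l : ℕ} (h : l < m) :
    extend f a l = f ⟨l, h⟩ := dif_pos h

theorem extend_val {α : Type*} (f : Fin m → α) (a : α) (l : Fin m) : extend f a l = f l :=
  dif_pos l.2

/-- Domination on natural numbers. -/
def dom (v u : ℕ) : Prop := ∃ (hv : v < n) (hu : u < n), P.tree.Dom P.root ⟨v, hv⟩ ⟨u, hu⟩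

theorem dom_val (v u : Fin n) : P.dom v u ↔ P.tree.Dom P.root v u :=
  ⟨fun ⟨_, _, h⟩ => h, fun h => ⟨v.2, u.2, h⟩⟩

/-- This is the edge to the parent of `v`; `exists_vertex` conversely assigns to an edge its lower
end. -/
theorem exists_edge {v : Fin n} (hv : v ≠ P.root) : ∃ e ∈ P.tree.edgeSet, ∀ ℓ,
    (e ∈ pathEdges P.tree (P.src ℓ) (P.tgt ℓ) ↔ ¬(P.dom v (P.src ℓ) ↔ P.dom v (P.tgt ℓ))) := by
  obtain ⟨a, ha, hd⟩ := exists_adj_dom P.isTree hv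
  refine ⟨s(a, v), ha, fun ℓ => ?_⟩
  rw [dom_val, dom_val]
  exact Dom.mem_pathEdges_iff P.isTree ha hd _ _

theorem exists_vertex {e : Sym2 (Fin n)} (he : e ∈ P.tree.edgeSet) : ∃ v, v ≠ P.root ∧ ∀ ℓ,
    (e ∈ pathEdges P.tree (P.src ℓ) (P.tgt ℓ) ↔ ¬(P.dom v (P.src ℓ) ↔ P.dom v (P.tgt ℓ))) := by
  induction e with
  | _ a b =>
    have hab : P.tree.Adj a b := he
    simp only [dom_val]
    rcases Dom.of_adj (r := P.root) P.isTree hab with h | h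
    · refine ⟨b, ?_, fun ℓ => Dom.mem_pathEdges_iff P.isTree hab h _ _⟩
      rintro rfl
      exact hab.ne (Dom.antisymm P.isTree h (Dom.root a))
    · refine ⟨a, ?_, fun ℓ => ?_⟩
      · rintro rfl
        exact hab.ne' (Dom.antisymm P.isTree h (Dom.root b))
      · rw [Sym2.eq_swap]
        exact Dom.mem_pathEdges_iff P.isTree hab.symm h _ _

/-- The instance with integral costs and values. -/
def inst (C Z : Fin m → ℤ) (hC : ∀ ℓ, 0 ≤ C ℓ) (hZ : ∀ ℓ, 0 ≤ Z ℓ) : RAM.Aug.Inst where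
  n := n
  m := m
  r := P.root
  src := extend (fun ℓ => (P.src ℓ : ℕ)) 0
  tgt := extend (fun ℓ => (P.tgt ℓ : ℕ)) 0
  C := extend C 0
  Z := extend Z 0
  dom := P.dom
  src_lt l hl := by rw [extend_of_lt _ _ hl]; exact (P.src _).2
  tgt_lt l hl := by rw [extend_of_lt _ _ hl]; exact (P.tgt _).2
  C_nonneg l := by unfold extend; split_ifs <;> simp [hC]
  Z_nonneg l := by unfold extend; split_ifs <;> simp [hZ]
  C_of_le l hl := dif_neg (by omega)
  dom_refl v hv := ⟨hv, hv, Dom.refl _⟩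
  dom_trans := fun ⟨hu, _, h1⟩ ⟨_, hw, h2⟩ => ⟨hu, hw, h1.trans h2⟩
  dom_antisymm := fun ⟨_, _, h1⟩ ⟨_, _, h2⟩ => Fin.mk.inj_iff.1 (Dom.antisymm P.isTree h1 h2)
  dom_chain := fun ⟨hu, _, h1⟩ ⟨hv, _, h2⟩ =>
    (Dom.chain P.isTree h1 h2).imp (fun h => ⟨hu, hv, h⟩) fun h => ⟨hv, hu, h⟩
  dom_root v hv := ⟨P.root.2, hv, Dom.root _⟩
  covered v hv hr := by
    obtain ⟨e, he, h⟩ := P.exists_edge (v := ⟨v, hv⟩) (fun h => hr (congrArg Fin.val h))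
    by_contra! hcon
    have h1 := P.feasible e he
    rw [Finset.sum_eq_zero] at h1
    · norm_num at h1
    · intro ℓ _
      rw [Set.indicator_of_notMem]
      intro hmem
      have h2 := hcon ℓ ℓ.2
      rw [extend_val, extend_val] at h2
      exact (h ℓ).1 hmem h2

variable {C Z : Fin m → ℤ} {hC : ∀ ℓ, 0 ≤ C ℓ} {hZ : ∀ ℓ, 0 ≤ Z ℓ}

theorem inst_cov (v : ℕ) (ℓ : Fin m) : (P.inst C Z hC hZ).cov v ℓ ↔
    ¬(P.dom v (P.src ℓ) ↔ P.dom v (P.tgt ℓ)) := by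
  simp only [RAM.Aug.Inst.cov, inst, extend_val]

theorem inst_cross (ℓ : Fin m) : (P.inst C Z hC hZ).cross ℓ ↔ P.IsCross ℓ := by
  simp only [RAM.Aug.Inst.cross, inst, extend_val, IsCross, ne_eq, Fin.val_inj]
  constructor
  · rintro ⟨h1, h2, h3⟩
    refine ⟨h1, h2, ?_⟩
    rw [reachable_induce_iff P.isTree h1 h2]
    rintro ⟨v, hv, hvx, hvy⟩
    refine (h3 v v.2).elim (fun h => hv (Fin.val_inj.1 h)) fun h => h ?_
    rw [dom_val, dom_val]
    exact ⟨hvx, hvy⟩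
  · rintro ⟨h1, h2, h3⟩
    refine ⟨h1, h2, fun v hv => ?_⟩
    by_contra! hcon
    obtain ⟨hvr, hvx, hvy⟩ := hcon
    refine h3 ((reachable_induce_iff P.isTree h1 h2).2 ⟨⟨v, hv⟩, ?_, ?_, ?_⟩)
    · rintro h
      exact hvr (congrArg Fin.val h)
    · exact (P.dom_val ⟨v, hv⟩ _).1 hvx
    · exact (P.dom_val ⟨v, hv⟩ _).1 hvy

end RootedPair

/-! ### Verification of the computation of derived data -/

namespace RAM

namespace Aug

open X Cmd

/-- The memory holds the sizes and the endpoints of the links. -/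
structure Pre (I : Inst) (s : State) : Prop where
  n : s.var 0 = I.n
  m : s.var 1 = I.m
  r : s.var 2 = I.r
  nn : s.var 3 = ((I.n * I.n : ℕ) : ℤ)
  mm : s.var 4 = ((2 * I.m : ℕ) : ℤ)
  three : s.var 5 = ((3 : ℕ) : ℤ)
  src : ∀ l < I.m, s.arr 1 (l : ℕ) = I.src l
  tgt : ∀ l < I.m, s.arr 2 (l : ℕ) = I.tgt l

def keepsPre (c : Cmd) : Bool :=
  [0, 1, 2, 3, 4, 5].all (fun x => c.keepsV x) && [1, 2].all fun a => c.keepsA a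

theorem Pre.congr {I : Inst} {s s' : State} (h : Pre I s)
    (hv : ∀ x ∈ [0, 1, 2, 3, 4, 5], s'.var x = s.var x)
    (ha : ∀ a ∈ [1, 2], s'.arr a = s.arr a) : Pre I s' := by
  simp only [List.mem_cons, List.not_mem_nil, or_false, forall_eq_or_imp, forall_eq] at hv ha
  obtain ⟨v0, v1, v2, v3, v4, v5⟩ := hv
  constructor
  · rw [v0, h.n]
  · rw [v1, h.m]
  · rw [v2, h.r]
  · rw [v3, h.nn]
  · rw [v4, h.mm]
  · rw [v5, h.three]
  · rw [ha.1]; exact h.src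
  · rw [ha.2]; exact h.tgt

theorem Pre.frame {I : Inst} {s s' : State} {c : Cmd} (h : Pre I s) (hf : Frame c s s')
    (hk : keepsPre c = true) : Pre I s' := by
  simp only [keepsPre, Bool.and_eq_true, List.all_eq_true] at hk
  exact h.congr (fun x hx => hf.var x (hk.1 x hx)) (fun a ha => hf.arr a (hk.2 a ha))

theorem Pre.setV {I : Inst} {s : State} (h : Pre I s) (x : ℕ) (v : ℤ) (hx : 10 ≤ x := by norm_num) :
    Pre I (s.setV x v) := by
  refine h.congr (fun y hy => ?_) (fun _ _ => rfl)
  have : y ≤ 5 := by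
    simp only [List.mem_cons, List.not_mem_nil, or_false] at hy
    omega
  rw [State.setV_var, if_neg (by omega)]

section Eval

variable {I : Inst} {s : State} {B : ℤ}

theorem Pre.toNat_n (h : Pre I s) : (s.var 0).toNat = I.n := by simp [h.n]
theorem Pre.toNat_m (h : Pre I s) : (s.var 1).toNat = I.m := by simp [h.m]

theorem Pre.eval_domX (h : Pre I s)
    (hd : ∀ v < I.n, ∀ u < I.n, s.arr 10 ((v : ℤ) * I.n + u) = tv (I.dom v u)) {v u : X} {a b : ℕ}
    (hv : v.eval s = a) (hu : u.eval s = b) (ha : a < I.n) (hb : b < I.n) :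
    (domX v u).eval s = tv (I.dom a b) := by
  simp only [domX, eval_get, eval_add, eval_mul, eval_var, hv, hu, h.n]
  exact hd a ha b hb

theorem Pre.eval_rowX (h : Pre I s) {k : X} {a : ℕ} (hk : k.eval s = a) :
    (rowX k).eval s = ((a / I.n : ℕ) : ℤ) := by
  simp [rowX, hk, h.n]

theorem Pre.eval_colX (h : Pre I s) {k : X} {a : ℕ} (hk : k.eval s = a) :
    (colX k).eval s = ((a % I.n : ℕ) : ℤ) := by
  simp only [colX, eval_sub, eval_mul, eval_div, eval_var, hk, h.n]
  push_cast
  rw [← Int.emod_def]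

theorem crossCmd_wp (h : Pre I s) (hB : Small I B)
    (hd : ∀ v < I.n, ∀ u < I.n, s.arr 10 ((v : ℤ) * I.n + u) = tv (I.dom v u)) :
    crossCmd.wp B (fun s' => ∀ l < I.m, s'.arr 13 (l : ℕ) = tv (I.cross l)) s := by
  refine wp_fill (fun l => tv (I.cross l)) h.m ?_ (fun s' _ h1 _ => h1)
  intro l hl s' hf hx _ _
  refine ⟨?_, hB.abs_tv _⟩
  have h' := h.frame hf rfl
  have hd' : ∀ v < I.n, ∀ u < I.n, s'.arr 10 ((v : ℤ) * I.n + u) = tv (I.dom v u) := by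
    rw [hf.arr 10 rfl]; exact hd
  have e1 : (get 1 (.var 20)).eval s' = I.src l := by
    rw [eval_get, eval_var, hx]; exact h'.src l hl
  have e2 : (get 2 (.var 20)).eval s' = I.tgt l := by
    rw [eval_get, eval_var, hx]; exact h'.tgt l hl
  rw [eval_and]
  apply tv_congr
  rw [eval_and, tv_pos, eval_not, tv_pos, eval_not, tv_pos, eval_eq, tv_pos, eval_eq, tv_pos, e1, e2,
    eval_var, h'.r, eval_all, tv_pos, h'.toNat_n]
  refine and_congr (by simp) (and_congr (by simp) (forall₂_congr fun v hv => ?_))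
  have h3 := h'.setV 50 v
  have e3 : (get 1 (.var 20)).eval (s'.setV 50 v) = I.src l := by simpa using e1
  have e4 : (get 2 (.var 20)).eval (s'.setV 50 v) = I.tgt l := by simpa using e2
  rw [eval_or, tv_pos, eval_not, tv_pos, eval_and, tv_pos,
    h3.eval_domX hd' (a := v) (by simp) e3 hv (I.src_lt l hl),
    h3.eval_domX hd' (a := v) (by simp) e4 hv (I.tgt_lt l hl)]
  simp [h'.r]

theorem zcCmd_wp (h : Pre I s) (hd : ∀ v < I.n, ∀ u < I.n, s.arr 10 ((v : ℤ) * I.n + u) = tv (I.dom v u))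
    (hZ : ∀ l < I.m, s.arr 12 (l : ℕ) = I.Z l) (hc : ∀ l < I.m, s.arr 13 (l : ℕ) = tv (I.cross l))
    (hB : ∑ l ∈ Finset.range I.m, I.Z l ≤ B) :
    zcCmd.wp B (fun s' => ∀ v < I.n, s'.arr 14 (v : ℕ) = I.zc v) s := by
  refine wp_fill (fun v => I.zc v) h.n ?_ (fun s' _ h1 _ => h1)
  intro v hv s' hf hx _ _
  have h' := h.frame hf rfl
  have hd' : ∀ v < I.n, ∀ u < I.n, s'.arr 10 ((v : ℤ) * I.n + u) = tv (I.dom v u) := by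
    rw [hf.arr 10 rfl]; exact hd
  constructor
  · rw [eval_sum, h'.toNat_m, Inst.zc]
    apply Finset.sum_congr rfl
    intro l hl
    rw [Finset.mem_range] at hl
    have h3 := h'.setV 50 l
    have q1 : (get 1 (.var 50)).eval (s'.setV 50 l) = I.src l := by
      simpa using h'.src l hl
    have q2 : (get 2 (.var 50)).eval (s'.setV 50 l) = I.tgt l := by
      simpa using h'.tgt l hl
    have q13 : (get 13 (.var 50)).eval (s'.setV 50 l) = tv (I.cross l) := by
      simpa [hf.arr 13 rfl] using hc l hl
    have q12 : (get 12 (.var 50)).eval (s'.setV 50 l) = I.Z l := by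
      simpa [hf.arr 12 rfl] using hZ l hl
    rw [eval_mul, eval_and, q12, q13, tv_pos, covX, eval_eq, tv_pos, eval_add,
      h3.eval_domX hd' (a := v) (by simp [hx]) q1 hv (I.src_lt l hl),
      h3.eval_domX hd' (a := v) (by simp [hx]) q2 hv (I.tgt_lt l hl)]
    congr 1
    apply tv_congr
    refine and_congr_right fun _ => ?_
    unfold Inst.cov tv
    by_cases h1 : I.dom v (I.src l) <;> by_cases h2 : I.dom v (I.tgt l) <;> simp [h1, h2]
  · rw [abs_of_nonneg (Inst.zc_nonneg v)]
    refine le_trans (Finset.sum_le_sum fun l _ => ?_) hB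
    have := I.Z_nonneg l
    nlinarith [tv_le_one (I.cross l ∧ I.cov v l)]

theorem eval_caseX (h : Pre I s) {a b q : ℕ} (hx : s.var 20 = q) {f g : ℕ → ℤ}
    (hq : q < 2 * I.m) (hf : ∀ l < I.m, s.arr a (l : ℕ) = f l)
    (hg : ∀ l < I.m, s.arr b (l : ℕ) = g l) :
    (caseX a b).eval s = if q < I.m then f q else g (q - I.m) := by
  simp only [caseX, eval_add, eval_mul, eval_not, eval_lt, eval_get, eval_sub, eval_var, hx, h.m,
    tv_pos, Nat.cast_lt]
  split_ifs with hlt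
  · rw [tv_true hlt, tv_false (not_not.2 hlt), hf q hlt]; ring
  · have : ((q : ℤ) - I.m) = ((q - I.m : ℕ) : ℤ) := by omega
    rw [tv_false hlt, tv_true hlt, this, hg _ (by omega)]; ring

theorem pieceCmd_wp (h : Pre I s) (hB : Small I B) (hC : ∀ l : ℕ, s.arr 11 (l : ℕ) = I.C l) :
    pieceCmd.wp B (fun s' => (∀ q < 2 * I.m, s'.arr 15 (q : ℕ) = I.pu q) ∧
      (∀ q < 2 * I.m, s'.arr 16 (q : ℕ) = I.pw q) ∧
      ∀ q < 2 * I.m, s'.arr 17 (q : ℕ) = I.pC q) s := by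
  refine wp_seq (P := fun s' => ∀ q < 2 * I.m, s'.arr 15 (q : ℕ) = I.pu q)
    (wp_fill (fun q => (I.pu q : ℤ)) h.mm ?_ (fun s' _ h1 _ => h1)) ?_
  · intro q hq s' hf hx _ _
    have h' := h.frame hf rfl
    refine ⟨?_, hB.abs_le (by have := pu_lt hq; omega)⟩
    rw [eval_caseX h' hx hq h'.src h'.tgt, Inst.pu]
    split_ifs <;> rfl
  intro s1 h15 hf1
  have h1 := h.frame hf1 rfl
  refine wp_seq (P := fun s' => ∀ q < 2 * I.m, s'.arr 16 (q : ℕ) = I.pw q)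
    (wp_fill (fun q => (I.pw q : ℤ)) h1.mm ?_ (fun s' _ h1 _ => h1)) ?_
  · intro q hq s' hf hx _ _
    have h' := h1.frame hf rfl
    refine ⟨?_, hB.abs_le (by have := pw_lt hq; omega)⟩
    rw [eval_caseX h' hx hq h'.tgt h'.src, Inst.pw]
    split_ifs <;> rfl
  intro s2 h16 hf2
  have h2 := h1.frame hf2 rfl
  refine wp_fill (fun q => I.pC q) h2.mm ?_ ?_
  · intro q hq s' hf hx _ _
    have h' := h2.frame hf rfl
    have hC' : ∀ l < I.m, s'.arr 11 (l : ℕ) = I.C l := by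
      rw [hf.arr 11 rfl, hf2.arr 11 rfl, hf1.arr 11 rfl]
      exact fun l _ => hC l
    refine ⟨?_, ?_⟩
    · rw [eval_caseX h' hx hq hC' hC', Inst.pC]
    · rw [abs_of_nonneg (I.pC_nonneg q)]
      exact hB.pC_le q
  · intro s' hf h17 _
    refine ⟨?_, ?_, h17⟩
    · rw [hf.arr 15 rfl, hf2.arr 15 rfl]; exact h15
    · rw [hf.arr 16 rfl]; exact h16

/-- The factors are at least 1, so no partial product exceeds the full one. -/
theorem prodDen_wp {y a m : ℕ} {d : ℕ → ℤ} (hy : y = 10 ∨ y = 11) (hm : s.var 1 = m)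
    (hd : ∀ l < m, s.arr a (l : ℕ) = d l) (hpos : ∀ l, 1 ≤ d l)
    (hB : ∏ l ∈ Finset.range m, d l ≤ B) :
    (prodDen y a).wp B (fun s' => s'.var y = ∏ l ∈ Finset.range m, d l) s := by
  have hnn : ∀ k, 0 ≤ ∏ l ∈ Finset.range k, d l := fun k =>
    Finset.prod_nonneg fun l _ => by linarith [hpos l]
  have hbound : ∀ k ≤ m, |∏ l ∈ Finset.range k, d l| ≤ B := by
    intro k hk
    rw [abs_of_nonneg (hnn k)]
    refine le_trans ?_ hB
    refine monotone_nat_of_le_succ (f := fun k => ∏ l ∈ Finset.range k, d l) (fun k => ?_) hk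
    simp only [Finset.prod_range_succ]
    nlinarith [hnn k, hpos k]
  refine ⟨by simpa using hbound 0 (Nat.zero_le _), ?_⟩
  refine wp_forTo (fun k s' => s'.var y = ∏ l ∈ Finset.range k, d l) (N := m) ?_ (by simp) ?_
    (fun s' _ hI => hI)
  · rw [State.setV_var, if_neg (by omega), hm]
  · intro k hk s' hf hI
    have ha : s'.arr a (k : ℕ) = d k := by
      rw [hf.arr a rfl]; exact hd k hk
    have e : (mul (.var y) (get a (.var 20))).eval (s'.setV 20 k) =
        ∏ l ∈ Finset.range (k + 1), d l := by
      rw [Finset.prod_range_succ, ← hI, ← ha]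
      simp [show y ≠ 20 by omega]
    refine ⟨by rw [e]; exact hbound _ (by omega), ?_⟩
    rw [e]; simp

theorem scale_wp {y a b c m : ℕ} {f : ℕ → ℤ} (hy : y = 10 ∨ y = 11) (hab : b ≠ a) (hac : c ≠ a)
    (hm : s.var 1 = m) (hf : ∀ l < m, s.arr b (l : ℕ) * (s.var y / s.arr c (l : ℕ)) = f l)
    (hB : ∀ l < m, |f l| ≤ B) :
    (scale y a b c).wp B (fun s' => (∀ l < m, s'.arr a (l : ℕ) = f l) ∧
      ∀ l : ℕ, m ≤ l → s'.arr a (l : ℕ) = s.arr a (l : ℕ)) s := by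
  refine wp_fill f hm ?_ (fun s' _ h1 h2 => ⟨h1, h2⟩)
  intro l hl s' hF hx _ _
  refine ⟨?_, hB l hl⟩
  rw [← hf l hl]
  simp only [eval_mul, eval_get, eval_div, eval_var, hx]
  rw [hF.arr b (by simpa [keepsA] using hab), hF.arr c (by simpa [keepsA] using hac),
    hF.var y (by rcases hy with rfl | rfl <;> rfl)]

end Eval

end Aug

end RAM

/-! ### Computation of domination from the adjacency matrix, and scaling -/

namespace RootedPair

open RAM RAM.Aug RAM.X RAM.Cmd SimpleGraph

variable {n m : ℕ} (P : RootedPair n m)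

theorem adjArray_eq (i j : Fin n) : P.adjArray (((i : ℕ) : ℤ) * n + (j : ℕ)) = tv (P.tree.Adj i j) := by
  classical
  unfold adjArray
  by_cases h : P.tree.Adj i j
  · rw [tv_true h, Set.indicator_of_mem]
    · rfl
    · exact ⟨i, j, h, rfl⟩
  · rw [tv_false h, Set.indicator_of_notMem]
    rintro ⟨i', j', h', heq⟩
    have heq : (i : ℕ) * n + j = i' * n + j' := by exact_mod_cast heq
    have h1 := congrArg (· / n) heq
    have h2 := congrArg (· % n) heq
    simp only [row_idx j.2, row_idx j'.2, col_idx j.2, col_idx j'.2] at h1 h2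
    rw [Fin.val_inj] at h1 h2
    subst h1 h2
    exact h h'

/-- Approximation of domination from above: `A` excludes domination of `u` by `v` if some walk of
length at most `b (v * n + u)` avoids `v`. -/
structure Closure (b : ℕ → ℕ) (A : ℕ → ℤ) : Prop where
  zero_or_one : ∀ k < n * n, A k = 0 ∨ A k = 1
  sound : ∀ v u : Fin n, P.tree.Dom P.root v u → 0 < A (v * n + u)
  complete : ∀ v u : Fin n, ∀ p : P.tree.Walk P.root u, p.length ≤ b (v * n + u) → v ∉ p.support →
    A (v * n + u) = 0

variable {P}

theorem Closure.mono {b b' : ℕ → ℕ} {A : ℕ → ℤ} (h : P.Closure b A)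
    (hb : ∀ k < n * n, b' k ≤ b k) : P.Closure b' A :=
  ⟨h.zero_or_one, h.sound, fun v u p hp => h.complete v u p (hp.trans (hb _ (idx_lt v.2 u.2)))⟩

/-- The tree path to `u` has length less than `n`, so `n` rounds detect every vertex that it avoids.
-/
theorem Closure.eq_tv {b : ℕ → ℕ} {A : ℕ → ℤ} (h : P.Closure b A) (hb : ∀ k < n * n, n ≤ b k)
    (v u : Fin n) : A (v * n + u) = tv (P.tree.Dom P.root v u) := by
  have hk := idx_lt v.2 u.2
  by_cases hd : P.tree.Dom P.root v u
  · have h1 := h.sound v u hd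
    rw [tv_true hd]
    rcases h.zero_or_one _ hk with h2 | h2
    · omega
    · exact h2
  · rw [tv_false hd]
    obtain ⟨p, hp, -⟩ := P.isTree.existsUnique_path P.root u
    have hv : v ∉ p.support := fun hv => hd (P.isTree.mem_support_of_isPath hp hv)
    refine h.complete v u p ?_ hv
    have := hp.length_lt
    rw [Fintype.card_fin] at this
    exact this.le.trans (hb _ hk)

theorem Closure.init {A : ℕ → ℤ}
    (h : ∀ k < n * n, A k = tv (k / n = P.root ∨ k % n ≠ P.root)) : P.Closure (fun _ => 0) A := by
  refine ⟨fun k hk => ?_, fun v u hd => ?_, fun v u p hp hv => ?_⟩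
  · rw [h k hk]; unfold tv; split_ifs <;> simp
  · rw [h _ (idx_lt v.2 u.2), row_idx u.2, col_idx u.2, tv_pos]
    by_contra! hcon
    have hu : u = P.root := Fin.ext hcon.2
    subst hu
    have := hd Walk.nil
    simp only [Walk.support_nil, List.mem_singleton] at this
    exact hcon.1 (congrArg Fin.val this)
  · rw [h _ (idx_lt v.2 u.2), row_idx u.2, col_idx u.2, tv_false]
    have hu : P.root = u := Walk.eq_of_length_eq_zero (Nat.le_zero.1 hp)
    rintro (h1 | h1)
    · exact hv (by rw [Fin.ext h1]; exact p.start_mem_support)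
    · exact h1 (by rw [hu])

/-- If `v ≠ u` dominates `u`, it dominates all neighbours of `u`, as a walk to a neighbour extends
to `u`; so nothing is eliminated wrongly. A walk of length at most `k + 1` that avoids `v` loses its
last step and is then known at a neighbour. -/
theorem Closure.step {b : ℕ → ℕ} {A : ℕ → ℤ} (h : P.Closure b A) {k : ℕ} (v u : Fin n)
    (hb : ∀ w : Fin n, k ≤ b (v * n + w)) :
    P.Closure (Function.update b (v * n + u) (k + 1)) (Function.update A (v * n + u)
      (tv (0 < A (v * n + u) ∧ (v = u ∨ ¬ ∃ w, P.tree.Adj w u ∧ ¬ 0 < A (v * n + w))))) := by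
  have hinj : ∀ v' u' : Fin n, (v' : ℕ) * n + u' = v * n + u → v' = v ∧ u' = u := by
    intro v' u' heq
    have h1 := congrArg (· / n) heq
    have h2 := congrArg (· % n) heq
    simp only [row_idx u.2, row_idx u'.2, col_idx u.2, col_idx u'.2] at h1 h2
    exact ⟨Fin.ext h1, Fin.ext h2⟩
  refine ⟨fun j hj => ?_, fun v' u' hd => ?_, fun v' u' p hp hv => ?_⟩
  · rw [Function.update_apply]
    split_ifs
    · unfold tv; split_ifs <;> simp
    · exact h.zero_or_one j hj
  · rw [Function.update_apply]
    split_ifs with heq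
    · obtain ⟨rfl, rfl⟩ := hinj _ _ heq
      rw [tv_pos]
      refine ⟨h.sound _ _ hd, ?_⟩
      by_contra! hcon
      obtain ⟨hne, w, hw, hA⟩ := hcon
      refine absurd (h.sound v' w fun q => ?_) (not_lt.2 hA)
      have := hd (q.concat hw)
      rw [Walk.support_concat, List.mem_append, List.mem_singleton] at this
      exact this.resolve_right hne
    · exact h.sound _ _ hd
  · rw [Function.update_apply] at hp ⊢
    split_ifs at hp ⊢ with heq
    · obtain ⟨rfl, rfl⟩ := hinj _ _ heq
      apply tv_false
      rintro ⟨h1, h2⟩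
      by_cases hnil : p.Nil
      · have h3 := h.complete v' u' p (by
          rw [Walk.length_eq_zero_iff.2 hnil]; exact Nat.zero_le _) hv
        omega
      · have hne : v' ≠ u' := by
          rintro rfl
          exact hv p.end_mem_support
        refine h2.resolve_left hne ⟨p.penultimate, p.adj_penultimate hnil, ?_⟩
        have h3 := h.complete v' p.penultimate p.dropLast (by
          have h4 := hb p.penultimate
          have h5 := Walk.length_dropLast_add_one hnil
          omega) (fun hmem => hv (by
            rw [← Walk.support_dropLast_concat hnil]
            exact List.mem_append_left _ hmem))
        omega
    · exact h.complete _ _ p hp hv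

variable {C Z : Fin m → ℤ} {hC : ∀ ℓ, 0 ≤ C ℓ} {hZ : ∀ ℓ, 0 ≤ Z ℓ} {s : State} {B : ℤ}

theorem domInit_wp (h : Pre (P.inst C Z hC hZ) s) (hB : Small (P.inst C Z hC hZ) B) :
    domInit.wp B (fun s' => P.Closure (fun _ => 0) (s'.nat 10)) s := by
  refine wp_fill (fun k => tv (k / n = P.root ∨ k % n ≠ P.root)) h.nn ?_
    (fun s' _ h1 _ => Closure.init h1)
  intro k _ s' hf hx _ _
  have h' := h.frame hf rfl
  refine ⟨?_, hB.abs_tv _⟩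
  rw [eval_or, eval_not, tv_pos, eval_eq, tv_pos, eval_eq, tv_pos,
    h'.eval_rowX (k := .var 20) (a := k) (by simp [hx]),
    h'.eval_colX (k := .var 20) (a := k) (by simp [hx]), eval_var, h'.r]
  apply tv_congr
  rw [Nat.cast_inj, Nat.cast_inj]
  rfl

theorem domStep_wp (h : Pre (P.inst C Z hC hZ) s) (hB : Small (P.inst C Z hC hZ) B)
    (hadj : s.arr 0 = P.adjArray) {i : ℕ} (hc : P.Closure (fun _ => i) (s.nat 10)) :
    domStep.wp B (fun s' => P.Closure (fun _ => i + 1) (s'.nat 10)) s := by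
  refine wp_forTo (N := n * n)
    -- Updating in place, the cells below `k` are one round ahead, which only helps the cells that
    -- follow.
    (fun k s' => P.Closure (fun j => if j < k then i + 1 else i) (s'.nat 10)) h.nn ?_ ?_ ?_
  · simpa using hc
  · intro k hk s' hf hcl
    have h' := (h.frame hf rfl).setV 20 k
    obtain ⟨v, u, rfl⟩ : ∃ v u : Fin n, k = v * n + u :=
      ⟨⟨k / n, row_lt hk⟩, ⟨k % n, col_lt hk⟩, by
        rw [mul_comm]; exact (Nat.div_add_mod k n).symm⟩
    set k := (v : ℕ) * n + u with hkdef
    have hrow : (rowX (.var 20)).eval (s'.setV 20 k) = ((v : ℕ) : ℤ) := by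
      rw [h'.eval_rowX (a := k) (by simp)]
      exact congrArg Nat.cast (row_idx u.2)
    have hcol : (colX (.var 20)).eval (s'.setV 20 k) = ((u : ℕ) : ℤ) := by
      rw [h'.eval_colX (a := k) (by simp)]
      exact congrArg Nat.cast (col_idx u.2)
    have heval : (X.and (get 10 (.var 20)) (X.or (X.eq (rowX (.var 20)) (colX (.var 20)))
        (X.not (ex 50 0 (X.and (get 0 (X.add (mul (.var 50) (.var 0)) (colX (.var 20))))
          (X.not (domX (rowX (.var 20)) (.var 50)))))))).eval (s'.setV 20 k) =
        tv (0 < s'.nat 10 k ∧ (v = u ∨ ¬ ∃ w, P.tree.Adj w u ∧ ¬ 0 < s'.nat 10 (v * n + w))) := by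
      rw [eval_and]
      apply tv_congr
      rw [eval_or, tv_pos, eval_eq, tv_pos, eval_not, tv_pos, eval_ex, tv_pos, h'.toNat_n, hrow, hcol,
        Nat.cast_inj, Fin.val_inj]
      refine and_congr (by simp [State.nat]) (or_congr Iff.rfl (not_congr ?_))
      have hw : ∀ w : Fin n, 0 < (X.and (get 0 (X.add (mul (.var 50) (.var 0)) (colX (.var 20))))
          (X.not (domX (rowX (.var 20)) (.var 50)))).eval ((s'.setV 20 k).setV 50 (w : ℕ)) ↔
          P.tree.Adj w u ∧ ¬ 0 < s'.nat 10 (v * n + w) := by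
        intro w
        have h3 := h'.setV 50 (w : ℕ)
        have hn : ((s'.setV 20 k).setV 50 (w : ℕ)).var 0 = n := h3.n
        have ha : ((s'.setV 20 k).setV 50 (w : ℕ)).arr 0 = P.adjArray := by
          simp only [State.setV_arr]; rw [hf.arr 0 rfl, hadj]
        have hrow' : (rowX (.var 20)).eval ((s'.setV 20 k).setV 50 (w : ℕ)) = ((v : ℕ) : ℤ) := by
          rw [h3.eval_rowX (a := k) (by simp)]
          exact congrArg Nat.cast (row_idx u.2)
        have hcol' : (colX (.var 20)).eval ((s'.setV 20 k).setV 50 (w : ℕ)) = ((u : ℕ) : ℤ) := by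
          rw [h3.eval_colX (a := k) (by simp)]
          exact congrArg Nat.cast (col_idx u.2)
        have e50 : (X.var 50).eval ((s'.setV 20 k).setV 50 (w : ℕ)) = ((w : ℕ) : ℤ) := by simp
        rw [eval_and, tv_pos, eval_not, tv_pos, eval_get, eval_add, eval_mul, eval_var (x := 0),
          hcol', e50, hn, ha, adjArray_eq, tv_pos, domX, eval_get, eval_add, eval_mul,
          eval_var (x := 0), hrow', e50, hn, State.nat]
        push_cast
        rfl
      constructor
      · rintro ⟨w, hwn, hw'⟩
        exact ⟨⟨w, hwn⟩, (hw ⟨w, hwn⟩).1 hw'⟩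
      · rintro ⟨w, hw'⟩
        exact ⟨w, w.2, (hw w).2 hw'⟩
    refine ⟨by rw [heval]; exact hB.abs_tv _, ?_⟩
    rw [heval]
    have e20 : (X.var 20).eval (s'.setV 20 k) = k := by simp
    rw [e20]
    change P.Closure _ (State.nat _ _)
    rw [State.nat_setA, State.nat_setV]
    refine (hcl.step (k := i) v u fun w => ?_).mono fun j _ => ?_
    · split_ifs <;> omega
    · rw [Function.update_apply]
      split_ifs <;> omega
  · intro s' _ hcl
    exact hcl.mono fun k hk => by rw [if_pos hk]

theorem domCmd_wp (h : Pre (P.inst C Z hC hZ) s) (hB : Small (P.inst C Z hC hZ) B)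
    (hadj : s.arr 0 = P.adjArray) :
    domCmd.wp B (fun s' => ∀ v < n, ∀ u < n, s'.arr 10 ((v : ℤ) * n + u) = tv (P.dom v u)) s := by
  refine wp_seq (domInit_wp h hB) fun s1 hc hf1 => ?_
  have h1 := h.frame hf1 rfl
  refine wp_forTo (N := n) (fun k s' => P.Closure (fun _ => k) (s'.nat 10)) h1.n hc ?_ ?_
  · intro k hk s' hf hcl
    exact domStep_wp ((h1.frame hf rfl).setV 21 k) hB
      (by rw [State.setV_arr, hf.arr 0 rfl, hf1.arr 0 rfl, hadj]) hcl
  · intro s' _ hcl v hv u hu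
    have := hcl.eq_tv (fun _ _ => le_rfl) ⟨v, hv⟩ ⟨u, hu⟩
    rw [State.nat] at this
    push_cast at this
    rw [this]
    exact tv_congr (P.dom_val ⟨v, hv⟩ ⟨u, hu⟩).symm

/-! ### Scaling to integers -/

/-- The product of the denominators. -/
def denProd (c : Fin m → ℚ) : ℤ := ∏ ℓ, ((c ℓ).den : ℤ)

/-- Rational numbers, multiplied by their common denominator. -/
def scaled (c : Fin m → ℚ) (ℓ : Fin m) : ℤ := (c ℓ).num * (denProd c / (c ℓ).den)

theorem denProd_pos (c : Fin m → ℚ) : 0 < denProd c :=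
  Finset.prod_pos fun ℓ _ => by exact_mod_cast (c ℓ).den_pos

theorem scaled_cast (c : Fin m → ℚ) (ℓ : Fin m) : (scaled c ℓ : ℚ) = denProd c * c ℓ := by
  have hdvd : ((c ℓ).den : ℤ) ∣ denProd c := Finset.dvd_prod_of_mem _ (Finset.mem_univ ℓ)
  have hne : (((c ℓ).den : ℤ) : ℚ) ≠ 0 := by exact_mod_cast (c ℓ).den_nz
  rw [scaled, Int.cast_mul, Int.cast_div hdvd hne]
  conv_rhs => rw [← Rat.num_div_den (c ℓ)]
  push_cast
  ring

theorem scaled_nonneg {c : Fin m → ℚ} (hc : ∀ ℓ, 0 ≤ c ℓ) (ℓ : Fin m) : 0 ≤ scaled c ℓ :=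
  mul_nonneg (Rat.num_nonneg.2 (hc ℓ)) (Int.ediv_nonneg (denProd_pos c).le (by positivity))

/-- Memory with the input. -/
structure Start (P : RootedPair n m) (c x : Fin m → ℚ) (s : State) : Prop where
  var_n : s.var 0 = n
  var_m : s.var 1 = m
  var_r : s.var 2 = (P.root : ℕ)
  var_nn : s.var 3 = ((n * n : ℕ) : ℤ)
  var_mm : s.var 4 = ((2 * m : ℕ) : ℤ)
  var_three : s.var 5 = ((3 : ℕ) : ℤ)
  adj : s.arr 0 = P.adjArray
  src : ∀ ℓ : Fin m, s.arr 1 (ℓ : ℕ) = (P.src ℓ : ℕ)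
  tgt : ∀ ℓ : Fin m, s.arr 2 (ℓ : ℕ) = (P.tgt ℓ : ℕ)
  cnum : ∀ ℓ : Fin m, s.arr 3 (ℓ : ℕ) = (c ℓ).num
  cden : ∀ ℓ : Fin m, s.arr 4 (ℓ : ℕ) = (c ℓ).den
  xnum : ∀ ℓ : Fin m, s.arr 5 (ℓ : ℕ) = (x ℓ).num
  xden : ∀ ℓ : Fin m, s.arr 6 (ℓ : ℕ) = (x ℓ).den
  zero : ∀ l : ℕ, s.arr 11 (l : ℕ) = 0

theorem prod_extend_den (c : Fin m → ℚ) :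
    ∏ l ∈ Finset.range m, extend (fun ℓ => ((c ℓ).den : ℤ)) 1 l = denProd c := by
  rw [← Fin.prod_univ_eq_prod_range]
  simp only [extend_val, denProd]

theorem setupCmd_wp {c x : Fin m → ℚ} {hc : ∀ ℓ, 0 ≤ c ℓ} {hx : ∀ ℓ, 0 ≤ x ℓ}
    (h : Start P c x s)
    (hB : Small (P.inst (scaled c) (scaled x) (scaled_nonneg hc) (scaled_nonneg hx)) B)
    (hZ : ∑ ℓ, scaled x ℓ ≤ B) (hD : denProd c ≤ B) (hE : denProd x ≤ B) :
    setupCmd.wp B (Env (P.inst (scaled c) (scaled x) (scaled_nonneg hc) (scaled_nonneg hx))) s := by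
  set I := P.inst (scaled c) (scaled x) (scaled_nonneg hc) (scaled_nonneg hx) with hI
  have h0 : Pre I s := by
    refine ⟨h.var_n, h.var_m, h.var_r, h.var_nn, h.var_mm, h.var_three, fun l hl => ?_, fun l hl => ?_⟩
    · exact (h.src ⟨l, hl⟩).trans
        (congrArg Nat.cast (extend_of_lt (fun ℓ => (P.src ℓ : ℕ)) 0 hl).symm)
    · exact (h.tgt ⟨l, hl⟩).trans
        (congrArg Nat.cast (extend_of_lt (fun ℓ => (P.tgt ℓ : ℕ)) 0 hl).symm)
  have hpos : ∀ (c : Fin m → ℚ) l, 1 ≤ extend (fun ℓ => ((c ℓ).den : ℤ)) 1 l := by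
    intro c l
    unfold extend
    split_ifs
    · exact Int.natCast_pos.2 (c _).den_pos
    · exact le_rfl
  have hZsum : ∑ l ∈ Finset.range I.m, I.Z l ≤ B := by
    refine le_trans (le_of_eq ?_) hZ
    rw [Finset.sum_range]
    exact Finset.sum_congr rfl fun ℓ _ => extend_val _ _ ℓ
  have hZle : ∀ l < I.m, |I.Z l| ≤ B := fun l hl => by
    rw [abs_of_nonneg (I.Z_nonneg l)]
    exact (Finset.single_le_sum (fun l _ => I.Z_nonneg l) (Finset.mem_range.2 hl)).trans hZsum
  have hCle : ∀ l < I.m, |I.C l| ≤ B := fun l _ => by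
    have h1 := I.C_nonneg l
    have h2 := hB.C_le l
    rw [abs_of_nonneg h1]
    linarith
  refine wp_seq (prodDen_wp (m := m) (d := extend (fun ℓ => ((c ℓ).den : ℤ)) 1) (Or.inl rfl) h.var_m
    (fun l hl => (h.cden ⟨l, hl⟩).trans (extend_of_lt (fun ℓ => ((c ℓ).den : ℤ)) 1 hl).symm) (hpos c)
    (by rwa [prod_extend_den])) fun s1 v10 hf1 => ?_
  rw [prod_extend_den] at v10
  have h1 := h0.frame hf1 rfl
  refine wp_seq (prodDen_wp (m := m) (d := extend (fun ℓ => ((x ℓ).den : ℤ)) 1) (Or.inr rfl) h1.m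
    (fun l hl => by
      rw [hf1.arr 6 rfl]
      exact (h.xden ⟨l, hl⟩).trans (extend_of_lt (fun ℓ => ((x ℓ).den : ℤ)) 1 hl).symm) (hpos x)
    (by rwa [prod_extend_den])) fun s2 v11 hf2 => ?_
  rw [prod_extend_den] at v11
  have h2 := h1.frame hf2 rfl
  refine wp_seq (scale_wp (f := I.C) (Or.inl rfl) (by norm_num) (by norm_num) h2.m
    (fun l hl => ?_) hCle) fun s3 hC3 hf3 => ?_
  · rw [hf2.arr 3 rfl, hf1.arr 3 rfl, hf2.arr 4 rfl, hf1.arr 4 rfl, hf2.var 10 rfl, v10]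
    rw [h.cnum ⟨l, hl⟩, h.cden ⟨l, hl⟩]
    exact (extend_of_lt (scaled c) 0 hl).symm
  have h3 := h2.frame hf3 rfl
  have c3 : ∀ l : ℕ, s3.arr 11 (l : ℕ) = I.C l := by
    intro l
    by_cases hl : l < I.m
    · exact hC3.1 l hl
    · rw [hC3.2 l (by omega), hf2.arr 11 rfl, hf1.arr 11 rfl, h.zero l, I.C_of_le l (by omega)]
  refine wp_seq (scale_wp (f := I.Z) (Or.inr rfl) (by norm_num) (by norm_num) h3.m
    (fun l hl => ?_) hZle) fun s4 hZ4 hf4 => ?_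
  · rw [hf3.arr 5 rfl, hf2.arr 5 rfl, hf1.arr 5 rfl, hf3.arr 6 rfl, hf2.arr 6 rfl, hf1.arr 6 rfl,
      hf3.var 11 rfl, v11]
    rw [h.xnum ⟨l, hl⟩, h.xden ⟨l, hl⟩]
    exact (extend_of_lt (scaled x) 0 hl).symm
  have h4 := h3.frame hf4 rfl
  refine wp_seq (domCmd_wp h4 hB (by
    rw [hf4.arr 0 rfl, hf3.arr 0 rfl, hf2.arr 0 rfl, hf1.arr 0 rfl, h.adj])) fun s5 hd5 hf5 => ?_
  have h5 := h4.frame hf5 rfl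
  refine wp_seq (crossCmd_wp h5 hB hd5) fun s6 hc6 hf6 => ?_
  have h6 := h5.frame hf6 rfl
  have d6 : ∀ v < I.n, ∀ u < I.n, s6.arr 10 ((v : ℤ) * I.n + u) = tv (I.dom v u) := by
    rw [hf6.arr 10 rfl]; exact hd5
  refine wp_seq (zcCmd_wp h6 d6 (by rw [hf6.arr 12 rfl, hf5.arr 12 rfl]; exact hZ4.1) hc6 hZsum)
    fun s7 hz7 hf7 => ?_
  have h7 := h6.frame hf7 rfl
  have c7 : s7.arr 11 = s3.arr 11 := by
    rw [hf7.arr 11 rfl, hf6.arr 11 rfl, hf5.arr 11 rfl, hf4.arr 11 rfl]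
  refine wp_mono ?_ (wp_frame (pieceCmd_wp h7 hB (by rw [c7]; exact c3)))
  rintro s8 ⟨⟨p15, p16, p17⟩, hf8⟩
  have h8 := h7.frame hf8 rfl
  refine ⟨h8.n, h8.m, h8.r, h8.nn, h8.mm, h8.three, h8.src, h8.tgt, ?_, ?_, ?_, ?_, p15, p16, p17⟩
  · rw [hf8.arr 10 rfl, hf7.arr 10 rfl]; exact d6
  · rw [hf8.arr 11 rfl, c7]; exact c3
  · rw [hf8.arr 13 rfl, hf7.arr 13 rfl]; exact hc6
  · rw [hf8.arr 14 rfl]; exact hz7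

end RootedPair

namespace RootedPair

open RAM RAM.Aug RAM.Cmd

variable {n m : ℕ} {P : RootedPair n m}

/-! ### The approximation guarantee -/

/-- Weak duality. -/
theorem mul_sum_le {cov : ℕ → Fin m → Prop} {y : ℕ → ℤ} {w K : Fin m → ℝ} {a : ℝ}
    (hy : ∀ v < n, 0 ≤ y v) (hw : ∀ ℓ, 0 ≤ w ℓ)
    (h1 : ∀ v < n, y v ≠ 0 → a ≤ ∑ ℓ : Fin m, (tv (cov v ℓ) : ℝ) * w ℓ)
    (h2 : ∀ ℓ, w ℓ ≠ 0 → ∑ v ∈ Finset.range n, (tv (cov v ℓ) : ℝ) * y v ≤ K ℓ) :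
    a * ∑ v ∈ Finset.range n, (y v : ℝ) ≤ ∑ ℓ, w ℓ * K ℓ := by
  calc a * ∑ v ∈ Finset.range n, (y v : ℝ)
      ≤ ∑ v ∈ Finset.range n, ∑ ℓ, w ℓ * ((tv (cov v ℓ) : ℝ) * y v) := by
        rw [Finset.mul_sum]
        apply Finset.sum_le_sum
        intro v hv
        rw [Finset.mem_range] at hv
        have hy' : (0 : ℝ) ≤ y v := by exact_mod_cast hy v hv
        by_cases h0 : y v = 0
        · simp [h0]
        · refine (mul_le_mul_of_nonneg_right (h1 v hv h0) hy').trans (le_of_eq ?_)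
          rw [Finset.sum_mul]
          exact Finset.sum_congr rfl fun ℓ _ => by ring
    _ = ∑ ℓ, w ℓ * ∑ v ∈ Finset.range n, (tv (cov v ℓ) : ℝ) * y v := by
        rw [Finset.sum_comm]
        exact Finset.sum_congr rfl fun ℓ _ => (Finset.mul_sum _ _ _).symm
    _ ≤ _ := by
        apply Finset.sum_le_sum
        intro ℓ _
        by_cases h0 : w ℓ = 0
        · simp [h0]
        · exact mul_le_mul_of_nonneg_left (h2 ℓ h0) (hw ℓ)

theorem zCross_nonneg (ℓ : Fin m) : 0 ≤ P.zCross ℓ :=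
  Set.indicator_nonneg (fun ℓ _ => P.z_nonneg ℓ) ℓ

theorem zIn_nonneg (ℓ : Fin m) : 0 ≤ P.zIn ℓ :=
  sub_nonneg.2 (Set.indicator_le_self' (fun ℓ _ => P.z_nonneg ℓ) ℓ)

theorem isCross_of_zCross_ne {ℓ : Fin m} (h : P.zCross ℓ ≠ 0) : P.IsCross ℓ :=
  Set.mem_of_indicator_ne_zero (s := {ℓ | P.IsCross ℓ}) h

variable {C Z : Fin m → ℤ} {hC : ∀ ℓ, 0 ≤ C ℓ} {hZ : ∀ ℓ, 0 ≤ Z ℓ}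

theorem inst_zc {E : ℝ} (hZE : ∀ ℓ, (Z ℓ : ℝ) = E * P.z ℓ) (v : ℕ) :
    ((P.inst C Z hC hZ).zc v : ℝ) =
      E * ∑ ℓ : Fin m, (tv ((P.inst C Z hC hZ).cov v ℓ) : ℝ) * P.zCross ℓ := by
  have hsum : (P.inst C Z hC hZ).zc v =
      ∑ ℓ : Fin m, tv ((P.inst C Z hC hZ).cross ℓ ∧ (P.inst C Z hC hZ).cov v ℓ) * Z ℓ := by
    rw [Inst.zc, show (P.inst C Z hC hZ).m = m from rfl, Finset.sum_range]
    exact Finset.sum_congr rfl fun ℓ _ => congrArg _ (extend_val Z 0 ℓ)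
  rw [hsum, Finset.mul_sum]
  push_cast
  apply Finset.sum_congr rfl
  intro ℓ _
  rw [hZE, zCross]
  by_cases h1 : P.IsCross ℓ
  · have h2 := (P.inst_cross (hC := hC) (hZ := hZ) ℓ).2 h1
    rw [Set.indicator_of_mem (show ℓ ∈ {ℓ | P.IsCross ℓ} from h1),
      tv_congr (and_iff_right h2)]
    ring
  · have h2 := fun h => h1 ((P.inst_cross (hC := hC) (hZ := hZ) ℓ).1 h)
    rw [Set.indicator_of_notMem (show ℓ ∉ {ℓ | P.IsCross ℓ} from h1), tv_false fun h => h2 h.1]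
    simp

theorem one_le_sum_cov {v : ℕ} (hv : v < n) (hr : v ≠ P.root) :
    1 ≤ ∑ ℓ : Fin m, (tv ((P.inst C Z hC hZ).cov v ℓ) : ℝ) * P.z ℓ := by
  obtain ⟨e, he, h⟩ := P.exists_edge (v := ⟨v, hv⟩) (fun h => hr (congrArg Fin.val h))
  refine (P.feasible e he).trans (le_of_eq (Finset.sum_congr rfl fun ℓ _ => ?_))
  have hiff : e ∈ pathEdges P.tree (P.src ℓ) (P.tgt ℓ) ↔ (P.inst C Z hC hZ).cov v ℓ :=
    (h ℓ).trans (P.inst_cov v ℓ).symm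
  by_cases hcov : (P.inst C Z hC hZ).cov v ℓ
  · rw [Set.indicator_of_mem (show ℓ ∈ {ℓ | e ∈ pathEdges P.tree (P.src ℓ) (P.tgt ℓ)} from hiff.2 hcov), tv_true hcov]; simp
  · rw [Set.indicator_of_notMem
      (show ℓ ∉ {ℓ | e ∈ pathEdges P.tree (P.src ℓ) (P.tgt ℓ)} from fun h => hcov (hiff.1 h)),
      tv_false hcov]
    simp

theorem cast_sum_cov (y : ℕ → ℤ) (ℓ : Fin m) :
    ∑ v ∈ Finset.range n, (tv ((P.inst C Z hC hZ).cov v ℓ) : ℝ) * y v =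
      ((∑ v ∈ Finset.range n, tv ((P.inst C Z hC hZ).cov v ℓ) * y v : ℤ) : ℝ) := by
  push_cast; rfl

/-- The analysis of the best of all candidates. -/
theorem le_of_bound {lam : ℝ} (hlam : 1 < lam) {D E : ℝ} (hD : 0 < D) (hE : 0 < E)
    (hCD : ∀ ℓ, (C ℓ : ℝ) = D * P.cost ℓ) (hZE : ∀ ℓ, (Z ℓ : ℝ) = E * P.z ℓ) {best : ℤ}
    (hb : ∀ v < n, (P.inst C Z hC hZ).Bound v best) :
    (best : ℝ) ≤ D * (2 * lam * ∑ ℓ, P.cost ℓ * P.zIn ℓ +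
      4 * lam / (3 * (lam - 1)) * ∑ ℓ, P.cost ℓ * P.zCross ℓ) := by
  classical
  set I := P.inst C Z hC hZ with hI
  have hl0 : 0 < lam := by linarith
  have hl1 : 0 < lam - 1 := by linarith
  -- With this θ, the in-links have value at least 1 - θ = 1/λ on the edges of small cross value,
  -- and the cross-links value at least θ on the others.
  set θ : ℝ := (lam - 1) / lam with hθ
  have hθ0 : 0 < θ := div_pos hl1 hl0
  have hθ1 : 1 - θ = 1 / lam := by rw [hθ]; field_simp; ring
  -- The greatest cross value below θ separates the edges exactly as θ does. Such a vertex exists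
  -- because the root has cross value 0.
  obtain ⟨v₀, hv₀, hmax⟩ := Finset.exists_max_image
    ((Finset.range n).filter fun v => (I.zc v : ℝ) < θ * E) I.zc
    ⟨P.root, by
      have : I.zc P.root = 0 := Inst.zc_root
      simp only [Finset.mem_filter, Finset.mem_range, Fin.is_lt, true_and, this]
      push_cast
      positivity⟩
  simp only [Finset.mem_filter, Finset.mem_range] at hv₀ hmax
  obtain ⟨y, γ, y0, γ0, ysupp, γsupp, yfeas, γfeas, hle⟩ := hb v₀ hv₀.1
  have hIC : ∀ ℓ : Fin m, (I.C ℓ : ℝ) = D * P.cost ℓ := fun ℓ => by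
    rw [← hCD]; exact congrArg Int.cast (extend_val C 0 ℓ)
  have hy : (1 / lam) * ∑ v ∈ Finset.range n, (y v : ℝ) ≤ ∑ ℓ, P.zIn ℓ * (2 * (D * P.cost ℓ)) := by
    refine mul_sum_le (cov := fun v ℓ => I.cov v ℓ) y0 zIn_nonneg ?_ ?_
    · intro v hv hne
      obtain ⟨hr, hz⟩ := ysupp v hv hne
      have h1 : 1 ≤ ∑ ℓ : Fin m, (tv (I.cov v ℓ) : ℝ) * P.z ℓ := one_le_sum_cov hv hr
      have h2 : (I.zc v : ℝ) = E * ∑ ℓ : Fin m, (tv (I.cov v ℓ) : ℝ) * P.zCross ℓ := inst_zc hZE v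
      have h3 : (I.zc v : ℝ) ≤ I.zc v₀ := by exact_mod_cast not_lt.1 hz
      have h4 : ∑ ℓ : Fin m, (tv (I.cov v ℓ) : ℝ) * P.zCross ℓ < θ := by
        by_contra! hcon
        have := mul_le_mul_of_nonneg_left hcon hE.le
        linarith [hv₀.2]
      have h5 : ∑ ℓ : Fin m, (tv (I.cov v ℓ) : ℝ) * P.zIn ℓ = ∑ ℓ : Fin m, (tv (I.cov v ℓ) : ℝ) * P.z ℓ -
          ∑ ℓ : Fin m, (tv (I.cov v ℓ) : ℝ) * P.zCross ℓ := by
        rw [← Finset.sum_sub_distrib]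
        exact Finset.sum_congr rfl fun ℓ _ => by rw [zIn]; ring
      rw [h5, ← hθ1]
      linarith
    · intro ℓ _
      rw [cast_sum_cov, ← hIC]
      exact_mod_cast yfeas ℓ ℓ.2
  have hγ : θ * ∑ v ∈ Finset.range n, (γ v : ℝ) ≤ ∑ ℓ, P.zCross ℓ * (2 * (D * P.cost ℓ)) := by
    refine mul_sum_le (cov := fun v ℓ => I.cov v ℓ) γ0 zCross_nonneg ?_ ?_
    · intro v hv hne
      have hz := γsupp v hv hne
      have h2 : (I.zc v : ℝ) = E * ∑ ℓ : Fin m, (tv (I.cov v ℓ) : ℝ) * P.zCross ℓ := inst_zc hZE v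
      -- A vertex beyond the threshold of `v₀` with cross value below θ would contradict the
      -- maximality of `v₀`.
      by_contra! hcon
      have h3 := mul_lt_mul_of_pos_left hcon hE
      exact absurd (hmax v ⟨hv, by rw [h2]; linarith⟩) (not_le.2 hz)
    · intro ℓ hne
      rw [cast_sum_cov, ← hIC]
      exact_mod_cast γfeas ℓ ℓ.2 ((P.inst_cross ℓ).2 (isCross_of_zCross_ne hne))
  have hin : ∑ ℓ, P.zIn ℓ * (2 * (D * P.cost ℓ)) = 2 * D * ∑ ℓ, P.cost ℓ * P.zIn ℓ := by
    rw [Finset.mul_sum]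
    exact Finset.sum_congr rfl fun ℓ _ => by ring
  have hcr : ∑ ℓ, P.zCross ℓ * (2 * (D * P.cost ℓ)) = 2 * D * ∑ ℓ, P.cost ℓ * P.zCross ℓ := by
    rw [Finset.mul_sum]
    exact Finset.sum_congr rfl fun ℓ _ => by ring
  rw [hin] at hy
  rw [hcr] at hγ
  set Y := ∑ v ∈ Finset.range n, (y v : ℝ)
  set G := ∑ v ∈ Finset.range n, (γ v : ℝ)
  set cin := ∑ ℓ, P.cost ℓ * P.zIn ℓ
  set ccr := ∑ ℓ, P.cost ℓ * P.zCross ℓ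
  have hle' : 3 * (best : ℝ) ≤ 3 * Y + 2 * G := by
    have := (Int.cast_le (R := ℝ)).2 hle
    push_cast at this
    exact this
  have hY : Y ≤ lam * (2 * D * cin) := by
    have := mul_le_mul_of_nonneg_left hy hl0.le
    rwa [← mul_assoc, mul_one_div_cancel hl0.ne', one_mul] at this
  have hG : G ≤ lam / (lam - 1) * (2 * D * ccr) := by
    have := mul_le_mul_of_nonneg_left hγ (div_pos hl0 hl1).le
    rwa [← mul_assoc, hθ, div_mul_div_cancel₀ hl1.ne', div_self hl0.ne', one_mul] at this
  -- The constant of the cross part is the product of 2/3 from the three colours, 2 from the dual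
  -- constraints and 1/θ = λ/(λ-1).
  have hfin : D * (2 * lam * cin + 4 * lam / (3 * (lam - 1)) * ccr) =
      lam * (2 * D * cin) + 2 / 3 * (lam / (lam - 1) * (2 * D * ccr)) := by
    field_simp
    ring
  rw [hfin]
  linarith

theorem isRounding_output {lam : ℝ} (hlam : 1 < lam) {D E : ℝ} (hD : 0 < D) (hE : 0 < E)
    (hCD : ∀ ℓ, (C ℓ : ℝ) = D * P.cost ℓ) (hZE : ∀ ℓ, (Z ℓ : ℝ) = E * P.z ℓ) {s : State}
    (hk : Kept (P.inst C Z hC hZ) s) (hb : ∀ v < n, (P.inst C Z hC hZ).Bound v (s.var 12)) :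
    P.IsRounding lam (s.output m) := by
  classical
  obtain ⟨F, h7, hcov, h12⟩ := hk
  have hmem : ∀ ℓ : Fin m, ℓ ∈ s.output m ↔ F ℓ := by
    intro ℓ
    have := h7 ℓ ℓ.2
    rw [State.nat] at this
    simp only [State.output, Finset.mem_filter, Finset.mem_univ, true_and, this, tv_ne_zero]
  constructor
  · intro e he
    obtain ⟨v, hv, h⟩ := P.exists_vertex he
    obtain ⟨l, hl, hF, hc⟩ := hcov v v.2 fun h => hv (Fin.ext h)
    exact ⟨⟨l, hl⟩, (hmem _).2 hF, (h _).2 ((P.inst_cov v ⟨l, hl⟩).1 hc)⟩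
  · have hcost : ((s.var 12 : ℤ) : ℝ) = D * ∑ ℓ ∈ s.output m, P.cost ℓ := by
      rw [h12, show (P.inst C Z hC hZ).m = m from rfl, Finset.sum_range]
      push_cast
      rw [Finset.mul_sum, ← Finset.sum_filter_add_sum_filter_not Finset.univ (fun ℓ : Fin m => F ℓ),
        Finset.sum_eq_zero (s := Finset.univ.filter fun ℓ : Fin m => ¬ F ℓ), add_zero]
      · refine Finset.sum_congr (Finset.ext fun ℓ => by simp [hmem]) fun ℓ hℓ => ?_
        rw [tv_true ((hmem ℓ).1 hℓ), ← hCD, Int.cast_one, one_mul]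
        exact congrArg Int.cast (extend_val C 0 ℓ)
      · intro ℓ hℓ
        rw [tv_false (Finset.mem_filter.1 hℓ).2, Int.cast_zero, zero_mul]
    have := le_of_bound hlam hD hE hCD hZE hb
    rw [hcost] at this
    exact le_of_mul_le_mul_left this hD

end RootedPair

namespace RAM

theorem abs_lt_two_pow_bits (k : ℤ) : |k| < 2 ^ bits k := by
  have : k.natAbs < 2 ^ bits k := Nat.lt_size_self _
  rw [Int.abs_eq_natAbs]
  exact_mod_cast this

theorem abs_le_of_bits_le {k : ℤ} {S : ℕ} (h : bits k ≤ S) : |k| ≤ 2 ^ S :=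
  (abs_lt_two_pow_bits k).le.trans (pow_le_pow_right₀ (by norm_num) h)

theorem abs_arrayOf_le {k : ℕ} {f : Fin k → ℤ} {B : ℤ} (hB : 0 ≤ B) (hf : ∀ l, |f l| ≤ B) (i : ℤ) :
    |arrayOf f i| ≤ B := by
  unfold arrayOf
  split_ifs
  · exact hf _
  · simpa using hB

theorem arrayOf_val {k : ℕ} (f : Fin k → ℤ) (l : Fin k) : arrayOf f ((l : ℕ) : ℤ) = f l := by
  unfold arrayOf
  rw [dif_pos ⟨by positivity, by simp⟩]
  congr 1

end RAM

namespace RootedPair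

open RAM RAM.Aug RAM.Cmd

variable {n m : ℕ} {P : RootedPair n m} {c x : Fin m → ℚ}

/-! ### Bounds in terms of the encoding length -/

theorem link_bits_le (ℓ : Fin m) :
    RAM.bits (P.src ℓ : ℕ) + RAM.bits (P.tgt ℓ : ℕ)
        + RAM.bits (c ℓ).num + RAM.bits (c ℓ).den + RAM.bits (x ℓ).num + RAM.bits (x ℓ).den
      ≤ P.inputSize c x := by
  unfold inputSize
  refine le_trans ?_ (Nat.le_add_left _ _)
  exact Finset.single_le_sum (f := fun ℓ => RAM.bits (P.src ℓ : ℕ) + RAM.bits (P.tgt ℓ : ℕ)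
        + RAM.bits (c ℓ).num + RAM.bits (c ℓ).den + RAM.bits (x ℓ).num + RAM.bits (x ℓ).den)
        (fun _ _ => Nat.zero_le _) (Finset.mem_univ ℓ)

theorem one_le_bits_den (q : ℚ) : 1 ≤ bits q.den := by
  unfold bits
  exact Nat.size_pos.2 (by simpa using q.den_pos)

/-- Each link contributes two denominators, of at least one bit each. -/
theorem two_mul_m_le : 2 * m ≤ P.inputSize c x := by
  unfold inputSize
  refine le_trans ?_ (Nat.le_add_left _ _)
  calc 2 * m = ∑ _ℓ : Fin m, 2 := by simp [mul_comm]
    _ ≤ _ := Finset.sum_le_sum fun ℓ _ => by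
      have h1 := one_le_bits_den (c ℓ)
      have h2 := one_le_bits_den (x ℓ)
      omega

theorem sq_le : n * n ≤ P.inputSize c x := by
  unfold inputSize
  omega

theorem n_le : n ≤ P.inputSize c x := (Nat.le_mul_self n).trans sq_le

theorem denProd_le (f : Fin m → ℚ) : denProd f ≤ 2 ^ ∑ ℓ, bits (f ℓ).den := by
  rw [← Finset.prod_pow_eq_pow_sum]
  refine Finset.prod_le_prod (fun ℓ _ => by positivity) fun ℓ _ => ?_
  exact (le_abs_self _).trans (abs_lt_two_pow_bits _).le

theorem denProd_cost_le : denProd c ≤ 2 ^ P.inputSize c x := by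
  refine (denProd_le c).trans (pow_le_pow_right₀ (by norm_num) ?_)
  unfold inputSize
  refine le_trans ?_ (Nat.le_add_left _ _)
  exact Finset.sum_le_sum fun ℓ _ => by omega

theorem denProd_val_le : denProd x ≤ 2 ^ P.inputSize c x := by
  refine (denProd_le x).trans (pow_le_pow_right₀ (by norm_num) ?_)
  unfold inputSize
  refine le_trans ?_ (Nat.le_add_left _ _)
  exact Finset.sum_le_sum fun ℓ _ => by omega

/-- There are at most `2 ^ S` terms, each a numerator times a quotient of the common denominator,
both at most `2 ^ S`. -/
theorem sum_scaled_le {f : Fin m → ℚ} {S : ℕ} (hm : m ≤ 2 ^ S)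
    (hnum : ∀ ℓ, bits (f ℓ).num ≤ S) (hden : denProd f ≤ 2 ^ S) :
    ∑ ℓ, scaled f ℓ ≤ 2 ^ (3 * S) := by
  have hone : ∀ ℓ, scaled f ℓ ≤ 2 ^ S * 2 ^ S := by
    intro ℓ
    have h1 := (le_abs_self _).trans (abs_le_of_bits_le (hnum ℓ))
    have h2 : denProd f / (f ℓ).den ≤ 2 ^ S :=
      (Int.ediv_le_self _ (denProd_pos f).le).trans hden
    exact mul_le_mul h1 h2 (Int.ediv_nonneg (denProd_pos f).le (by positivity)) (by positivity)
  calc ∑ ℓ, scaled f ℓ ≤ ∑ _ℓ : Fin m, (2 ^ S * 2 ^ S : ℤ) := Finset.sum_le_sum fun ℓ _ => hone ℓ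
    _ = m * (2 ^ S * 2 ^ S) := by simp
    _ ≤ 2 ^ S * (2 ^ S * 2 ^ S) := by
      apply mul_le_mul_of_nonneg_right _ (by positivity)
      exact_mod_cast hm
    _ = 2 ^ (3 * S) := by ring

/-- A bound on all numbers in memory. -/
def numBound (S : ℕ) : ℤ := 2 ^ (3 * S + 2)

theorem two_pow_le_numBound (S : ℕ) : (2 : ℤ) ^ S ≤ numBound S :=
  pow_le_pow_right₀ (by norm_num) (by omega)

theorem linear_le_numBound (S : ℕ) : 4 * (S : ℤ) + 4 ≤ numBound S := by
  have h1 : (S : ℤ) + 1 ≤ 2 ^ S := by exact_mod_cast Nat.lt_two_pow_self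
  have h2 : (2 : ℤ) ^ S ≤ 2 ^ (3 * S) := pow_le_pow_right₀ (by norm_num) (by omega)
  have h3 : numBound S = 4 * 2 ^ (3 * S) := by unfold numBound; ring
  rw [h3]
  linarith

theorem small_inst {hc : ∀ ℓ, 0 ≤ c ℓ} {hx : ∀ ℓ, 0 ≤ x ℓ} :
    Small (P.inst (scaled c) (scaled x) (scaled_nonneg hc) (scaled_nonneg hx))
      (numBound (P.inputSize c x)) := by
  set S := P.inputSize c x with hS
  constructor
  · have h1 : n * n ≤ S := sq_le
    have h2 : 2 * m ≤ S := two_mul_m_le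
    have h3 : n ≤ S := n_le
    have h4 := linear_le_numBound S
    change ((n * n + 2 * m + n + 4 : ℕ) : ℤ) ≤ _
    refine le_trans ?_ h4
    exact_mod_cast (by omega : n * n + 2 * m + n + 4 ≤ 4 * S + 4)
  · have h1 := sum_scaled_le (S := S) (by
      have h2 : 2 * m ≤ S := two_mul_m_le
      have h3 : S < 2 ^ S := Nat.lt_two_pow_self
      omega) (fun ℓ => by have := link_bits_le (P := P) (c := c) (x := x) ℓ; omega) denProd_cost_le
    -- The summand 2 in the exponent of `numBound` pays for the factor 4 in `Small.cost`.
    have h3 : numBound S = 4 * 2 ^ (3 * S) := by unfold numBound; ring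
    rw [h3, Finset.sum_range]
    have : ∑ ℓ : Fin m, extend (scaled c) 0 ℓ = ∑ ℓ, scaled c ℓ :=
      Finset.sum_congr rfl fun ℓ _ => extend_val _ _ ℓ
    change 4 * ∑ ℓ : Fin m, extend (scaled c) 0 ℓ ≤ _
    rw [this]
    linarith

theorem sum_val_le : ∑ ℓ, scaled x ℓ ≤ numBound (P.inputSize c x) := by
  set S := P.inputSize c x with hS
  refine (sum_scaled_le (S := S) ?_ ?_ denProd_val_le).trans
    (pow_le_pow_right₀ (by norm_num) (by omega))
  · have h2 : 2 * m ≤ S := two_mul_m_le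
    have h3 : S < 2 ^ S := Nat.lt_two_pow_self
    omega
  · intro ℓ
    have := link_bits_le (P := P) (c := c) (x := x) ℓ
    omega

/-! ### The algorithm -/

/-- The program: derived sizes, then the main command. -/
def program : Prog :=
  .seq (.assign 3 (.mul (.var 0) (.var 0))) (.seq (.assign 4 (.add (.var 1) (.var 1)))
    (.seq (.assign 5 (.lit 3)) (mainCmd.comp 100)))

/-- Memory with the derived sizes. -/
noncomputable def sized (P : RootedPair n m) (c x : Fin m → ℚ) : State :=
  (((P.input c x).setV 3 (n * n)).setV 4 (m + m)).setV 5 3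

def mainDeg : ℕ := mainCmd.deg + 1

/-- The product is the exponent of `numBound S ^ mainDeg`; the other summands make the inequality in
`Ctx.pow_lt` strict and also dominate the size variables, which are at most `S + 3`. -/
def lenBound (S : ℕ) : ℕ := (3 * S + 2) * mainDeg + 4 * S + 5

/-- The parameters of the running time analysis. -/
def context (S : ℕ) : Ctx where
  B := numBound S
  D := mainDeg
  L := lenBound S
  two_le := by
    have := linear_le_numBound S
    omega
  one_le := Nat.le_add_left _ _
  pow_lt := by
    rw [numBound, ← pow_mul]
    exact pow_lt_pow_right₀ (by norm_num) (by unfold lenBound; omega)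

theorem start_sized : Start P c x (P.sized c x) where
  var_n := rfl
  var_m := rfl
  var_r := rfl
  var_nn := by simp [sized]
  var_mm := by simp [sized, input]; ring
  var_three := by simp [sized]
  adj := rfl
  src ℓ := arrayOf_val (fun ℓ => ((P.src ℓ : ℕ) : ℤ)) ℓ
  tgt ℓ := arrayOf_val (fun ℓ => ((P.tgt ℓ : ℕ) : ℤ)) ℓ
  cnum ℓ := arrayOf_val (fun ℓ => (c ℓ).num) ℓ
  cden ℓ := arrayOf_val (fun ℓ => ((c ℓ).den : ℤ)) ℓ
  xnum ℓ := arrayOf_val (fun ℓ => (x ℓ).num) ℓ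
  xden ℓ := arrayOf_val (fun ℓ => ((x ℓ).den : ℤ)) ℓ
  zero _ := rfl

theorem sized_var (P : RootedPair n m) (c x : Fin m → ℚ) (y : ℕ) :
    0 ≤ (P.sized c x).var y ∧ (P.sized c x).var y ≤ P.inputSize c x + 3 := by
  set S := P.inputSize c x with hS
  have h1 : n * n ≤ S := sq_le
  have h2 : 2 * m ≤ S := two_mul_m_le
  have h3 : n ≤ S := n_le
  have h4 := P.root.2
  match y with
  | 0 => exact ⟨by simp [sized, input], by simp [sized, input]; omega⟩
  | 1 => exact ⟨by simp [sized, input], by simp [sized, input]; omega⟩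
  | 2 => exact ⟨by simp [sized, input], by simp [sized, input]; omega⟩
  | 3 =>
    refine ⟨by simp [sized]; positivity, ?_⟩
    simp only [sized, State.setV_var]
    norm_num
    zify at h1
    linarith
  | 4 => exact ⟨by simp [sized], by simp [sized]; omega⟩
  | 5 => exact ⟨by simp [sized], by simp [sized]⟩
  | y + 6 => exact ⟨by simp [sized, input], by simp [sized, input]; omega⟩

theorem abs_sized_arr_le (P : RootedPair n m) (c x : Fin m → ℚ) (a : ℕ) (i : ℤ) :
    |(P.sized c x).arr a i| ≤ numBound (P.inputSize c x) := by
  set S := P.inputSize c x with hS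
  have hB := linear_le_numBound S
  have hB0 : 0 ≤ numBound S := by omega
  have hbit : ∀ {k : ℤ}, bits k ≤ S → |k| ≤ numBound S := fun h =>
    (abs_le_of_bits_le h).trans (two_pow_le_numBound S)
  have hl := link_bits_le (P := P) (c := c) (x := x)
  have key : ∀ f : Fin m → ℤ, (∀ ℓ, bits (f ℓ) ≤ S) → |arrayOf f i| ≤ numBound S :=
    fun f hf => abs_arrayOf_le hB0 (fun ℓ => hbit (hf ℓ)) i
  change |(P.input c x).arr a i| ≤ _
  match a with
  | 0 =>
    change |P.adjArray i| ≤ _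
    unfold adjArray
    by_cases h : i ∈ {k : ℤ | ∃ i j : Fin n, P.tree.Adj i j ∧ k = (i : ℤ) * n + j}
    · rw [Set.indicator_of_mem h]; simp; omega
    · rw [Set.indicator_of_notMem h]; simpa using hB0
  | 1 => exact key (fun ℓ => ((P.src ℓ : ℕ) : ℤ)) fun ℓ => by have := hl ℓ; omega
  | 2 => exact key (fun ℓ => ((P.tgt ℓ : ℕ) : ℤ)) fun ℓ => by have := hl ℓ; omega
  | 3 => exact key (fun ℓ => (c ℓ).num) fun ℓ => by have := hl ℓ; omega
  | 4 => exact key (fun ℓ => ((c ℓ).den : ℤ)) fun ℓ => by have := hl ℓ; omega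
  | 5 => exact key (fun ℓ => (x ℓ).num) fun ℓ => by have := hl ℓ; omega
  | 6 => exact key (fun ℓ => ((x ℓ).den : ℤ)) fun ℓ => by have := hl ℓ; omega
  | a + 7 =>
    change |(0 : ℤ)| ≤ _
    simpa using hB0

theorem good_sized : Good (context (P.inputSize c x)) (P.sized c x) := by
  set S := P.inputSize c x with hS
  have hB := linear_le_numBound S
  have hvar : ∀ y, |(P.sized c x).var y| ≤ numBound S := by
    intro y
    obtain ⟨h1, h2⟩ := P.sized_var c x y
    rw [abs_of_nonneg h1]
    omega
  refine ⟨fun y _ => (P.sized_var c x y).1, fun y _ => ?_, fun y _ => hvar y, P.abs_sized_arr_le c x,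
    fun y => (context S).lt_of_le (hvar y)⟩
  refine (P.sized_var c x y).2.trans ?_
  change _ ≤ ((lenBound S : ℕ) : ℤ)
  exact_mod_cast (by unfold lenBound; omega : S + 3 ≤ lenBound S)

/-- The bound on the running time. -/
noncomputable def timePoly : Polynomial ℕ :=
  (20 * (.X + 1) + mainCmd.time).comp ((3 * .X + 2) * .C mainDeg + 4 * .X + 5)

theorem eval_timePoly (S : ℕ) :
    timePoly.eval S = 20 * (lenBound S + 1) + mainCmd.time.eval (lenBound S) := by
  simp [timePoly, lenBound, Polynomial.eval_comp]

/-- The number λ enters only through the evaluation of the output: program and time bound are the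
same for all λ. -/
theorem exists_run_program {lam : ℝ} (hlam : 1 < lam) (hc : ∀ ℓ, P.cost ℓ = (c ℓ : ℝ))
    (hx : ∀ ℓ, P.z ℓ = (x ℓ : ℝ)) : ∃ (s : State) (t : ℕ), Run program (P.input c x) s t ∧
      t ≤ timePoly.eval (P.inputSize c x) ∧ P.IsRounding lam (s.output m) := by
  set S := P.inputSize c x with hS
  have hc0 : ∀ ℓ, 0 ≤ c ℓ := fun ℓ => by
    have := P.cost_nonneg ℓ
    rw [hc] at this
    exact_mod_cast this
  have hx0 : ∀ ℓ, 0 ≤ x ℓ := fun ℓ => by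
    have := P.z_nonneg ℓ
    rw [hx] at this
    exact_mod_cast this
  have hsmall := small_inst (P := P) (hc := hc0) (hx := hx0)
  have hwp : mainCmd.wp (context S).B (fun s' =>
      Kept (P.inst (scaled c) (scaled x) (scaled_nonneg hc0) (scaled_nonneg hx0)) s' ∧
      ∀ v < n, (P.inst (scaled c) (scaled x) (scaled_nonneg hc0) (scaled_nonneg hx0)).Bound v
        (s'.var 12)) (P.sized c x) :=
    wp_seq (setupCmd_wp (hc := hc0) (hx := hx0) start_sized hsmall sum_val_le
      (denProd_cost_le.trans (two_pow_le_numBound S)) (denProd_val_le.trans (two_pow_le_numBound S)))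
      fun s' henv _ => roundCmd_wp henv hsmall
  obtain ⟨s', t, σ', hrun, ht, hag, ⟨hk, hb⟩, -, -⟩ := exists_run_comp mainCmd_wf
    (show mainCmd.deg ≤ (context S).D from Nat.le_succ _) le_rfl hwp (Agree.refl _) good_sized
  have r1 := run_assign (P.input c x) 3 (.mul (.var 0) (.var 0))
  have r2 := run_assign ((P.input c x).setV 3 (n * n)) 4 (.add (.var 1) (.var 1))
  have r3 := run_assign (((P.input c x).setV 3 (n * n)).setV 4 (m + m)) 5 (.lit 3)
  refine ⟨s', _, .seq r1 (.seq r2 (.seq r3 hrun)), ?_, ?_⟩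
  · rw [eval_timePoly]
    have hbit : ∀ {k : ℤ}, 0 ≤ k → k ≤ S + 3 → bits k ≤ lenBound S := by
      intro k h0 h1
      refine bits_le ((context S).lt_of_le ?_)
      rw [abs_of_nonneg h0]
      have := linear_le_numBound S
      change k ≤ numBound S
      omega
    have b0 := hbit (P.sized_var c x 0).1 (P.sized_var c x 0).2
    have b1 := hbit (P.sized_var c x 1).1 (P.sized_var c x 1).2
    have b3 := hbit (P.sized_var c x 3).1 (P.sized_var c x 3).2
    have b4 := hbit (P.sized_var c x 4).1 (P.sized_var c x 4).2
    have b5 := hbit (P.sized_var c x 5).1 (P.sized_var c x 5).2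
    simp only [sized, State.setV_var, input] at b0 b1 b3 b4 b5
    norm_num at b0 b1 b3 b4 b5
    have ht' : t ≤ mainCmd.time.eval (lenBound S) := ht
    simp only [Expr.cost, Expr.eval, State.setV_var, input]
    norm_num
    omega
  · have hout : s'.output m = σ'.output m := by
      unfold State.output
      rw [hag.arr]
    rw [hout]
    refine isRounding_output hlam (D := denProd c) (E := denProd x)
      (by exact_mod_cast denProd_pos c) (by exact_mod_cast denProd_pos x) (fun ℓ => ?_) (fun ℓ => ?_)
      hk hb
    · rw [hc]
      exact_mod_cast congrArg (Rat.cast (K := ℝ)) (scaled_cast c ℓ)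
    · rw [hx]
      exact_mod_cast congrArg (Rat.cast (K := ℝ)) (scaled_cast x ℓ)

/-! ### Real costs and values -/

/-- The pair with other costs and values. -/
def withData (P : RootedPair n m) (c z : Fin m → ℝ) (hc : ∀ ℓ, 0 ≤ c ℓ) (hz : ∀ ℓ, P.z ℓ ≤ z ℓ) :
    RootedPair n m where
  tree := P.tree
  isTree := P.isTree
  root := P.root
  src := P.src
  tgt := P.tgt
  cost := c
  cost_nonneg := hc
  z := z
  z_nonneg ℓ := (P.z_nonneg ℓ).trans (hz ℓ)
  feasible e he := (P.feasible e he).trans (Finset.sum_le_sum fun ℓ _ =>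
    Set.indicator_le_indicator (hz ℓ))

/-- The costs and values for which a set of links is cheap enough. -/
def cheapData (P : RootedPair n m) (lam : ℝ) (S : Finset (Fin m)) :
    Set ((Fin m → ℝ) × (Fin m → ℝ)) :=
  {p | ∑ ℓ ∈ S, p.1 ℓ ≤ 2 * lam * ∑ ℓ, p.1 ℓ * (p.2 ℓ - Set.indicator {ℓ | P.IsCross ℓ} p.2 ℓ)
        + 4 * lam / (3 * (lam - 1)) * ∑ ℓ, p.1 ℓ * Set.indicator {ℓ | P.IsCross ℓ} p.2 ℓ}

theorem isClosed_cheapData (lam : ℝ) (S : Finset (Fin m)) : IsClosed (P.cheapData lam S) := by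
  have hind : ∀ ℓ : Fin m, Continuous fun p : (Fin m → ℝ) × (Fin m → ℝ) =>
      Set.indicator {ℓ | P.IsCross ℓ} p.2 ℓ := by
    intro ℓ
    by_cases h : ℓ ∈ {ℓ | P.IsCross ℓ}
    · simp only [Set.indicator_of_mem h]
      fun_prop
    · simp only [Set.indicator_of_notMem h]
      fun_prop
  refine isClosed_le ?_ ?_ <;> fun_prop

/-- For each of the finitely many covers the data for which it is cheap enough form a closed set,
hence so does their union. By the algorithm the union contains all rational data of this tree and
its links with nonnegative costs and a feasible `z`, and these approximate the given ones. -/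
theorem exists_isRounding {lam : ℝ} (hlam : 1 < lam) : ∃ S, P.IsRounding lam S := by
  set U : Set ((Fin m → ℝ) × (Fin m → ℝ)) :=
    ⋃ S : {S : Finset (Fin m) // P.CoversTree S}, P.cheapData lam S with hU
  have hclosed : IsClosed U := 
    isClosed_iUnion_of_finite fun S => isClosed_cheapData lam S.1
  have hmem : (P.cost, P.z) ∈ U := by
    rw [← hclosed.closure_eq, Metric.mem_closure_iff]
    intro ε hε
    -- Approximation from above keeps the costs nonnegative and the fractional solution feasible.
    have hq : ∀ a : ℝ, ∃ q : ℚ, a < q ∧ (q : ℝ) < a + ε := fun a => exists_rat_btwn (by linarith)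
    choose c hc1 hc2 using fun ℓ => hq (P.cost ℓ)
    choose x hx1 hx2 using fun ℓ => hq (P.z ℓ)
    set Q := P.withData (fun ℓ => c ℓ) (fun ℓ => x ℓ)
      (fun ℓ => (P.cost_nonneg ℓ).trans (hc1 ℓ).le) (fun ℓ => (hx1 ℓ).le) with hQ
    obtain ⟨s, -, -, -, h1, h2⟩ := exists_run_program (P := Q) (c := c) (x := x) hlam
      (fun _ => rfl) (fun _ => rfl)
    refine ⟨(fun ℓ => c ℓ, fun ℓ => x ℓ), Set.mem_iUnion.2 ⟨⟨s.output m, h1⟩, h2⟩, ?_⟩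
    rw [Prod.dist_eq, max_lt_iff, dist_pi_lt_iff hε, dist_pi_lt_iff hε]
    refine ⟨fun ℓ => ?_, fun ℓ => ?_⟩
    · have h3 := hc1 ℓ
      have h4 := hc2 ℓ
      rw [Real.dist_eq, abs_sub_lt_iff]
      constructor <;> dsimp only <;> linarith
    · have h3 := hx1 ℓ
      have h4 := hx2 ℓ
      rw [Real.dist_eq, abs_sub_lt_iff]
      constructor <;> dsimp only <;> linarith
  obtain ⟨⟨S, hS⟩, h⟩ := Set.mem_iUnion.1 hmem
  exact ⟨S, hS, h⟩

end RootedPair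

theorem mainTheorem4 (lam : ℝ) (hlam : 1 < lam) :
    (∀ (n m : ℕ) (P : RootedPair n m), ∃ S : Finset (Fin m), P.IsRounding lam S) ∧
    ∃ (p : RAM.Prog) (q : Polynomial ℕ),
      ∀ (n m : ℕ) (P : RootedPair n m) (c x : Fin m → ℚ),
        (∀ ℓ, P.cost ℓ = (c ℓ : ℝ)) → (∀ ℓ, P.z ℓ = (x ℓ : ℝ)) →
        ∃ (s : RAM.State) (t : ℕ),
          RAM.Run p (P.input c x) s t ∧ t ≤ q.eval (P.inputSize c x) ∧
            P.IsRounding lam (s.output m) :=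
  ⟨fun _ _ _ => RootedPair.exists_isRounding hlam, RootedPair.program, RootedPair.timePoly,
    fun _ _ _ _ _ hc hx => RootedPair.exists_run_program hlam hc hx⟩
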